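/- Let $Q$ be a Dynkin quiver (its underlying graph is of type $A_n$, $D_n$, $E_6$, $E_7$ or $E_8$), with finite dimensional representations over $\mathbb{C}$, and assume that $Q$ is special: $\dim\operatorname{Hom}(X,S(j))\le 1$ for every vertex $j$ and every indecomposable $X$, where $S(j)$ is the simple representation at $j$. Fix a vertex $i$. Let $\tau$ be the Auslander–Reiten translation and $\mu_B(M)$ the multiplicity of $B$ as a direct summand of $M$ ($\mu_0(M)=0$). Let $\mathcal{P}_i$ be the set of isomorphism classes of indecomposables $B$ with $\operatorname{Hom}(B,S(i))\neq0$, ordered by $B\unlhd B'\iff\operatorname{Hom}(B,B')\ne0$, and let $\mathcal{S}_i$ be the set of direct sums $V=X_1\oplus\dots\oplus X_k$ ($k\ge1$) over antichains $\{X_1,\dots,X_k\}$ in $\mathcal{P}_i$, ordered by $V\unlhd V'\iff\operatorname{Hom}(B,V')\neq 0$ for every indecomposable summand $B$ of $V$; $B\unlhd V$ is defined likewise. Put $$F_i(M,V)=\sum_{B\in\mathcal{P}_i,\ B\unlhd V}\bigl(\mu_B(M)-\mu_{\tau B}(M)\bigr),\qquad a_i^Q(M)=\max_{V\in\mathcal{S}_i}F_i(M,V).$$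 For a representation $M$, let $\mathcal{P}_M^\infty$ be the following oriented graph. Replace each vertex $B$ of the Hasse diagram of $\mathcal{P}_i$ by a chain $v_{B^{(1)}}\to\dots\to v_{B^{(l_B)}}$ with $l_B=\max(1,\mu_B(M),\mu_B(\tau^{-1}M))$, each arrow $B\to B'$ by $v_{B^{(l_B)}}\to v_{B'^{(1)}}$, and add a vertex $v_\infty$ with arrows $v_{B^{(l_B)}}\to v_\infty$ for the maximal $B$. Order the vertices by $v\unlhd w$ iff there is a path from $v$ to $w$, and let $V^{\downarrow}$ be the down-closure of a set $V$ of vertices. Let $W$ consist of the vertices $v_{B^{(k)}}$ with $1\le k\le\mu_B(M)$, and $R$ of those with $1\le k\le\mu_B(\tau^{-1}M)$. For sets of vertices $W_1,W_2$ let $\operatorname{Hom}_{\mathscr A}(W_1,W_2)$ be the set of maps $f:W_1\cup\{v_\infty\}\to W_2\cup\{v_\infty\}$ such that $w\unlhd f(w)$ for all $w$ and $f$ is injective on $\{w\in W_1: f(w)\ne v_\infty\}$. On $\operatorname{Hom}_{\mathscr A}(R,W)$ put $f\preceq g$ iff $g(R)=\rho(f(R))$ for some $\rho\in\operatorname{Hom}_{\mathscr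 A}(W,W)$; call $f$ $\preceq$-minimal if $g\preceq f$ implies $f\preceq g$. For $f\in\operatorname{Hom}_{\mathscr A}(R,W)$ put $\Phi(V)=\bigl(f(R\cap V^{\downarrow})\cup V\bigr)^{\downarrow}$ and $H_f(V)=\Phi^k(V)$, where $k$ is smallest with $\Phi^k(V)=\Phi^{k+1}(V)$. Fix decompositions of $M$ and $\tau^{-1}M$ into indecomposables. Let $B_j$ (resp. $C_k$) be the summands of $M$ (resp. $\tau^{-1}M$) lying in $\mathcal{P}_i$, labelled bijectively by the vertices in $W$ (resp. $R$), compatibly with isomorphism classes. A homomorphism $\phi:\tau^{-1}M\to M$ is combinatorial if it vanishes on the summands of $\tau^{-1}M$ not in $\mathcal{P}_i$ and, for each $k$, either $\phi|_{C_k}=0$ or $\phi$ maps $C_k$ into some $B_{j(k)}$ inducing an isomorphism $\operatorname{Hom}(B_{j(k)},S(i))\cong\operatorname{Hom}(C_k,S(i))$, where distinct $k$ have distinct $j(k)$. It is $\preceq$-minimal if it is combinatorial and the map $R\to W\cup\{v_\infty\}$ sending the label of $C_k$ to the label of $B_{j(k)}$, or to $v_\infty$ if $\phi|_{C_k}=0$,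 extended by $v_\infty\mapsto v_\infty$, is a $\preceq$-minimal element $f$ of $\operatorname{Hom}_{\mathscr A}(R,W)$. Let $M$ satisfy $a_i^Q(M)>0$. Then for every $\preceq$-minimal $\phi:\tau^{-1}M\to M$, with induced map $f$, the set $H_f(W\setminus f(R))$ does not contain $v_\infty$, and the direct sum $V^\phi$ of all $B\in\mathcal{P}_i$ such that some $v_{B^{(k)}}$ is a maximal element of this set is the unique $\unlhd$-minimal element among those $V\in\mathcal{S}_i$ at which $F_i(M,V)$ is maximal. In particular $V^\phi$ does not depend on the choice of $\phi$ (nor on the decompositions and labellings). -/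

import Mathlib

/-! # Representations of a quiver over `ℂ` -/

noncomputable section

namespace QuiverCrystal

/-- A representation over `ℂ` of a quiver with vertex type `I` (equivalently, a module over its path
algebra): a vector space at each vertex and a linear map for each arrow. -/
structure QRep (I : Type) [Quiver.{0} I] where
  /-- the vector space at a vertex -/
  V : I → Type
  [addCommGroup : ∀ v, AddCommGroup (V v)]
  [module : ∀ v, Module ℂ (V v)]
  /-- the linear map of an arrow -/
  map : ∀ {s t : I}, (s ⟶ t) → V s →ₗ[ℂ] V t

attribute [instance] QRep.addCommGroup QRep.module

namespace QRep

variable {I : Type} [Quiver.{0} I]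

/-- Finite dimensional representations, the objects of `ℂQ-mod`. -/
def FinDim (M : QRep I) : Prop := ∀ v, Module.Finite ℂ (M.V v)

/-- The zero representation. -/
def IsZero (M : QRep I) : Prop := ∀ v, Subsingleton (M.V v)

/-- The vector space of homomorphisms of representations. -/
def Hom (M N : QRep I) : Submodule ℂ (∀ v, M.V v →ₗ[ℂ] N.V v) where
  carrier := {f | ∀ (s t : I) (a : s ⟶ t), f t ∘ₗ M.map a = N.map a ∘ₗ f s}
  add_mem' {f g} hf hg s t a := by
    simp only [Pi.add_apply, LinearMap.add_comp, LinearMap.comp_add, hf s t a, hg s t a]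
  zero_mem' s t a := by simp
  smul_mem' c f hf s t a := by
    simp only [Pi.smul_apply, LinearMap.smul_comp, LinearMap.comp_smul, hf s t a]

/-- Composition `g ∘ f` of homomorphisms. -/
def comp {L M N : QRep I} (g : Hom M N) (f : Hom L M) : Hom L N :=
  ⟨fun v => g.1 v ∘ₗ f.1 v, fun s t a => by
    rw [LinearMap.comp_assoc, f.2 s t a, ← LinearMap.comp_assoc, g.2 s t a,
      LinearMap.comp_assoc]⟩

/-- An isomorphism of representations. -/
structure Iso (M N : QRep I) where
  /-- the linear isomorphism at a vertex -/
  equiv : ∀ v, M.V v ≃ₗ[ℂ] N.V v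
  comm : ∀ (s t : I) (a : s ⟶ t) (x : M.V s), equiv t (M.map a x) = N.map a (equiv s x)

/-- The underlying homomorphism of an isomorphism. -/
def Iso.hom {M N : QRep I} (e : Iso M N) : Hom M N :=
  ⟨fun v => (e.equiv v).toLinearMap, fun s t a => LinearMap.ext fun x => e.comm s t a x⟩

/-- The identity isomorphism. -/
def Iso.refl (M : QRep I) : Iso M M := ⟨fun v => LinearEquiv.refl ℂ (M.V v), fun _ _ _ _ => rfl⟩

/-- The inverse isomorphism. -/
def Iso.symm {M N : QRep I} (e : Iso M N) : Iso N M :=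
  ⟨fun v => (e.equiv v).symm, fun s t a x => by
    rw [LinearEquiv.symm_apply_eq, e.comm, LinearEquiv.apply_symm_apply]⟩

/-- The composite isomorphism. -/
def Iso.trans {L M N : QRep I} (e : Iso L M) (f : Iso M N) : Iso L N :=
  ⟨fun v => (e.equiv v).trans (f.equiv v), fun s t a x => by
    simp only [LinearEquiv.trans_apply, e.comm, f.comm]⟩

/-- Isomorphism of representations, as an equivalence relation. -/
instance isoSetoid (I : Type) [Quiver.{0} I] : Setoid (QRep I) where
  r M N := Nonempty (Iso M N)
  iseqv := ⟨fun M => ⟨Iso.refl M⟩, fun ⟨e⟩ => ⟨e.symm⟩, fun ⟨e⟩ ⟨f⟩ => ⟨e.trans f⟩⟩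

/-- The direct sum of two representations. -/
def prod (M N : QRep I) : QRep I where
  V v := M.V v × N.V v
  map a := (M.map a).prodMap (N.map a)

/-- The direct sum of a finite family of representations. -/
def dsum {J : Type} [Fintype J] (X : J → QRep I) : QRep I where
  V v := ∀ j, (X j).V v
  map a := LinearMap.pi fun j => (X j).map a ∘ₗ LinearMap.proj j

open Classical in
/-- The inclusion of a summand in a finite direct sum. -/
def dsumIncl {J : Type} [Fintype J] (X : J → QRep I) (j : J) : Hom (X j) (dsum X) :=
  ⟨fun v => LinearMap.single ℂ (fun j => (X j).V v) j, fun s t a => by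
    refine LinearMap.ext fun x => funext fun k => ?_
    change (Pi.single j ((X j).map a x) : ∀ j, (X j).V t) k =
      (X k).map a ((Pi.single j x : ∀ j, (X j).V s) k)
    by_cases h : k = j
    · subst h
      simp
    · simp [h]⟩

/-- Indecomposable: nonzero, and not the direct sum of two nonzero representations. -/
def Indecomposable (M : QRep I) : Prop :=
  ¬ M.IsZero ∧ ∀ A B : QRep I, Nonempty (Iso M (A.prod B)) → A.IsZero ∨ B.IsZero

open Classical in
/-- The multiplicity `μ_N(M)` of `N` as a direct summand of `M`: the largest `n` such that `N^n` is
a direct summand of `M`. For `N = 0` it is `0` by convention. -/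
def mult (N M : QRep I) : ℕ :=
  if N.IsZero then 0
  else sSup {n : ℕ | ∃ X : QRep I, Nonempty (Iso M ((dsum fun _ : Fin n => N).prod X))}

/-- The simple representation `S(i)`: one-dimensional at `i`, zero elsewhere (the space at `v` is
the space of functions to `ℂ` on the type `v = i`). -/
def simple (i : I) : QRep I where
  V v := PLift (v = i) → ℂ
  map _ := 0

/-! ## The Auslander-Reiten translations

For finite dimensional representations of a finite quiver without oriented cycles, with projectives
`P(j)` (spanned by the paths starting in `j`), injectives `I(j)` (functions on the paths ending in
`j`) and Nakayama functor `ν`, `ν P(j) = I(j)`: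
the standard resolution `0 → ⨁_{a : s → t} P(t) ⊗ M_s → ⨁_j P(j) ⊗ M_j → M → 0` gives
`τ M = ker (⨁_{a : s → t} I(t) ⊗ M_s → ⨁_j I(j) ⊗ M_j)`, and
the standard coresolution `0 → M → ⨁_j I(j) ⊗ M_j → ⨁_{a : s → t} I(s) ⊗ M_t → 0` gives
`τ⁻¹ M = coker (⨁_j P(j) ⊗ M_j → ⨁_{a : s → t} P(s) ⊗ M_t)`.
Here `I(j)_v ⊗ E` is the space of functions `Path v j → E` and `P(j)_v ⊗ E` the space of finitely
supported functions `Path j v →₀ E`. -/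

/-- The set of all arrows of the quiver; `⟨s, t, a⟩` is the arrow `a : s → t`. -/
abbrev Arr (I : Type) [Quiver.{0} I] : Type := Σ s : I, Σ t : I, (s ⟶ t)

open Classical in
/-- The element `p ⊗ m` of the summand `P(s) ⊗ M_t` of `⨁_{a : s → t} P(s) ⊗ M_t`. -/
def tauInvElem (M : QRep I) (v : I) (a : Arr I) (p : Quiver.Path a.1 v) (m : M.V a.2.1) :
    ∀ a : Arr I, Quiver.Path a.1 v →₀ M.V a.2.1 :=
  Pi.single a (Finsupp.single p m)

/-- The action of an arrow on `⨁_{a : s → t} P(s) ⊗ M_t`: it is appended to the paths. -/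
def tauInvStep (M : QRep I) {v w : I} (b : v ⟶ w) :
    (∀ a : Arr I, Quiver.Path a.1 v →₀ M.V a.2.1) →ₗ[ℂ]
      (∀ a : Arr I, Quiver.Path a.1 w →₀ M.V a.2.1) :=
  LinearMap.pi fun a =>
    Finsupp.lmapDomain (M.V a.2.1) ℂ (fun p : Quiver.Path a.1 v => p.cons b) ∘ₗ LinearMap.proj a

theorem tauInvStep_elem (M : QRep I) {v w : I} (b : v ⟶ w) (a : Arr I) (p : Quiver.Path a.1 v)
    (m : M.V a.2.1) :
    tauInvStep M b (tauInvElem M v a p m) = tauInvElem M w a (p.cons b) m := by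
  classical
  funext c
  by_cases h : c = a
  · subst h
    simp [tauInvStep, tauInvElem]
  · simp [tauInvStep, tauInvElem, h]

variable [Fintype I] [∀ s t : I, Fintype (s ⟶ t)]

/-- The Auslander-Reiten translation `τ M`. -/
def tau (M : QRep I) : QRep I where
  V v := ({
    carrier := {x | ∀ (j : I) (p : Quiver.Path v j),
      ∑ t : I, ∑ a : (j ⟶ t), x ⟨j, t, a⟩ (p.cons a) =
        ∑ s : I, ∑ a : (s ⟶ j), M.map a (x ⟨s, j, a⟩ p)}
    add_mem' := fun {x y} hx hy j p => by
      simp only [Pi.add_apply, map_add, Finset.sum_add_distrib, hx j p, hy j p]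
    zero_mem' := fun j p => by simp
    smul_mem' := fun c x hx j p => by
      simp only [Pi.smul_apply, map_smul, ← Finset.smul_sum, hx j p] } :
    Submodule ℂ (∀ a : Arr I, Quiver.Path v a.2.1 → M.V a.1))
  map {v w} b :=
    LinearMap.codRestrict _
      ({ toFun := fun x a p => x.1 a (b.toPath.comp p)
         map_add' := fun _ _ => rfl
         map_smul' := fun _ _ => rfl } : _ →ₗ[ℂ] (∀ a : Arr I, Quiver.Path w a.2.1 → M.V a.1))
      (fun x j p => x.2 j (b.toPath.comp p))

/-- The image of `p ⊗ m ∈ P(j) ⊗ M_j` in `⨁_{a : s → t} P(s) ⊗ M_t`. -/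
def tauInvRel (M : QRep I) (v j : I) (p : Quiver.Path j v) (m : M.V j) :
    ∀ a : Arr I, Quiver.Path a.1 v →₀ M.V a.2.1 :=
  (∑ s : I, ∑ a : (s ⟶ j), tauInvElem M v ⟨s, j, a⟩ (a.toPath.comp p) m) -
    ∑ t : I, ∑ a : (j ⟶ t), tauInvElem M v ⟨j, t, a⟩ p (M.map a m)

/-- The image of `⨁_j P(j) ⊗ M_j` in `⨁_{a : s → t} P(s) ⊗ M_t`, at the vertex `v`. -/
def tauInvSpan (M : QRep I) (v : I) :
    Submodule ℂ (∀ a : Arr I, Quiver.Path a.1 v →₀ M.V a.2.1) :=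
  Submodule.span ℂ {y | ∃ (j : I) (p : Quiver.Path j v) (m : M.V j), y = tauInvRel M v j p m}

theorem tauInvSpan_le (M : QRep I) {v w : I} (b : v ⟶ w) :
    tauInvSpan M v ≤ (tauInvSpan M w).comap (tauInvStep M b) := by
  refine Submodule.span_le.2 ?_
  rintro _ ⟨j, p, m, rfl⟩
  refine Submodule.subset_span ⟨j, p.cons b, m, ?_⟩
  simp only [tauInvRel, map_sub, map_sum, tauInvStep_elem, Quiver.Path.comp_cons]

/-- The inverse Auslander-Reiten translation `τ⁻¹ M`. -/
def tauInv (M : QRep I) : QRep I where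
  V v := (∀ a : Arr I, Quiver.Path a.1 v →₀ M.V a.2.1) ⧸ tauInvSpan M v
  map b := (tauInvSpan M _).mapQ (tauInvSpan M _) (tauInvStep M b) (tauInvSpan_le M b)

end QRep

/-! # Special Dynkin quivers -/

/-- The matrix with entries `2 δ_{v w} - #(arrows between v and w)`. -/
def quiverCartan (I : Type) [Quiver.{0} I] [∀ s t : I, Fintype (s ⟶ t)] : Matrix I I ℤ :=
  open Classical in
  fun v w => (if v = w then 2 else 0) - Fintype.card (v ⟶ w) - Fintype.card (w ⟶ v)

/-- A Dynkin quiver: the underlying graph is a Dynkin diagram of type `A_n` (`n ≥ 1`), `D_n`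
(`n ≥ 4`), `E₆`, `E₇` or `E₈`. -/
def IsDynkinQuiver (I : Type) [Quiver.{0} I] [∀ s t : I, Fintype (s ⟶ t)] : Prop :=
  (∃ n, 1 ≤ n ∧ ∃ e : I ≃ Fin n, (quiverCartan I).reindex e e = CartanMatrix.A n) ∨
  (∃ n, 4 ≤ n ∧ ∃ e : I ≃ Fin n, (quiverCartan I).reindex e e = CartanMatrix.D n) ∨
  (∃ e : I ≃ Fin 6, (quiverCartan I).reindex e e = CartanMatrix.E₆) ∨
  (∃ e : I ≃ Fin 7, (quiverCartan I).reindex e e = CartanMatrix.E₇) ∨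
  (∃ e : I ≃ Fin 8, (quiverCartan I).reindex e e = CartanMatrix.E₈)

/-- A quiver is special if `dim Hom(X, S(i)) ≤ 1` for all vertices `i` and all indecomposable
finite dimensional representations `X`. -/
def IsSpecialQuiver (I : Type) [Quiver.{0} I] : Prop :=
  ∀ (i : I) (X : QRep I), X.FinDim → X.Indecomposable →
    Module.finrank ℂ (QRep.Hom X (QRep.simple i)) ≤ 1

/-! # The sets `𝒫_i(Q)` and `𝒮_i(Q)` -/

section Posets

variable {I : Type} [Quiver.{0} I]

/-- `X` is an indecomposable finite dimensional representation with `dim Hom(X, S(i)) ≠ 0`. -/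
def InP (i : I) (X : QRep I) : Prop :=
  X.FinDim ∧ X.Indecomposable ∧ Module.finrank ℂ (QRep.Hom X (QRep.simple i)) ≠ 0

/-- `𝒫_i(Q)`, as a set of isomorphism classes; `B.rep` is a fixed representative. -/
def P (i : I) : Type 1 :=
  {B : Quotient (QRep.isoSetoid I) // InP i B.out}

/-- A fixed representative of an element of `𝒫_i(Q)`. -/
def P.rep {i : I} (B : P i) : QRep I := B.1.out

/-- The relation `B ⊴ B'` on `𝒫_i(Q)`: there is a nonzero homomorphism from `B` to `B'`. -/
def P.le {i : I} (B B' : P i) : Prop := ∃ f : QRep.Hom B.rep B'.rep, f ≠ 0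

/-- `B ◁ B'`. -/
def P.lt {i : I} (B B' : P i) : Prop := B.le B' ∧ B ≠ B'

/-- `B ◁ B'` minimally, i.e. `B → B'` is an arrow of the Hasse diagram. -/
def P.covers {i : I} (B B' : P i) : Prop := B.lt B' ∧ ¬ ∃ C : P i, B.lt C ∧ C.lt B'

/-- `B` is a `⊴`-maximal element of `𝒫_i(Q)`. -/
def P.isMaximal {i : I} (B : P i) : Prop := ∀ C : P i, B.le C → C = B

/-- `𝒮_i(Q)`: finite nonempty antichains of `𝒫_i(Q)`. The antichain `{X_1, …, X_k}` stands for the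
representation `X_1 ⊕ ⋯ ⊕ X_k`. -/
def S (i : I) : Set (Set (P i)) :=
  {V | V.Finite ∧ V.Nonempty ∧ ∀ B ∈ V, ∀ B' ∈ V, B.le B' → B = B'}

/-- `B ⊴ V` for `B ∈ 𝒫_i(Q)` and `V ∈ 𝒮_i(Q)`. -/
def P.leS {i : I} (B : P i) (V : Set (P i)) : Prop := ∃ B' ∈ V, B.le B'

/-- `V ⊴ V'` for `V, V' ∈ 𝒮_i(Q)`. -/
def leS {i : I} (V V' : Set (P i)) : Prop := ∀ B ∈ V, B.leS V'

variable [Fintype I] [∀ s t : I, Fintype (s ⟶ t)]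

/-- `F_i(M, V) = ∑_{B ∈ 𝒫_i(Q), B ⊴ V} (μ_B(M) - μ_{τ B}(M))`. -/
def F (i : I) (M : QRep I) (V : Set (P i)) : ℤ :=
  ∑ᶠ (B : P i) (_ : B.leS V), ((B.rep.mult M : ℤ) - ((QRep.tau B.rep).mult M : ℤ))

/-- `a_i^Q(M)`, the maximum of `F_i(M, V)` over `V ∈ 𝒮_i(Q)`. -/
def aQ (i : I) (M : QRep I) : ℤ := sSup (F i M '' S i)

/-- `V` is an element of `𝒮_i(Q)` at which `F_i(M, V)` is maximal. -/
def IsMaximizer (i : I) (M : QRep I) (V : Set (P i)) : Prop :=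
  V ∈ S i ∧ ∀ V' ∈ S i, F i M V' ≤ F i M V

/-- `V` is `⊴`-minimal among the elements of `𝒮_i(Q)` at which `F_i(M, V)` is maximal. -/
def IsMinimalMaximizer (i : I) (M : QRep I) (V : Set (P i)) : Prop :=
  IsMaximizer i M V ∧ ∀ V', IsMaximizer i M V' → leS V' V → V' = V

/-! # The graph `𝒫_M^∞` -/

/-- The length `l_B = max(1, μ_B(M), μ_B(τ⁻¹ M))` of the chain that replaces `B`. -/
def chainLength (i : I) (M : QRep I) (B : P i) : ℕ :=
  max 1 (max (B.rep.mult M) (B.rep.mult M.tauInv))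

/-- The vertices of the graph `𝒫_M^∞`. The vertex `v_{B^{(k)}}`, `1 ≤ k ≤ l_B`, is `copy B n` with
`n = k - 1`. -/
inductive Vert (i : I) (M : QRep I) : Type 1
  | copy (B : P i) (n : Fin (chainLength i M B)) : Vert i M
  | infty : Vert i M

/-- The arrows of the graph `𝒫_M^∞`. -/
def Vert.arrow {i : I} {M : QRep I} : Vert i M → Vert i M → Prop
  | .copy B m, .copy B' n =>
      (B = B' ∧ (m : ℕ) + 1 = n) ∨
        (B.covers B' ∧ (m : ℕ) + 1 = chainLength i M B ∧ (n : ℕ) = 0)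
  | .copy B m, .infty => B.isMaximal ∧ (m : ℕ) + 1 = chainLength i M B
  | .infty, _ => False

/-- The order on the vertices of `𝒫_M^∞`: there is a path from `v` to `w`. -/
def Vert.le {i : I} {M : QRep I} (v w : Vert i M) : Prop := Relation.ReflTransGen Vert.arrow v w

/-- The set `W` of white vertices, `v_{B^{(1)}}, …, v_{B^{(μ_B(M))}}` for each `B`. -/
def white (i : I) (M : QRep I) : Set (Vert i M) :=
  {v | ∃ B n, v = .copy B n ∧ (n : ℕ) < B.rep.mult M}

/-- The set `R` of red vertices, `v_{B^{(1)}}, …, v_{B^{(μ_B(τ⁻¹ M))}}` for each `B`. -/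
def red (i : I) (M : QRep I) : Set (Vert i M) :=
  {v | ∃ B n, v = .copy B n ∧ (n : ℕ) < B.rep.mult M.tauInv}

/-- `V^↓`. -/
def down {i : I} {M : QRep I} (V : Set (Vert i M)) : Set (Vert i M) :=
  {v | ∃ w ∈ V, v.le w}

/-- `f` is a morphism `W₁ → W₂` of the category `𝒜`, i.e. it maps `W₁ ∪ {v_∞}` to `W₂ ∪ {v_∞}`,
`w ⊴ f(w)` for all `w` (in particular `f(v_∞) = v_∞`), and `f` is injective on the elements of `W₁`
not mapped to `v_∞`. Only the restriction of `f` to `W₁ ∪ {v_∞}` is relevant. -/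
def IsMor {i : I} {M : QRep I} (W₁ W₂ : Set (Vert i M)) (f : Vert i M → Vert i M) : Prop :=
  Set.MapsTo f (insert .infty W₁) (insert .infty W₂) ∧
    (∀ w ∈ insert Vert.infty W₁, w.le (f w)) ∧ Set.InjOn f {w | w ∈ W₁ ∧ f w ≠ .infty}

/-- The preorder `φ ⪯ ψ` on `Hom_𝒜(R, W)`. -/
def precLe {i : I} {M : QRep I} (φ ψ : Vert i M → Vert i M) : Prop :=
  ∃ ρ, IsMor (white i M) (white i M) ρ ∧ ψ '' red i M = ρ '' (φ '' red i M)

/-- `φ` is a `⪯`-minimal element of `Hom_𝒜(R, W)`. -/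
def IsPrecMinimal {i : I} {M : QRep I} (φ : Vert i M → Vert i M) : Prop :=
  IsMor (red i M) (white i M) φ ∧
    ∀ ψ, IsMor (red i M) (white i M) ψ → precLe ψ φ → precLe φ ψ

/-- The operator `Φ(V) = (φ(R ∩ V^↓) ∪ V)^↓`. -/
def stepOp {i : I} {M : QRep I} (φ : Vert i M → Vert i M) (V : Set (Vert i M)) :
    Set (Vert i M) :=
  down (φ '' (red i M ∩ down V) ∪ V)

/-- The closure operator `H_φ(V) = Φ^k(V)`, `k` smallest with `Φ^k(V) = Φ^{k+1}(V)`. -/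
def closureOp {i : I} {M : QRep I} (φ : Vert i M → Vert i M) (V : Set (Vert i M)) :
    Set (Vert i M) :=
  (stepOp φ)^[sInf {k : ℕ | (stepOp φ)^[k] V = (stepOp φ)^[k + 1] V}] V

/-- `V^φ = H_φ(W ∖ φ(R))`, as a set of vertices of `𝒫_M^∞`. -/
def hull {i : I} {M : QRep I} (φ : Vert i M → Vert i M) : Set (Vert i M) :=
  closureOp φ (white i M \ φ '' red i M)

/-- The antichain of `𝒫_i(Q)` given by `V^φ`: all `B` such that some vertex `v_{B^{(k)}}` is a
`⊴`-maximal element of `V^φ`. -/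
def hullAntichain {i : I} {M : QRep I} (φ : Vert i M → Vert i M) : Set (P i) :=
  {B | ∃ n, Vert.copy B n ∈ hull φ ∧ ∀ w ∈ hull φ, (Vert.copy B n).le w → w = .copy B n}

end Posets

/-! # Combinatorial homomorphisms -/

section Combinatorial

variable {I : Type} [Quiver.{0} I]

/-- A decomposition of a representation into a finite direct sum of indecomposables. -/
structure Decomp (M : QRep I) where
  /-- the index set of the summands -/
  J : Type
  [fintype : Fintype J]
  /-- the indecomposable summands -/
  X : J → QRep I
  indecomposable : ∀ j, (X j).Indecomposable
  /-- the identification of the direct sum with `M` -/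
  iso : QRep.Iso (QRep.dsum X) M

attribute [instance] Decomp.fintype

/-- The inclusion of a summand. -/
def Decomp.incl {M : QRep I} (D : Decomp M) (j : D.J) : QRep.Hom (D.X j) M :=
  QRep.comp D.iso.hom (QRep.dsumIncl D.X j)

variable [Fintype I] [∀ s t : I, Fintype (s ⟶ t)]

/-- The vertex `v` of `𝒫_M^∞` is one of the vertices `v_{B^{(k)}}` with `B ≅ X`. -/
def Vert.isCopyOf {i : I} {M : QRep I} : Vert i M → QRep I → Prop
  | .copy B _, X => Nonempty (QRep.Iso B.rep X)
  | .infty, _ => False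

/-- A labelling of the summands in `𝒫_i(Q)` of a decomposition by the vertices in `T`: a bijection
that sends a summand isomorphic to `B` to one of the vertices `v_{B^{(k)}}`. -/
structure Labelling {N : QRep I} (D : Decomp N) {i : I} {M : QRep I} (T : Set (Vert i M)) where
  /-- the bijection -/
  label : {j : D.J // InP i (D.X j)} ≃ T
  isCopyOf : ∀ j, (label j : Vert i M).isCopyOf (D.X j)

/-- `φ|_{C_k}` has image in `B_j` and induces an isomorphism `Hom(B_j, S(i)) ≅ Hom(C_k, S(i))`. -/
def Hits (i : I) {M : QRep I} (D : Decomp M) (E : Decomp M.tauInv)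
    (φ : QRep.Hom M.tauInv M) (k : E.J) (j : D.J) : Prop :=
  ∃ g : QRep.Hom (E.X k) (D.X j), QRep.comp φ (E.incl k) = QRep.comp (D.incl j) g ∧
    Function.Bijective fun h : QRep.Hom (D.X j) (QRep.simple i) => QRep.comp h g

/-- `φ : τ⁻¹ M → M` is combinatorial with respect to the chosen decompositions. (The summands `X`
with `X ⊴ S(i)` are those in `𝒫_i(Q)`.) -/
def IsCombinatorial (i : I) {M : QRep I} (D : Decomp M) (E : Decomp M.tauInv)
    (φ : QRep.Hom M.tauInv M) : Prop :=
  (∀ k, ¬ InP i (E.X k) → QRep.comp φ (E.incl k) = 0) ∧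
  (∀ k, InP i (E.X k) → QRep.comp φ (E.incl k) = 0 ∨ ∃ j, InP i (D.X j) ∧ Hits i D E φ k j) ∧
  (∀ k k' j, InP i (E.X k) → InP i (E.X k') → InP i (D.X j) →
    Hits i D E φ k j → Hits i D E φ k' j → k = k')

/-- `φ : τ⁻¹ M → M` induces `f : R → W`: the vertex of `C_k` is sent to the vertex of `B_j` if `φ`
maps `C_k` to `B_j` (inducing an isomorphism on `Hom(-, S(i))`), and to `v_∞` if `φ` is zero
on `C_k`. -/
def Induces {i : I} {M : QRep I} {D : Decomp M} {E : Decomp M.tauInv}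
    (σ : Labelling D (white i M)) (ρ : Labelling E (red i M))
    (φ : QRep.Hom M.tauInv M) (f : Vert i M → Vert i M) : Prop :=
  (∀ k : {k : E.J // InP i (E.X k)}, QRep.comp φ (E.incl k) = 0 → f (ρ.label k) = .infty) ∧
  (∀ (k : {k : E.J // InP i (E.X k)}) (j : {j : D.J // InP i (D.X j)}),
    Hits i D E φ k j → f (ρ.label k) = σ.label j)

/-- A `⪯`-minimal homomorphism `τ⁻¹ M → M`, together with the choices it refers to: decompositions
of `M` and `τ⁻¹ M` into indecomposables, labellings of their summands in `𝒫_i(Q)` by the white and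
the red vertices of `𝒫_M^∞`, and the induced `⪯`-minimal element of `Hom_𝒜(R, W)`. -/
structure MinimalHom (i : I) (M : QRep I) where
  /-- the homomorphism -/
  φ : QRep.Hom M.tauInv M
  /-- the decomposition of `M` -/
  D : Decomp M
  /-- the decomposition of `τ⁻¹ M` -/
  E : Decomp M.tauInv
  /-- the white vertex of a summand of `M` -/
  σ : Labelling D (white i M)
  /-- the red vertex of a summand of `τ⁻¹ M` -/
  ρ : Labelling E (red i M)
  /-- the induced morphism from `R` to `W` -/
  f : Vert i M → Vert i M
  combinatorial : IsCombinatorial i D E φ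
  induces : Induces σ ρ φ f
  minimal : IsPrecMinimal f

end Combinatorial

end QuiverCrystal

end

open QuiverCrystal

/-!
Fix a `⪯`-minimal morphism `f : R → W`. Everything rests on two inputs from representation theory and
one matching argument.

**The counting function.** Since `μ_{τB}(M) = μ_B(τ⁻¹M)` (`QRep.mult_tau`), the number `F_i(M, V)`
is the number of vertices in `W` minus the number of those in `R` inside the lower set of
`𝒫_M^∞` consisting of the full chains below `V` (`F_eq_excess`). The equality of multiplicities comes
from the explicit description of `τ` and `τ⁻¹`: both `Hom(τ⁻¹M, Y)` and `Hom(M, τY)` are the space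
`QRep.Theta M Y`, which the trace pairing makes dual to `Ext¹(Y, M)`; hence `τ⁻¹τY ≅ Y` for
indecomposable `Y` with `τY ≠ 0`.

**The order.** For a Dynkin quiver the Euler form is positive definite
(`QRep.eulerPosDef_of_isDynkinQuiver`). So indecomposables are bricks without self-extensions
(`QRep.Indecomposable.brick_and_extZero`), they are finite in number and determined by their dimension
vectors, and they are directed, because `τ` is nilpotent and acts on dimension vectors by the Coxeter
transformation (`QRep.exists_height`). For a special quiver, nonzero maps between elements of `𝒫_i`
can be chosen to commute with nonzero maps to `S(i)` (`QRep.exists_comp_ne_zero`). Hence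
`B ⊴ B' ↔ Hom(B, B') ≠ 0` is a partial order on the finite set `𝒫_i` (`P.isPartialOrder`).

**The matching.** If `v_∞` were in `H_f(W \ f(R))`, an alternating chain would lead from a vertex of
`W \ f(R)` to `v_∞`; changing `f` along it would add a vertex to the image and so give a strictly
smaller morphism (`infty_notMem_hull`). For a lower set `D` without `v_∞`, the difference
`|W ∩ D| - |R ∩ D|` is `|(W ∩ D) \ f(R)|` minus the number of `r ∈ R ∩ D` with `f(r) ∉ D`
(`excess_eq`). It is therefore at most `|W \ f(R)|`, with equality if and only if `D` contains
`W \ f(R)` and is stable under `f`. The least such `D` is `H_f(W \ f(R))`. Being least, it is a union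
of full chains (`hull_full`), so it is the lower set below `V^φ`, and `V^φ` lies below all maximizers.
-/

noncomputable section

set_option linter.unusedSectionVars false

namespace QuiverCrystal

namespace QRep

variable {I : Type} [Quiver.{0} I]

/-! ### Homomorphisms, subrepresentations and retracts -/

@[simp] theorem comp_apply {L M N : QRep I} (g : Hom M N) (f : Hom L M) (v : I) (x : L.V v) :
    (comp g f).1 v x = g.1 v (f.1 v x) := rfl

theorem hom_ext {M N : QRep I} {f g : Hom M N} (h : ∀ v x, f.1 v x = g.1 v x) : f = g :=
  Subtype.ext (funext fun v => LinearMap.ext (h v))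

theorem hom_map {M N : QRep I} (f : Hom M N) {s t : I} (a : s ⟶ t) (x : M.V s) :
    f.1 t (M.map a x) = N.map a (f.1 s x) := LinearMap.congr_fun (f.2 s t a) x

@[simp] theorem hom_zero_apply {M N : QRep I} (v : I) (x : M.V v) :
    (0 : Hom M N).1 v x = 0 := rfl

@[simp] theorem hom_add_apply {M N : QRep I} (f g : Hom M N) (v : I) (x : M.V v) :
    (f + g).1 v x = f.1 v x + g.1 v x := rfl

@[simp] theorem hom_sub_apply {M N : QRep I} (f g : Hom M N) (v : I) (x : M.V v) :
    (f - g).1 v x = f.1 v x - g.1 v x := rfl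

@[simp] theorem hom_smul_apply {M N : QRep I} (c : ℂ) (f : Hom M N) (v : I) (x : M.V v) :
    (c • f).1 v x = c • f.1 v x := rfl

@[simp] theorem hom_sum_apply {M N : QRep I} {J : Type} (s : Finset J) (f : J → Hom M N) (v : I)
    (x : M.V v) : (∑ j ∈ s, f j).1 v x = ∑ j ∈ s, (f j).1 v x := by
  induction s using Finset.cons_induction with
  | empty => simp
  | cons a s h ih => rw [Finset.sum_cons, hom_add_apply, ih, Finset.sum_cons]

/-- A homomorphism from compatible linear maps. -/
def mkHom {M N : QRep I} (f : ∀ v, M.V v →ₗ[ℂ] N.V v)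
    (h : ∀ (s t : I) (a : s ⟶ t) (x : M.V s), f t (M.map a x) = N.map a (f s x)) : Hom M N :=
  ⟨f, fun s t a => LinearMap.ext (h s t a)⟩

/-- The identity homomorphism. -/
def idHom (M : QRep I) : Hom M M := mkHom (fun _ => LinearMap.id) fun _ _ _ _ => rfl

@[simp] theorem idHom_apply {M : QRep I} (v : I) (x : M.V v) : (idHom M).1 v x = x := rfl

@[simp] theorem Iso.symm_hom_apply {M N : QRep I} (e : Iso M N) (v : I) (x : M.V v) :
    e.symm.hom.1 v (e.hom.1 v x) = x := (e.equiv v).symm_apply_apply x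

@[simp] theorem Iso.hom_symm_apply {M N : QRep I} (e : Iso M N) (v : I) (x : N.V v) :
    e.hom.1 v (e.symm.hom.1 v x) = x := (e.equiv v).apply_symm_apply x

/-- A homomorphism that is bijective at every vertex is an isomorphism. -/
def isoOfBijective {M N : QRep I} (f : Hom M N) (h : ∀ v, Function.Bijective (f.1 v)) : Iso M N :=
  ⟨fun v => LinearEquiv.ofBijective (f.1 v) (h v), fun _ _ a x => hom_map f a x⟩

/-- Mutually inverse homomorphisms give an isomorphism. -/
def isoOfInverse {M N : QRep I} (f : Hom M N) (g : Hom N M) (h : ∀ v x, g.1 v (f.1 v x) = x)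
    (h' : ∀ v x, f.1 v (g.1 v x) = x) : Iso M N :=
  isoOfBijective f fun v => Function.bijective_iff_has_inverse.2 ⟨g.1 v, h v, h' v⟩

theorem hom_ne_zero_iff {M N : QRep I} (f : Hom M N) : f ≠ 0 ↔ ∃ v x, f.1 v x ≠ 0 := by
  constructor
  · intro h
    by_contra! h'
    exact h (hom_ext h')
  · rintro ⟨v, x, h⟩ rfl
    exact h rfl

theorem hom_eq_zero_of_isZero_left {M N : QRep I} (h : M.IsZero) (f : Hom M N) : f = 0 :=
  hom_ext fun v x => by
    have := h v
    rw [Subsingleton.elim x 0, map_zero, map_zero]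

theorem hom_eq_zero_of_isZero_right {M N : QRep I} (h : N.IsZero) (f : Hom M N) : f = 0 :=
  hom_ext fun v _ => by
    have := h v
    exact Subsingleton.elim _ _

theorem isZero_iff_idHom {M : QRep I} : M.IsZero ↔ idHom M = 0 := by
  refine ⟨fun h => hom_eq_zero_of_isZero_left h _, fun h v => ⟨fun x y => ?_⟩⟩
  have := fun x => congrArg (fun f : Hom M M => f.1 v x) h
  simp only [idHom_apply, hom_zero_apply] at this
  rw [this x, this y]

theorem Iso.isZero_iff {M N : QRep I} (e : Iso M N) : M.IsZero ↔ N.IsZero :=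
  ⟨fun h v => have := h v; (e.equiv v).symm.toEquiv.subsingleton,
    fun h v => have := h v; (e.equiv v).toEquiv.subsingleton⟩

theorem FinDim.of_iso {M N : QRep I} (h : M.FinDim) (e : Iso M N) : N.FinDim := fun v =>
  have := h v
  Module.Finite.equiv (e.equiv v)

/-- The subrepresentation on a family of subspaces that is stable under the arrows. -/
def subrep (M : QRep I) (U : ∀ v, Submodule ℂ (M.V v))
    (hU : ∀ (s t : I) (a : s ⟶ t), ∀ x ∈ U s, M.map a x ∈ U t) : QRep I where
  V v := U v
  map {s t} a := (M.map a).restrict (hU s t a)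

section subrep

variable {M : QRep I} {U : ∀ v, Submodule ℂ (M.V v)}
  {hU : ∀ (s t : I) (a : s ⟶ t), ∀ x ∈ U s, M.map a x ∈ U t}

/-- The inclusion of a subrepresentation. -/
def subIncl (hU : ∀ (s t : I) (a : s ⟶ t), ∀ x ∈ U s, M.map a x ∈ U t) : Hom (subrep M U hU) M :=
  mkHom (fun v => (U v).subtype) fun _ _ _ _ => rfl

/-- A homomorphism with image in a subrepresentation. -/
def subLift (hU : ∀ (s t : I) (a : s ⟶ t), ∀ x ∈ U s, M.map a x ∈ U t) {N : QRep I} (f : Hom N M)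
    (h : ∀ v x, f.1 v x ∈ U v) : Hom N (subrep M U hU) :=
  mkHom (fun v => (f.1 v).codRestrict (U v) (h v)) fun _ _ a x => Subtype.ext (hom_map f a x)

theorem subIncl_injective (v : I) : Function.Injective ((subIncl hU).1 v) :=
  Subtype.val_injective

theorem subIncl_mem (v : I) (x : (subrep M U hU).V v) : (subIncl hU).1 v x ∈ U v := x.2

theorem subrep_finDim (h : M.FinDim) : (subrep M U hU).FinDim := fun v => by
  have := h v
  exact inferInstanceAs (Module.Finite ℂ (U v))

/-- The quotient by a subrepresentation. -/
def quotRep (hU : ∀ (s t : I) (a : s ⟶ t), ∀ x ∈ U s, M.map a x ∈ U t) : QRep I where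
  V v := M.V v ⧸ U v
  map {s t} a := (U s).mapQ (U t) (M.map a) (hU s t a)

/-- The projection to a quotient. -/
def quotMk (hU : ∀ (s t : I) (a : s ⟶ t), ∀ x ∈ U s, M.map a x ∈ U t) : Hom M (quotRep hU) :=
  mkHom (fun v => (U v).mkQ) fun _ _ _ _ => rfl

theorem quotMk_surjective (v : I) : Function.Surjective ((quotMk hU).1 v) :=
  Submodule.mkQ_surjective _

theorem ker_quotMk (v : I) : LinearMap.ker ((quotMk hU).1 v) = U v := Submodule.ker_mkQ _

theorem quotRep_finDim (h : M.FinDim) : (quotRep hU).FinDim := fun v => by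
  have := h v
  exact inferInstanceAs (Module.Finite ℂ (M.V v ⧸ U v))

end subrep

theorem ker_stable {M N : QRep I} (f : Hom M N) (s t : I) (a : s ⟶ t) :
    ∀ x ∈ LinearMap.ker (f.1 s), M.map a x ∈ LinearMap.ker (f.1 t) := fun x hx => by
  rw [LinearMap.mem_ker] at hx ⊢
  rw [hom_map, hx, map_zero]

theorem range_stable {M N : QRep I} (f : Hom M N) (s t : I) (a : s ⟶ t) :
    ∀ x ∈ LinearMap.range (f.1 s), N.map a x ∈ LinearMap.range (f.1 t) := by
  rintro _ ⟨x, rfl⟩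
  exact ⟨M.map a x, hom_map f a x⟩

/-- The kernel of a homomorphism. -/
abbrev ker {M N : QRep I} (f : Hom M N) : QRep I := subrep M _ (ker_stable f)

/-- The image of a homomorphism. -/
abbrev im {M N : QRep I} (f : Hom M N) : QRep I := subrep N _ (range_stable f)

/-- A homomorphism, with codomain restricted to its image. -/
def toIm {M N : QRep I} (f : Hom M N) : Hom M (im f) :=
  subLift (range_stable f) f fun _ x => ⟨x, rfl⟩

theorem toIm_surjective {M N : QRep I} (f : Hom M N) (v : I) :
    Function.Surjective ((toIm f).1 v) := by
  rintro ⟨_, x, rfl⟩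
  exact ⟨x, rfl⟩

theorem im_not_isZero {M N : QRep I} {f : Hom M N} (h : f ≠ 0) : ¬ (im f).IsZero := fun h0 => by
  obtain ⟨v, x, hx⟩ := (hom_ne_zero_iff f).1 h
  have := h0 v
  exact hx (congrArg Subtype.val (Subsingleton.elim ((toIm f).1 v x) 0))

theorem prod_finDim {M N : QRep I} (hM : M.FinDim) (hN : N.FinDim) : (M.prod N).FinDim := fun v =>
  have := hM v
  have := hN v
  inferInstanceAs (Module.Finite ℂ (M.V v × N.V v))

/-- The inclusion of the first summand. -/
def prodInl (A B : QRep I) : Hom A (A.prod B) :=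
  mkHom (fun _ => LinearMap.inl ℂ _ _) fun _ _ _ _ => Prod.ext rfl (map_zero (B.map _)).symm

/-- The inclusion of the second summand. -/
def prodInr (A B : QRep I) : Hom B (A.prod B) :=
  mkHom (fun _ => LinearMap.inr ℂ _ _) fun _ _ _ _ => Prod.ext (map_zero (A.map _)).symm rfl

/-- The projection to the first summand. -/
def prodFst (A B : QRep I) : Hom (A.prod B) A :=
  mkHom (fun _ => LinearMap.fst ℂ _ _) fun _ _ _ _ => rfl

/-- The projection to the second summand. -/
def prodSnd (A B : QRep I) : Hom (A.prod B) B :=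
  mkHom (fun _ => LinearMap.snd ℂ _ _) fun _ _ _ _ => rfl

theorem prodFst_inl {A B : QRep I} (v : I) (x : A.V v) :
    (prodFst A B).1 v ((prodInl A B).1 v x) = x := rfl

theorem prodSnd_inr {A B : QRep I} (v : I) (x : B.V v) :
    (prodSnd A B).1 v ((prodInr A B).1 v x) = x := rfl

theorem prodFst_inr {A B : QRep I} (v : I) (x : B.V v) :
    (prodFst A B).1 v ((prodInr A B).1 v x) = 0 := rfl

theorem prodSnd_inl {A B : QRep I} (v : I) (x : A.V v) :
    (prodSnd A B).1 v ((prodInl A B).1 v x) = 0 := rfl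

theorem prod_eta {A B : QRep I} (v : I) (x : (A.prod B).V v) :
    (prodInl A B).1 v ((prodFst A B).1 v x) + (prodInr A B).1 v ((prodSnd A B).1 v x) = x :=
  Prod.ext (add_zero x.1) (zero_add x.2)

/-- If `K` is a retract of `M`, then `M` is the direct sum of `K` and the kernel of the
retraction. -/
def isoProdKer {K M : QRep I} (i : Hom K M) (p : Hom M K) (h : ∀ v x, p.1 v (i.1 v x) = x) :
    Iso M (K.prod (ker p)) := by
  refine isoOfBijective (mkHom (fun v => (p.1 v).prod
    ((LinearMap.id - i.1 v ∘ₗ p.1 v).codRestrict _ fun x => by simp [h])) ?_) fun v => ⟨?_, ?_⟩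
  · intro s t a x
    refine Prod.ext (hom_map p a x) (Subtype.ext ?_)
    change M.map a x - i.1 t (p.1 t (M.map a x)) = M.map a (x - i.1 s (p.1 s x))
    rw [hom_map, hom_map, map_sub]
  · intro x y hxy
    have h1 : p.1 v x = p.1 v y := congrArg Prod.fst hxy
    have h2 : x - i.1 v (p.1 v x) = y - i.1 v (p.1 v y) :=
      congrArg (fun z : K.V v × (ker p).V v => z.2.1) hxy
    rwa [h1, sub_left_inj] at h2
  · rintro ⟨x, y, hy⟩
    have hy' : p.1 v y = 0 := hy
    refine ⟨i.1 v x + y, Prod.ext ?_ (Subtype.ext ?_)⟩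
    · change p.1 v (i.1 v x + y) = x
      rw [map_add, h, hy', add_zero]
    · change i.1 v x + y - i.1 v (p.1 v (i.1 v x + y)) = y
      rw [map_add, h, hy', add_zero, add_sub_cancel_left]

/-- A nonzero retract of an indecomposable representation is the whole of it. -/
theorem Indecomposable.section_of_retract {K M : QRep I} (hM : M.Indecomposable)
    (hK : ¬ K.IsZero) (i : Hom K M) (p : Hom M K) (h : ∀ v x, p.1 v (i.1 v x) = x) (v : I)
    (x : M.V v) : i.1 v (p.1 v x) = x := by
  rcases hM.2 _ _ ⟨isoProdKer i p h⟩ with h0 | h0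
  · exact absurd h0 hK
  · have := h0 v
    have hx : x - i.1 v (p.1 v x) ∈ LinearMap.ker (p.1 v) := by simp [h]
    have := congrArg Subtype.val (Subsingleton.elim (α := (ker p).V v) ⟨_, hx⟩ 0)
    exact (sub_eq_zero.1 this).symm

theorem Indecomposable.of_iso {M N : QRep I} (h : M.Indecomposable) (e : Iso M N) :
    N.Indecomposable :=
  ⟨fun h0 => h.1 (e.isZero_iff.2 h0), fun A B ⟨f⟩ => h.2 A B ⟨e.trans f⟩⟩

/-- The data exhibiting `M` as the direct sum of the `X j`. -/
structure SumDecomp (M : QRep I) {J : Type} [Fintype J] (X : J → QRep I) where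
  /-- the inclusions -/
  i : ∀ j, Hom (X j) M
  /-- the projections -/
  p : ∀ j, Hom M (X j)
  p_i : ∀ j v x, (p j).1 v ((i j).1 v x) = x
  p_i_ne : ∀ j k, j ≠ k → ∀ v x, (p j).1 v ((i k).1 v x) = 0
  sum_i_p : ∀ v x, ∑ j, (i j).1 v ((p j).1 v x) = x

section dims

variable [Fintype I]

/-- The total dimension. -/
def tdim (M : QRep I) : ℕ := ∑ v, Module.finrank ℂ (M.V v)

/-- The dimension vector. -/
def dv (M : QRep I) (v : I) : ℤ := Module.finrank ℂ (M.V v)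

theorem dv_nonneg (M : QRep I) : 0 ≤ M.dv := fun _ => Int.natCast_nonneg _

theorem Iso.dv_eq {M N : QRep I} (e : Iso M N) : M.dv = N.dv :=
  funext fun v => congrArg _ (e.equiv v).finrank_eq

theorem tdim_eq_of_dv_eq {M N : QRep I} (h : M.dv = N.dv) : M.tdim = N.tdim :=
  Finset.sum_congr rfl fun v _ => Int.natCast_inj.1 (congrFun h v)

theorem dv_prod {M N : QRep I} (hM : M.FinDim) (hN : N.FinDim) : (M.prod N).dv = M.dv + N.dv :=
  funext fun v => by
    have := hM v
    have := hN v
    change ((Module.finrank ℂ (M.V v × N.V v) : ℕ) : ℤ) = _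
    rw [Module.finrank_prod]
    simp [dv]

theorem tdim_prod {M N : QRep I} (hM : M.FinDim) (hN : N.FinDim) :
    (M.prod N).tdim = M.tdim + N.tdim := by
  have h : ((M.prod N).tdim : ℤ) = M.tdim + N.tdim := by
    have := fun M : QRep I => show ((M.tdim : ℕ) : ℤ) = ∑ v, M.dv v by simp [tdim, dv]
    rw [this, this, this, dv_prod hM hN]
    simp [Finset.sum_add_distrib]
  exact_mod_cast h

theorem isZero_of_tdim {M : QRep I} (hM : M.FinDim) (h : M.tdim = 0) : M.IsZero := fun v => by
  have := hM v
  rw [tdim, Finset.sum_eq_zero_iff] at h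
  exact Module.finrank_zero_iff.1 (h v (Finset.mem_univ v))

theorem tdim_pos {M : QRep I} (hM : M.FinDim) (h : ¬ M.IsZero) : 0 < M.tdim :=
  Nat.pos_of_ne_zero fun h0 => h (isZero_of_tdim hM h0)

theorem dv_ne_zero {M : QRep I} (hM : M.FinDim) (h : ¬ M.IsZero) : M.dv ≠ 0 := fun h0 =>
  h (isZero_of_tdim hM (Finset.sum_eq_zero fun v _ =>
    Int.natCast_inj.1 (congrFun h0 v)))

/-- An injective homomorphism between representations of the same dimension is bijective. -/
theorem bijective_of_injective {M N : QRep I} (hM : M.FinDim) (hN : N.FinDim) (f : Hom M N)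
    (h : ∀ v, Function.Injective (f.1 v)) (hd : N.tdim ≤ M.tdim) (v : I) :
    Function.Bijective (f.1 v) := by
  have := hM
  have := hN
  have hle : ∀ v ∈ Finset.univ, Module.finrank ℂ (M.V v) ≤ Module.finrank ℂ (N.V v) := fun v _ =>
    have := hM v
    have := hN v
    LinearMap.finrank_le_finrank_of_injective (h v)
  have heq := (Finset.sum_eq_sum_iff_of_le hle).1
    (le_antisymm (Finset.sum_le_sum hle) hd) v (Finset.mem_univ v)
  have := hM v
  have := hN v
  exact ⟨h v, (LinearMap.injective_iff_surjective_of_finrank_eq_finrank heq).1 (h v)⟩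

theorem tdim_le_of_injective {M N : QRep I} (hN : N.FinDim) (f : Hom M N)
    (h : ∀ v, Function.Injective (f.1 v)) : M.tdim ≤ N.tdim :=
  Finset.sum_le_sum fun v _ =>
    have := hN v
    LinearMap.finrank_le_finrank_of_injective (h v)

theorem tdim_le_of_surjective {M N : QRep I} (hM : M.FinDim) (f : Hom M N)
    (h : ∀ v, Function.Surjective (f.1 v)) : N.tdim ≤ M.tdim :=
  Finset.sum_le_sum fun v _ =>
    have := hM v
    LinearMap.finrank_le_finrank_of_surjective (h v)

/-- A surjective homomorphism between representations of the same dimension is bijective. -/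
theorem bijective_of_surjective {M N : QRep I} (hM : M.FinDim) (hN : N.FinDim) (f : Hom M N)
    (h : ∀ v, Function.Surjective (f.1 v)) (hd : M.tdim ≤ N.tdim) (v : I) :
    Function.Bijective (f.1 v) := by
  have hle : ∀ v ∈ Finset.univ, Module.finrank ℂ (N.V v) ≤ Module.finrank ℂ (M.V v) := fun v _ =>
    have := hM v
    LinearMap.finrank_le_finrank_of_surjective (h v)
  have heq := (Finset.sum_eq_sum_iff_of_le hle).1
    (le_antisymm (Finset.sum_le_sum hle) hd) v (Finset.mem_univ v)
  have := hM v
  have := hN v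
  exact ⟨(LinearMap.injective_iff_surjective_of_finrank_eq_finrank heq.symm).2 (h v), h v⟩

theorem dv_ker {M N : QRep I} (hM : M.FinDim) (f : Hom M N)
    (h : ∀ v, Function.Surjective (f.1 v)) : (ker f).dv = M.dv - N.dv := funext fun v => by
  have := hM v
  have h1 := (f.1 v).finrank_range_add_finrank_ker
  rw [LinearMap.range_eq_top.2 (h v), finrank_top] at h1
  change ((Module.finrank ℂ (LinearMap.ker (f.1 v)) : ℕ) : ℤ) = M.dv v - N.dv v
  simp only [dv]
  omega

/-- Every finite dimensional representation is a direct sum of indecomposables. -/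
theorem exists_sumDecomp (M : QRep I) (hM : M.FinDim) : ∃ (J : Type) (_ : Fintype J)
    (X : J → QRep I), (∀ j, (X j).FinDim ∧ (X j).Indecomposable) ∧ Nonempty (SumDecomp M X) := by
  induction hn : M.tdim using Nat.strong_induction_on generalizing M with
  | _ n ih =>
  subst hn
  by_cases h0 : M.IsZero
  · exact ⟨Empty, inferInstance, Empty.elim, fun j => j.elim,
      ⟨⟨fun j => j.elim, fun j => j.elim, fun j => j.elim, fun j => j.elim, fun v x =>
        have := h0 v
        Subsingleton.elim _ _⟩⟩⟩
  by_cases hi : M.Indecomposable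
  · refine ⟨Unit, inferInstance, fun _ => M, fun _ => ⟨hM, hi⟩,
      ⟨⟨fun _ => idHom M, fun _ => idHom M, fun _ _ _ => rfl, fun j k h => (h rfl).elim,
        fun v x => by simp⟩⟩⟩
  · simp only [Indecomposable, not_and, not_forall, not_or] at hi
    obtain ⟨A, B, ⟨e⟩, hA0, hB0⟩ := hi h0
    have hAB := hM.of_iso e
    have hA : A.FinDim := fun v => by
      have : Module.Finite ℂ (A.V v × B.V v) := hAB v
      exact Module.Finite.of_surjective (LinearMap.fst ℂ (A.V v) (B.V v)) LinearMap.fst_surjective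
    have hB : B.FinDim := fun v => by
      have : Module.Finite ℂ (A.V v × B.V v) := hAB v
      exact Module.Finite.of_surjective (LinearMap.snd ℂ (A.V v) (B.V v)) LinearMap.snd_surjective
    have hd := tdim_eq_of_dv_eq e.dv_eq
    rw [tdim_prod hA hB] at hd
    have hA1 := tdim_pos hA hA0
    have hB1 := tdim_pos hB hB0
    obtain ⟨J, _, X, hX, ⟨D⟩⟩ := ih A.tdim (by omega) A hA rfl
    obtain ⟨K, _, Y, hY, ⟨E⟩⟩ := ih B.tdim (by omega) B hB rfl
    refine ⟨J ⊕ K, inferInstance, Sum.elim X Y, ?_,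
      ⟨⟨fun j => match j with
          | .inl j => comp e.symm.hom (comp (prodInl A B) (D.i j))
          | .inr k => comp e.symm.hom (comp (prodInr A B) (E.i k)),
        fun j => match j with
          | .inl j => comp (D.p j) (comp (prodFst A B) e.hom)
          | .inr k => comp (E.p k) (comp (prodSnd A B) e.hom), ?_, ?_, ?_⟩⟩⟩
    · rintro (j | k)
      · exact hX j
      · exact hY k
    · rintro (j | k) v
      · refine fun x : (X j).V v => ?_
        change (D.p j).1 v ((prodFst A B).1 v (e.hom.1 v (e.symm.hom.1 v ((prodInl A B).1 v ((D.i j).1 v x))))) = x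
        rw [Iso.hom_symm_apply, prodFst_inl, D.p_i]
      · refine fun x : (Y k).V v => ?_
        change (E.p k).1 v ((prodSnd A B).1 v (e.hom.1 v (e.symm.hom.1 v ((prodInr A B).1 v ((E.i k).1 v x))))) = x
        rw [Iso.hom_symm_apply, prodSnd_inr, E.p_i]
    · rintro (j | k) (j' | k') h v
      · refine fun x : (X j').V v => ?_
        change (D.p j).1 v ((prodFst A B).1 v (e.hom.1 v (e.symm.hom.1 v ((prodInl A B).1 v ((D.i j').1 v x))))) = 0
        rw [Iso.hom_symm_apply, prodFst_inl, D.p_i_ne j j' fun h' => h (h' ▸ rfl)]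
      · refine fun x : (Y k').V v => ?_
        change (D.p j).1 v ((prodFst A B).1 v (e.hom.1 v (e.symm.hom.1 v ((prodInr A B).1 v ((E.i k').1 v x))))) = 0
        rw [Iso.hom_symm_apply, prodFst_inr, map_zero]
      · refine fun x : (X j').V v => ?_
        change (E.p k).1 v ((prodSnd A B).1 v (e.hom.1 v (e.symm.hom.1 v ((prodInl A B).1 v ((D.i j').1 v x))))) = 0
        rw [Iso.hom_symm_apply, prodSnd_inl, map_zero]
      · refine fun x : (Y k').V v => ?_
        change (E.p k).1 v ((prodSnd A B).1 v (e.hom.1 v (e.symm.hom.1 v ((prodInr A B).1 v ((E.i k').1 v x))))) = 0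
        rw [Iso.hom_symm_apply, prodSnd_inr, E.p_i_ne k k' fun h' => h (h' ▸ rfl)]
    · intro v x
      rw [Fintype.sum_sum_type]
      change ∑ j, e.symm.hom.1 v ((prodInl A B).1 v ((D.i j).1 v ((D.p j).1 v ((prodFst A B).1 v (e.hom.1 v x))))) +
        ∑ k, e.symm.hom.1 v ((prodInr A B).1 v ((E.i k).1 v ((E.p k).1 v ((prodSnd A B).1 v (e.hom.1 v x))))) = x
      rw [← map_sum, ← map_sum, ← map_sum, ← map_sum, D.sum_i_p, E.sum_i_p, ← map_add, prod_eta,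
        Iso.symm_hom_apply]

end dims

/-! ### The complex computing `Hom` and `Ext¹` -/

/-- Families of linear maps between the spaces at the vertices. -/
abbrev C0 (X N : QRep I) : Type := ∀ v, X.V v →ₗ[ℂ] N.V v

/-- Families of linear maps indexed by the arrows: the 1-cochains. -/
abbrev C1 (X N : QRep I) : Type := ∀ a : Arr I, X.V a.1 →ₗ[ℂ] N.V a.2.1

/-- The differential, with kernel `Hom(X, N)` and cokernel `Ext¹(X, N)`. -/
def delta (X N : QRep I) : C0 X N →ₗ[ℂ] C1 X N where
  toFun f a := f a.2.1 ∘ₗ X.map a.2.2 - N.map a.2.2 ∘ₗ f a.1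
  map_add' f g := by
    funext a
    simp only [Pi.add_apply, LinearMap.add_comp, LinearMap.comp_add]
    abel
  map_smul' c f := by
    funext a
    simp only [Pi.smul_apply, LinearMap.smul_comp, LinearMap.comp_smul, smul_sub,
      RingHom.id_apply]

theorem delta_apply {X N : QRep I} (f : C0 X N) (a : Arr I) (x : X.V a.1) :
    delta X N f a x = f a.2.1 (X.map a.2.2 x) - N.map a.2.2 (f a.1 x) := rfl

theorem ker_delta (X N : QRep I) : LinearMap.ker (delta X N) = Hom X N := by
  ext f
  refine ⟨fun h s t a => sub_eq_zero.1 (congrFun h ⟨s, t, a⟩), fun h => funext fun a => ?_⟩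
  exact sub_eq_zero.2 (h a.1 a.2.1 a.2.2)

/-- A 0-cochain with zero differential is a homomorphism. -/
def homOfDelta {X N : QRep I} (f : C0 X N) (h : delta X N f = 0) : Hom X N :=
  ⟨f, (ker_delta X N).le h⟩

theorem delta_comp_left {X N N' : QRep I} (g : Hom N N') (w : C0 X N) (a : Arr I) (x : X.V a.1) :
    delta X N' (fun v => g.1 v ∘ₗ w v) a x = g.1 a.2.1 (delta X N w a x) := by
  simp only [delta_apply, LinearMap.comp_apply, map_sub, hom_map]

theorem delta_comp_right {X X' N : QRep I} (f : Hom X' X) (w : C0 X N) (a : Arr I)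
    (x : X'.V a.1) :
    delta X' N (fun v => w v ∘ₗ f.1 v) a x = delta X N w a (f.1 a.1 x) := by
  simp only [delta_apply, LinearMap.comp_apply, hom_map]

/-- `Ext¹(X, N) = 0`. -/
def ExtZero (X N : QRep I) : Prop := Function.Surjective (delta X N)

/-- Over a field, a linear map factors through any linear map with smaller kernel. -/
theorem exists_factor {U V W : Type} [AddCommGroup U] [Module ℂ U] [AddCommGroup V] [Module ℂ V]
    [AddCommGroup W] [Module ℂ W] (β : U →ₗ[ℂ] V) (γ : U →ₗ[ℂ] W)
    (h : ∀ x, β x = 0 → γ x = 0) : ∃ ζ : V →ₗ[ℂ] W, ∀ x, ζ (β x) = γ x := by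
  obtain ⟨ζ, hζ⟩ := (((LinearMap.ker β).liftQ γ h) ∘ₗ
    β.quotKerEquivRange.symm.toLinearMap).exists_extend
  refine ⟨ζ, fun x => ?_⟩
  have := LinearMap.congr_fun hζ (β.rangeRestrict x)
  have h2 : β.quotKerEquivRange.symm (β.rangeRestrict x) = (LinearMap.ker β).mkQ x := by
    rw [LinearEquiv.symm_apply_eq]
    rfl
  simpa [h2] using! this

theorem exists_linear_retraction {U V : Type} [AddCommGroup U] [Module ℂ U] [AddCommGroup V]
    [Module ℂ V] (i : U →ₗ[ℂ] V) (h : Function.Injective i) :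
    ∃ σ : V →ₗ[ℂ] U, ∀ x, σ (i x) = x := by
  obtain ⟨σ, hσ⟩ := i.exists_leftInverse_of_injective (LinearMap.ker_eq_bot.2 h)
  exact ⟨σ, LinearMap.congr_fun hσ⟩

theorem exists_linear_section {U V : Type} [AddCommGroup U] [Module ℂ U] [AddCommGroup V]
    [Module ℂ V] (p : U →ₗ[ℂ] V) (h : Function.Surjective p) :
    ∃ σ : V →ₗ[ℂ] U, ∀ x, p (σ x) = x := by
  obtain ⟨σ, hσ⟩ := p.exists_rightInverse_of_surjective (LinearMap.range_eq_top.2 h)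
  exact ⟨σ, LinearMap.congr_fun hσ⟩

/-- `Ext¹` is right exact in the first variable. -/
theorem ExtZero.of_injective {X X' N : QRep I} (h : ExtZero X N) (i : Hom X' X)
    (hi : ∀ v, Function.Injective (i.1 v)) : ExtZero X' N := fun ζ => by
  choose σ hσ using fun v => exists_linear_retraction (i.1 v) (hi v)
  obtain ⟨w, hw⟩ := h fun a => ζ a ∘ₗ σ a.1
  refine ⟨fun v => w v ∘ₗ i.1 v, funext fun a => LinearMap.ext fun x => ?_⟩
  rw [delta_comp_right, hw, LinearMap.comp_apply, hσ]

/-- `Ext¹` is right exact in the second variable. -/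
theorem ExtZero.of_surjective {X N N' : QRep I} (h : ExtZero X N) (p : Hom N N')
    (hp : ∀ v, Function.Surjective (p.1 v)) : ExtZero X N' := fun ζ => by
  choose σ hσ using fun v => exists_linear_section (p.1 v) (hp v)
  obtain ⟨w, hw⟩ := h fun a => σ a.2.1 ∘ₗ ζ a
  refine ⟨fun v => p.1 v ∘ₗ w v, funext fun a => LinearMap.ext fun x => ?_⟩
  rw [delta_comp_left, hw, LinearMap.comp_apply, hσ]

/-- Lifting a homomorphism along a surjection whose kernel has no extensions by the source. -/
theorem exists_lift {X N N' : QRep I} (g : Hom N N') (hg : ∀ v, Function.Surjective (g.1 v))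
    (h : ExtZero X (ker g)) (f : Hom X N') : ∃ f' : Hom X N, ∀ v x, g.1 v (f'.1 v x) = f.1 v x := by
  choose σ hσ using fun v => exists_linear_section (g.1 v) (hg v)
  let ρ : C0 X N := fun v => σ v ∘ₗ f.1 v
  have hρ : ∀ a x, g.1 a.2.1 (delta X N ρ a x) = 0 := fun a x => by
    rw [← delta_comp_left, delta_apply]
    simp only [ρ, LinearMap.comp_apply, hσ, hom_map, sub_self]
  obtain ⟨w, hw⟩ := h fun a => (delta X N ρ a).codRestrict _ (hρ a)
  let ι := subIncl (ker_stable g)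
  refine ⟨homOfDelta (fun v => ρ v - ι.1 v ∘ₗ w v) (funext fun a => LinearMap.ext fun x => ?_),
    fun v x => ?_⟩
  · change delta X N (ρ - fun v => ι.1 v ∘ₗ w v) a x = 0
    rw [map_sub, Pi.sub_apply, LinearMap.sub_apply, delta_comp_left, hw]
    exact sub_self _
  · change g.1 v (σ v (f.1 v x) - ι.1 v (w v x)) = f.1 v x
    rw [map_sub, hσ, show g.1 v (ι.1 v (w v x)) = 0 from (w v x).2, sub_zero]

/-- Extending a homomorphism defined on the kernel `U` of `β : M → L` to all of `M`, when
`Ext¹(L, N) = 0`. -/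
theorem exists_extension {M L N : QRep I} {U : ∀ v, Submodule ℂ (M.V v)}
    (hU : ∀ (s t : I) (a : s ⟶ t), ∀ x ∈ U s, M.map a x ∈ U t) (β : Hom M L)
    (hβ : ∀ v x, β.1 v x = 0 ↔ x ∈ U v) (h : ExtZero L N) (f : Hom (subrep M U hU) N) :
    ∃ f' : Hom M N, ∀ v x, f'.1 v ((subIncl hU).1 v x) = f.1 v x := by
  choose ρ hρ using fun v => LinearMap.exists_extend (p := U v) (f.1 v)
  have hρ' : ∀ v (x : (subrep M U hU).V v), ρ v ((subIncl hU).1 v x) = f.1 v x := fun v x =>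
    LinearMap.congr_fun (hρ v) x
  have h0 : ∀ a x, β.1 a.1 x = 0 → delta M N ρ a x = 0 := fun a x hx => by
    let x' : (subrep M U hU).V a.1 := ⟨x, (hβ _ _).1 hx⟩
    change delta M N ρ a ((subIncl hU).1 a.1 x') = 0
    rw [delta_apply, ← hom_map, hρ', hρ', hom_map, sub_self]
  choose ζ hζ using fun a => exists_factor (β.1 a.1) (delta M N ρ a) (h0 a)
  obtain ⟨w, hw⟩ := h ζ
  refine ⟨homOfDelta (fun v => ρ v - w v ∘ₗ β.1 v) (funext fun a => LinearMap.ext fun x => ?_),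
    fun v x => ?_⟩
  · change delta M N (ρ - fun v => w v ∘ₗ β.1 v) a x = 0
    rw [map_sub, Pi.sub_apply, LinearMap.sub_apply, delta_comp_right, hw, hζ, sub_self]
  · change ρ v ((subIncl hU).1 v x) - w v (β.1 v ((subIncl hU).1 v x)) = f.1 v x
    rw [(hβ _ _).2 (subIncl_mem v x), map_zero, sub_zero, hρ']

/-- If `Ext¹(Z, Y) = 0`, then the identity of the image `L` of `f : Y → Z` is the sum of a map
that factors over `Y` and a map that factors over `Z`. -/
theorem exists_id_im_eq {Y Z : QRep I} (f : Hom Y Z) (h : ExtZero Z Y) :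
    ∃ (u : Hom (im f) Y) (r : Hom Z (im f)), ∀ v x,
      (toIm f).1 v (u.1 v x) + r.1 v ((subIncl (range_stable f)).1 v x) = x := by
  let ι := subIncl (range_stable f)
  choose σ hσ using fun v => exists_linear_retraction (ι.1 v) (subIncl_injective v)
  choose τ hτ using fun v => exists_linear_section ((toIm f).1 v) (toIm_surjective f v)
  obtain ⟨w, hw⟩ := h fun a => τ a.2.1 ∘ₗ delta Z (im f) σ a
  have hw' : ∀ a x, delta Z Y w a x = τ a.2.1 (delta Z (im f) σ a x) := fun a x => by
    rw [hw]
    rfl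
  refine ⟨homOfDelta (fun v => w v ∘ₗ ι.1 v) (funext fun a => LinearMap.ext fun x => ?_),
    homOfDelta (fun v => σ v - (toIm f).1 v ∘ₗ w v)
      (funext fun a => LinearMap.ext fun x => ?_), fun v x => ?_⟩
  · rw [delta_comp_right, hw', ← delta_comp_right, delta_apply]
    simp only [LinearMap.comp_apply, hσ, sub_self, map_zero]
    rfl
  · change delta Z (im f) (σ - fun v => (toIm f).1 v ∘ₗ w v) a x = 0
    rw [map_sub, Pi.sub_apply, LinearMap.sub_apply, delta_comp_left, hw', hτ, sub_self]
  · change (toIm f).1 v (w v (ι.1 v x)) + (σ v (ι.1 v x) - (toIm f).1 v (w v (ι.1 v x))) = x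
    rw [add_sub_cancel, hσ]

/-- Composition with a fixed homomorphism, as a linear map. -/
def compLeft {X N N' : QRep I} (g : Hom N N') : Hom X N →ₗ[ℂ] Hom X N' where
  toFun f := comp g f
  map_add' f f' := hom_ext fun v x => map_add (g.1 v) (f.1 v x) (f'.1 v x)
  map_smul' c f := hom_ext fun v x => map_smul (g.1 v) c (f.1 v x)

/-- Precomposition with a fixed homomorphism, as a linear map. -/
def compRight {X X' N : QRep I} (f : Hom X' X) : Hom X N →ₗ[ℂ] Hom X' N where
  toFun g := comp g f
  map_add' _ _ := rfl
  map_smul' _ _ := rfl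

/-- `dim Hom(X, N)`. -/
def homDim (X N : QRep I) : ℕ := Module.finrank ℂ (Hom X N)

/-- `dim Ext¹(X, N)`. -/
def extDim (X N : QRep I) : ℕ := Module.finrank ℂ (C1 X N ⧸ LinearMap.range (delta X N))

section fin

variable [Fintype I] [∀ s t : I, Fintype (s ⟶ t)]

theorem c0_finite {X N : QRep I} (hX : X.FinDim) (hN : N.FinDim) : Module.Finite ℂ (C0 X N) := by
  have := fun v => hX v
  have := fun v => hN v
  infer_instance

theorem c1_finite {X N : QRep I} (hX : X.FinDim) (hN : N.FinDim) : Module.Finite ℂ (C1 X N) := by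
  have := fun v => hX v
  have := fun v => hN v
  infer_instance

theorem hom_finite {X N : QRep I} (hX : X.FinDim) (hN : N.FinDim) :
    Module.Finite ℂ (Hom X N) := by
  have := c0_finite hX hN
  infer_instance

theorem homDim_eq_zero_iff {X N : QRep I} (hX : X.FinDim) (hN : N.FinDim) :
    homDim X N = 0 ↔ ∀ f : Hom X N, f = 0 := by
  have := hom_finite hX hN
  rw [homDim, Module.finrank_zero_iff]
  exact ⟨fun h f => Subsingleton.elim _ _, fun h => ⟨fun f g => by rw [h f, h g]⟩⟩

theorem homDim_pos_iff {X N : QRep I} (hX : X.FinDim) (hN : N.FinDim) :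
    0 < homDim X N ↔ ∃ f : Hom X N, f ≠ 0 := by
  rw [Nat.pos_iff_ne_zero, Ne, homDim_eq_zero_iff hX hN]
  push Not
  rfl

theorem extDim_eq_zero_iff {X N : QRep I} (hX : X.FinDim) (hN : N.FinDim) :
    extDim X N = 0 ↔ ExtZero X N := by
  have := c1_finite hX hN
  rw [extDim, Module.finrank_zero_iff, Submodule.Quotient.subsingleton_iff,
    LinearMap.range_eq_top]
  rfl

/-- The Euler form of the quiver. -/
def euler : (I → ℤ) →ₗ[ℤ] (I → ℤ) →ₗ[ℤ] ℤ :=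
  LinearMap.mk₂ ℤ (fun x y => ∑ v, x v * y v - ∑ a : Arr I, x a.1 * y a.2.1)
    (fun x x' y => by simp only [Pi.add_apply, add_mul, Finset.sum_add_distrib]; ring)
    (fun c x y => by
      simp only [Pi.smul_apply, smul_eq_mul, mul_assoc, ← Finset.mul_sum]; ring)
    (fun x y y' => by simp only [Pi.add_apply, mul_add, Finset.sum_add_distrib]; ring)
    (fun c x y => by
      simp only [Pi.smul_apply, smul_eq_mul, mul_left_comm _ c, ← Finset.mul_sum]; ring)

theorem euler_apply (x y : I → ℤ) :
    euler x y = ∑ v, x v * y v - ∑ a : Arr I, x a.1 * y a.2.1 := rfl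

/-- The Euler form computes `dim Hom - dim Ext¹`. -/
theorem homDim_sub_extDim {X N : QRep I} (hX : X.FinDim) (hN : N.FinDim) :
    (homDim X N : ℤ) - extDim X N = euler X.dv N.dv := by
  have := c0_finite hX hN
  have := c1_finite hX hN
  have := fun v => hX v
  have := fun v => hN v
  have h1 := (delta X N).finrank_range_add_finrank_ker
  have h2 := (LinearMap.range (delta X N)).finrank_quotient_add_finrank
  rw [ker_delta] at h1
  have h3 : Module.finrank ℂ (C0 X N) =
      ∑ v, Module.finrank ℂ (X.V v) * Module.finrank ℂ (N.V v) := by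
    rw [Module.finrank_pi_fintype]
    exact Finset.sum_congr rfl fun v _ => Module.finrank_linearMap ..
  have h4 : Module.finrank ℂ (C1 X N) =
      ∑ a : Arr I, Module.finrank ℂ (X.V a.1) * Module.finrank ℂ (N.V a.2.1) := by
    rw [Module.finrank_pi_fintype]
    exact Finset.sum_congr rfl fun v _ => Module.finrank_linearMap ..
  have h5 : euler X.dv N.dv = (Module.finrank ℂ (C0 X N) : ℤ) - Module.finrank ℂ (C1 X N) := by
    rw [h3, h4, euler_apply]
    simp [dv]
  rw [h5, homDim, extDim, ← h1, ← h2]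
  push_cast
  ring

end fin

/-! ### Dimensions of homomorphism spaces of direct sums -/

namespace SumDecomp

variable {M : QRep I} {J : Type} [Fintype J] {X : J → QRep I}

theorem injective_i (D : SumDecomp M X) (j : J) (v : I) : Function.Injective ((D.i j).1 v) :=
  Function.LeftInverse.injective (D.p_i j v)

theorem surjective_p (D : SumDecomp M X) (j : J) (v : I) : Function.Surjective ((D.p j).1 v) :=
  Function.RightInverse.surjective (D.p_i j v)

theorem finDim (D : SumDecomp M X) (hM : M.FinDim) (j : J) : (X j).FinDim := fun v => by
  have := hM v
  exact Module.Finite.of_surjective _ (D.surjective_p j v)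

/-- Homomorphisms into a direct sum. -/
def homEquiv (D : SumDecomp M X) (Y : QRep I) : Hom Y M ≃ₗ[ℂ] ∀ j, Hom Y (X j) where
  toFun f j := comp (D.p j) f
  map_add' f f' := funext fun j => hom_ext fun v x =>
    map_add ((D.p j).1 v) (f.1 v x) (f'.1 v x)
  map_smul' c f := funext fun j => hom_ext fun v x => map_smul ((D.p j).1 v) c (f.1 v x)
  invFun g := ∑ j, comp (D.i j) (g j)
  left_inv f := hom_ext fun v x => by simp [D.sum_i_p]
  right_inv g := funext fun j => hom_ext fun v x => by
    classical
    rw [comp_apply, hom_sum_apply, map_sum, Finset.sum_eq_single j]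
    · exact D.p_i j v _
    · intro k _ h
      exact D.p_i_ne j k h.symm v _
    · intro h
      exact absurd (Finset.mem_univ j) h

/-- Homomorphisms out of a direct sum. -/
def homEquiv' (D : SumDecomp M X) (Y : QRep I) : Hom M Y ≃ₗ[ℂ] ∀ j, Hom (X j) Y where
  toFun f j := comp f (D.i j)
  map_add' _ _ := rfl
  map_smul' _ _ := rfl
  invFun g := ∑ j, comp (g j) (D.p j)
  left_inv f := hom_ext fun v x => by
    rw [hom_sum_apply]
    simp only [comp_apply]
    rw [← map_sum, D.sum_i_p]
  right_inv g := funext fun j => hom_ext fun v x => by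
    classical
    rw [comp_apply, hom_sum_apply, Finset.sum_eq_single j]
    · rw [comp_apply, D.p_i]
    · intro k _ h
      rw [comp_apply, D.p_i_ne k j h, map_zero]
    · intro h
      exact absurd (Finset.mem_univ j) h

variable [Fintype I] [∀ s t : I, Fintype (s ⟶ t)]

theorem homDim_right (D : SumDecomp M X) (hM : M.FinDim) {Y : QRep I} (hY : Y.FinDim) :
    homDim Y M = ∑ j, homDim Y (X j) := by
  have := fun j => hom_finite hY (D.finDim hM j)
  rw [homDim, (D.homEquiv Y).finrank_eq, Module.finrank_pi_fintype]
  rfl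

theorem homDim_left (D : SumDecomp M X) (hM : M.FinDim) {Y : QRep I} (hY : Y.FinDim) :
    homDim M Y = ∑ j, homDim (X j) Y := by
  have := fun j => hom_finite (D.finDim hM j) hY
  rw [homDim, (D.homEquiv' Y).finrank_eq, Module.finrank_pi_fintype]
  rfl

theorem dv_eq (D : SumDecomp M X) (hM : M.FinDim) : M.dv = ∑ j, (X j).dv := funext fun v => by
  classical
  have := fun j => D.finDim hM j v
  let e : M.V v ≃ₗ[ℂ] ∀ j, (X j).V v :=
    { toFun x j := (D.p j).1 v x
      map_add' _ _ := funext fun _ => map_add _ _ _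
      map_smul' _ _ := funext fun _ => map_smul _ _ _
      invFun x := ∑ j, (D.i j).1 v (x j)
      left_inv x := D.sum_i_p v x
      right_inv x := funext fun j => by
        change (D.p j).1 v (∑ k, (D.i k).1 v (x k)) = x j
        rw [map_sum, Finset.sum_eq_single j]
        · exact D.p_i j v _
        · intro k _ h
          exact D.p_i_ne j k h.symm v _
        · intro h
          exact absurd (Finset.mem_univ j) h }
  simp only [dv, Finset.sum_apply]
  rw [e.finrank_eq, Module.finrank_pi_fintype]
  push_cast
  rfl

theorem extDim_right (D : SumDecomp M X) (hM : M.FinDim) {Y : QRep I} (hY : Y.FinDim) :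
    extDim Y M = ∑ j, extDim Y (X j) := by
  have h1 := homDim_sub_extDim hY hM
  have h2 : ∑ j, ((homDim Y (X j) : ℤ) - extDim Y (X j)) = euler Y.dv M.dv := by
    rw [D.dv_eq hM, map_sum]
    exact Finset.sum_congr rfl fun j _ => homDim_sub_extDim hY (D.finDim hM j)
  rw [D.homDim_right hM hY] at h1
  rw [Finset.sum_sub_distrib] at h2
  have : ((extDim Y M : ℕ) : ℤ) = ∑ j, (extDim Y (X j) : ℤ) := by push_cast at h1; linarith
  exact_mod_cast this

theorem extDim_left (D : SumDecomp M X) (hM : M.FinDim) {Y : QRep I} (hY : Y.FinDim) :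
    extDim M Y = ∑ j, extDim (X j) Y := by
  have h1 := homDim_sub_extDim hM hY
  have h2 : ∑ j, ((homDim (X j) Y : ℤ) - extDim (X j) Y) = euler M.dv Y.dv := by
    rw [D.dv_eq hM, map_sum, LinearMap.sum_apply]
    exact Finset.sum_congr rfl fun j _ => homDim_sub_extDim (D.finDim hM j) hY
  rw [D.homDim_left hM hY] at h1
  rw [Finset.sum_sub_distrib] at h2
  have : ((extDim M Y : ℕ) : ℤ) = ∑ j, (extDim (X j) Y : ℤ) := by push_cast at h1; linarith
  exact_mod_cast this

end SumDecomp

/-! ### Indecomposables are exceptional when the Euler form is positive definite -/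

theorem Indecomposable.of_isCompl {M : QRep I} (hM : M.Indecomposable)
    {U U' : ∀ v, Submodule ℂ (M.V v)}
    (hU : ∀ (s t : I) (a : s ⟶ t), ∀ x ∈ U s, M.map a x ∈ U t)
    (hU' : ∀ (s t : I) (a : s ⟶ t), ∀ x ∈ U' s, M.map a x ∈ U' t)
    (h : ∀ v, IsCompl (U v) (U' v)) : (∀ v, U v = ⊥) ∨ ∀ v, U' v = ⊥ := by
  let f : Hom ((subrep M U hU).prod (subrep M U' hU')) M :=
    mkHom (fun v => (Submodule.prodEquivOfIsCompl (U v) (U' v) (h v)).toLinearMap)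
      fun s t a x => by
        obtain ⟨x, y⟩ := x
        exact (map_add (M.map a) _ _).symm
  have hf : ∀ v, Function.Bijective (f.1 v) := fun v =>
    (Submodule.prodEquivOfIsCompl (U v) (U' v) (h v)).bijective
  rcases hM.2 _ _ ⟨(isoOfBijective f hf).symm⟩ with h0 | h0
  · exact Or.inl fun v => (Submodule.subsingleton_iff_eq_bot).1 (h0 v)
  · exact Or.inr fun v => (Submodule.subsingleton_iff_eq_bot).1 (h0 v)

section fin

variable [Fintype I]

/-- Fitting's lemma. -/
theorem Indecomposable.bijective_or_nilpotent {M : QRep I} (hM : M.Indecomposable)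
    (hf : M.FinDim) (f : Hom M M) :
    (∀ v, Function.Bijective (f.1 v)) ∨ ∃ n : ℕ, ∀ v x, ((f.1 v)^[n]) x = 0 := by
  have := fun v => hf v
  have h1 : ∀ᶠ n : ℕ in Filter.atTop, ∀ v,
      IsCompl (LinearMap.ker ((f.1 v) ^ n)) (LinearMap.range ((f.1 v) ^ n)) :=
    Filter.eventually_all.2 fun v => LinearMap.eventually_isCompl_ker_pow_range_pow (f.1 v)
  obtain ⟨n, hn, hn1⟩ := (h1.and (Filter.eventually_ge_atTop 1)).exists
  have hit : ∀ n {s t : I} (a : s ⟶ t) (x : M.V s),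
      ((f.1 t) ^ n) (M.map a x) = M.map a (((f.1 s) ^ n) x) := by
    intro n
    induction n with
    | zero => intros; rfl
    | succ n ih => intro s t a x; rw [pow_succ, pow_succ, Module.End.mul_apply, hom_map, ih]; rfl
  have hU : ∀ (s t : I) (a : s ⟶ t), ∀ x ∈ LinearMap.ker ((f.1 s) ^ n),
      M.map a x ∈ LinearMap.ker ((f.1 t) ^ n) := fun s t a x hx => by
    rw [LinearMap.mem_ker] at hx ⊢
    rw [hit, hx, map_zero]
  have hU' : ∀ (s t : I) (a : s ⟶ t), ∀ x ∈ LinearMap.range ((f.1 s) ^ n),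
      M.map a x ∈ LinearMap.range ((f.1 t) ^ n) := by
    rintro s t a _ ⟨x, rfl⟩
    exact ⟨M.map a x, hit n a x⟩
  rcases hM.of_isCompl hU hU' hn with h | h
  · left
    intro v
    have hi : Function.Injective (f.1 v) := by
      rw [injective_iff_map_eq_zero]
      intro x hx
      have : x ∈ LinearMap.ker ((f.1 v) ^ n) := by
        obtain ⟨m, rfl⟩ := Nat.exists_eq_add_of_le' hn1
        rw [LinearMap.mem_ker, pow_succ, Module.End.mul_apply, hx, map_zero]
      rw [h v] at this
      exact this
    exact ⟨hi, LinearMap.injective_iff_surjective.1 hi⟩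
  · right
    refine ⟨n, fun v x => ?_⟩
    have : ((f.1 v) ^ n) x ∈ LinearMap.range ((f.1 v) ^ n) := ⟨x, rfl⟩
    rw [h v, Submodule.mem_bot, Module.End.pow_apply] at this
    exact this

/-- All endomorphisms are scalars. -/
def Brick (X : QRep I) : Prop := ∀ f : Hom X X, ∃ c : ℂ, ∀ v x, f.1 v x = c • x

/-- If the rank of `α` is at least the rank of `θ` and `ker θ ⊆ ker α`, then the kernels agree. -/
theorem ker_eq_of_rank_le {X Y Z : QRep I} (hX : X.FinDim) (θ : Hom X Y) (α : Hom X Z)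
    (h : ∀ v x, θ.1 v x = 0 → α.1 v x = 0) (hr : (im θ).tdim ≤ (im α).tdim) (v : I) (x : X.V v)
    (hx : α.1 v x = 0) : θ.1 v x = 0 := by
  have := fun v => hX v
  have hle : ∀ v, LinearMap.ker (θ.1 v) ≤ LinearMap.ker (α.1 v) := h
  have h1 := fun v => (θ.1 v).finrank_range_add_finrank_ker
  have h2 := fun v => (α.1 v).finrank_range_add_finrank_ker
  have h3 : ∀ v ∈ Finset.univ, Module.finrank ℂ (LinearMap.range (α.1 v)) ≤
      Module.finrank ℂ (LinearMap.range (θ.1 v)) := fun v _ => by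
    have := Submodule.finrank_mono (hle v)
    have := h1 v
    have := h2 v
    omega
  have h4 := (Finset.sum_eq_sum_iff_of_le h3).1 (le_antisymm (Finset.sum_le_sum h3) hr) v
    (Finset.mem_univ v)
  have h5 := Submodule.eq_of_le_of_finrank_eq (hle v) (by have := h1 v; have := h2 v; omega)
  exact h5.ge hx

theorem Indecomposable.exists_nilpotent {X : QRep I} (hX : X.Indecomposable) (hf : X.FinDim)
    (hb : ¬ Brick X) : ∃ θ : Hom X X, θ ≠ 0 ∧ ∃ v, ¬ Function.Injective (θ.1 v) := by
  simp only [Brick, not_forall, not_exists] at hb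
  obtain ⟨f, hf'⟩ := hb
  have h0 := hX.1
  simp only [IsZero, not_forall, not_subsingleton_iff_nontrivial] at h0
  obtain ⟨v, hv⟩ := h0
  have := hf v
  obtain ⟨c, hc⟩ := Module.End.exists_eigenvalue (f.1 v)
  obtain ⟨x, hx⟩ := hc.exists_hasEigenvector
  obtain ⟨w, y, hy⟩ := hf' c
  refine ⟨f - c • idHom X, (hom_ne_zero_iff _).2 ⟨w, y, sub_ne_zero.2 hy⟩, v, fun hi => ?_⟩
  refine hx.2 ((injective_iff_map_eq_zero _).1 hi x ?_)
  rw [hom_sub_apply, hom_smul_apply, idHom_apply, hx.apply_eq_smul, sub_self]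

/-- A representation that is not a brick contains a proper indecomposable subrepresentation with
self-extensions: among the nonzero nilpotent endomorphisms `θ` choose one of minimal rank. Then
`θ² = 0`, and a summand `K` of `ker θ` that `θ` hits nontrivially would split off if
`Ext¹(K, K) = 0`. -/
theorem Indecomposable.brick_of_rigid {X : QRep I} (hX : X.Indecomposable) (hf : X.FinDim)
    (ih : ∀ K : QRep I, K.FinDim → K.Indecomposable → K.tdim < X.tdim → ExtZero K K) :
    Brick X := by
  by_contra hb
  let T : Set (Hom X X) := {θ | θ ≠ 0 ∧ ∃ v, ¬ Function.Injective (θ.1 v)}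
  obtain ⟨θ, ⟨hθ0, w, hw⟩, hmin⟩ : ∃ θ ∈ T, ∀ θ' ∈ T, (im θ).tdim ≤ (im θ').tdim := by
    obtain ⟨θ, hθ⟩ := hX.exists_nilpotent hf hb
    have hne : ((fun θ : Hom X X => (im θ).tdim) '' T).Nonempty := ⟨_, θ, hθ, rfl⟩
    obtain ⟨θ', hθ', h⟩ := Nat.sInf_mem hne
    exact ⟨θ', hθ', fun α hα => h.le.trans (Nat.sInf_le ⟨α, hα, rfl⟩)⟩
  have hsq : ∀ v x, θ.1 v (θ.1 v x) = 0 := by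
    by_contra! hne
    have hT : comp θ θ ∈ T := by
      refine ⟨(hom_ne_zero_iff _).2 hne, w, fun hi => hw fun x y hxy => hi ?_⟩
      rw [comp_apply, comp_apply, hxy]
    have hk := ker_eq_of_rank_le hf θ (comp θ θ) (fun v x h => by rw [comp_apply, h, map_zero])
      (hmin _ hT)
    rcases hX.bijective_or_nilpotent hf θ with h | ⟨n, hn⟩
    · exact hw (h w).1
    · refine hθ0 (hom_ext fun v x => ?_)
      have : ∀ n x, ((θ.1 v)^[n + 1]) x = 0 → θ.1 v x = 0 := by
        intro n
        induction n with
        | zero => exact fun x h => h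
        | succ n ih =>
          intro x h
          rw [Function.iterate_succ_apply] at h
          exact hk v x (ih _ h)
      refine this n x ?_
      rw [Function.iterate_succ_apply']
      rw [hn, map_zero]
  let θ' : Hom X (ker θ) := subLift (ker_stable θ) θ hsq
  obtain ⟨J, _, K, hK, ⟨D⟩⟩ := exists_sumDecomp (ker θ) (subrep_finDim hf)
  obtain ⟨j, hj⟩ : ∃ j, comp (D.p j) θ' ≠ 0 := by
    by_contra! h
    refine hθ0 (hom_ext fun v x => ?_)
    have hx : θ'.1 v x = 0 := by
      rw [← D.sum_i_p v (θ'.1 v x)]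
      refine Finset.sum_eq_zero fun j _ => ?_
      have : (comp (D.p j) θ').1 v x = 0 := by rw [h j]; rfl
      rw [comp_apply] at this
      rw [this, map_zero]
    exact congrArg Subtype.val hx
  let β := comp (D.p j) θ'
  let κ : Hom (K j) X := comp (subIncl (ker_stable θ)) (D.i j)
  have hκ : ∀ v, Function.Injective (κ.1 v) := fun v =>
    (subIncl_injective v).comp (D.injective_i j v)
  have hθβ : ∀ v x, θ.1 v x = 0 → β.1 v x = 0 := fun v x h => by
    have : θ'.1 v x = 0 := Subtype.ext h
    change (D.p j).1 v (θ'.1 v x) = 0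
    rw [this, map_zero]
  have hT : comp κ β ∈ T := by
    obtain ⟨v, x, hx⟩ := (hom_ne_zero_iff _).1 hj
    refine ⟨(hom_ne_zero_iff _).2 ⟨v, x, fun h => hx (hκ v (h.trans (map_zero _).symm))⟩, w,
      fun hi => hw ?_⟩
    rw [injective_iff_map_eq_zero] at hi ⊢
    intro x hx
    refine hi x ?_
    rw [comp_apply, hθβ w x hx, map_zero]
  have hk := ker_eq_of_rank_le hf θ (comp κ β)
    (fun v x h => by rw [comp_apply, hθβ v x h, map_zero]) (hmin _ hT)
  have hβ : ∀ v x, β.1 v x = 0 ↔ x ∈ LinearMap.ker (θ.1 v) := fun v x =>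
    ⟨fun h => hk v x (by rw [comp_apply, h, map_zero]), fun h => hθβ v x h⟩
  have hlt : (K j).tdim < X.tdim := by
    refine lt_of_le_of_ne (tdim_le_of_injective hf κ hκ) fun heq => hθ0 (hom_ext fun v x => ?_)
    obtain ⟨y, rfl⟩ := (bijective_of_injective (hK j).1 hf κ hκ heq.ge v).2 x
    exact ((D.i j).1 v y).2
  obtain ⟨r, hr⟩ := exists_extension (ker_stable θ) β hβ (ih _ (hK j).1 (hK j).2 hlt) (D.p j)
  have hret := hX.section_of_retract (hK j).2.1 κ r fun v x => by
    change r.1 v ((subIncl (ker_stable θ)).1 v ((D.i j).1 v x)) = x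
    rw [hr, D.p_i]
  refine hθ0 (hom_ext fun v x => ?_)
  rw [← hret v x]
  exact ((D.i j).1 v (r.1 v x)).2

variable [∀ s t : I, Fintype (s ⟶ t)]

theorem Brick.homDim_eq_one {X : QRep I} (h : Brick X) (h0 : ¬ X.IsZero) : homDim X X = 1 :=
  finrank_eq_one (idHom X) (fun h' => h0 (isZero_iff_idHom.2 h')) fun f => by
    obtain ⟨c, hc⟩ := h f
    exact ⟨c, hom_ext fun v x => (hc v x).symm⟩

end fin

end QRep

section eulerPosDef

open QRep

variable (I : Type) [Quiver.{0} I] [Fintype I] [∀ s t : I, Fintype (s ⟶ t)]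

/-- The Euler form of the quiver is positive definite. -/
def EulerPosDef : Prop := ∀ x : I → ℤ, x ≠ 0 → 0 < euler x x

variable {I}

namespace QRep

theorem Indecomposable.brick_and_extZero (hq : EulerPosDef I) {X : QRep I}
    (hX : X.Indecomposable) (hf : X.FinDim) : Brick X ∧ ExtZero X X := by
  induction hn : X.tdim using Nat.strong_induction_on generalizing X with
  | _ n ih =>
  subst hn
  have hb : Brick X := hX.brick_of_rigid hf fun K hK hKi hlt => (ih _ hlt hKi hK rfl).2
  refine ⟨hb, (extDim_eq_zero_iff hf hf).1 ?_⟩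
  have h1 := homDim_sub_extDim hf hf
  have h2 := hq _ (dv_ne_zero hf hX.1)
  rw [hb.homDim_eq_one hX.1] at h1
  omega

theorem Indecomposable.homDim_self (hq : EulerPosDef I) {X : QRep I}
    (hX : X.Indecomposable) (hf : X.FinDim) : homDim X X = 1 :=
  (hX.brick_and_extZero hq hf).1.homDim_eq_one hX.1

theorem Indecomposable.euler_self (hq : EulerPosDef I) {X : QRep I}
    (hX : X.Indecomposable) (hf : X.FinDim) : euler X.dv X.dv = 1 := by
  rw [← homDim_sub_extDim hf hf, hX.homDim_self hq hf,
    (extDim_eq_zero_iff hf hf).2 (hX.brick_and_extZero hq hf).2]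
  rfl

theorem Indecomposable.bijective_of_comp_ne_zero (hq : EulerPosDef I) {X Y : QRep I}
    (hX : X.Indecomposable) (hXf : X.FinDim) (hY : Y.Indecomposable) (f : Hom X Y) (g : Hom Y X)
    (h : comp g f ≠ 0) (v : I) : Function.Bijective (f.1 v) := by
  obtain ⟨c, hc⟩ := (hX.brick_and_extZero hq hXf).1 (comp g f)
  have hc0 : c ≠ 0 := by
    rintro rfl
    exact h (hom_ext fun v x => (hc v x).trans (zero_smul _ _))
  have h1 : ∀ v x, (c⁻¹ • g).1 v (f.1 v x) = x := fun v x => by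
    have := hc v x
    rw [comp_apply] at this
    rw [hom_smul_apply, this, smul_smul, inv_mul_cancel₀ hc0, one_smul]
  exact Function.bijective_iff_has_inverse.2
    ⟨_, h1 v, hY.section_of_retract hX.1 f _ h1 v⟩

/-- Happel–Ringel: a nonzero homomorphism `Y → Z` of indecomposables with `Ext¹(Z, Y) = 0` is
injective or surjective. -/
theorem injective_or_surjective (hq : EulerPosDef I) {Y Z : QRep I} (hY : Y.Indecomposable)
    (hYf : Y.FinDim) (hZ : Z.Indecomposable) (hZf : Z.FinDim) (f : Hom Y Z) (hf : f ≠ 0)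
    (h : ExtZero Z Y) :
    (∀ v, Function.Injective (f.1 v)) ∨ ∀ v, Function.Surjective (f.1 v) := by
  obtain ⟨u, r, hur⟩ := exists_id_im_eq f h
  have hLf : (im f).FinDim := subrep_finDim hZf
  obtain ⟨J, _, K, hK, ⟨D⟩⟩ := exists_sumDecomp (im f) hLf
  obtain ⟨j⟩ : Nonempty J := by
    by_contra hJ
    rw [not_nonempty_iff] at hJ
    refine im_not_isZero hf fun v => ⟨fun x y => ?_⟩
    rw [← D.sum_i_p v x, ← D.sum_i_p v y, Finset.univ_eq_empty, Finset.sum_empty,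
      Finset.sum_empty]
  by_cases hA : comp (comp (D.p j) (toIm f)) (comp u (D.i j)) = 0
  · right
    have hB : comp (comp (D.p j) r) (comp (subIncl (range_stable f)) (D.i j)) ≠ 0 := by
      intro hB
      refine (hK j).2.1 (isZero_iff_idHom.2 (hom_ext fun v x => ?_))
      have h1 := congrArg ((D.p j).1 v) (hur v ((D.i j).1 v x))
      have h2 : (D.p j).1 v ((toIm f).1 v (u.1 v ((D.i j).1 v x))) = 0 :=
        congrArg (fun g : Hom (K j) (K j) => g.1 v x) hA
      have h3 : (D.p j).1 v (r.1 v ((subIncl (range_stable f)).1 v ((D.i j).1 v x))) = 0 :=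
        congrArg (fun g : Hom (K j) (K j) => g.1 v x) hB
      rw [map_add, h2, h3, D.p_i, add_zero] at h1
      exact h1.symm
    intro v z
    obtain ⟨x, rfl⟩ := ((hK j).2.bijective_of_comp_ne_zero hq (hK j).1 hZ _ _ hB v).2 z
    exact ((D.i j).1 v x).2
  · left
    have h1 := (hK j).2.bijective_of_comp_ne_zero hq (hK j).1 hY _ _ hA
    have h2 : Y.tdim ≤ (im f).tdim :=
      (tdim_le_of_surjective (hK j).1 _ fun v => (h1 v).2).trans
        (tdim_le_of_injective hLf (D.i j) (D.injective_i j))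
    intro v x y hxy
    exact (bijective_of_surjective hYf hLf (toIm f) (toIm_surjective f) h2 v).1 (Subtype.ext hxy)

end QRep

end eulerPosDef

namespace QRep

section extension

variable {I : Type} [Quiver.{0} I]

/-! ### Extensions -/

/-- The middle term of the extension `0 → Y → E → X → 0` given by a 1-cochain. -/
def extRep {X Y : QRep I} (ζ : C1 X Y) : QRep I where
  V v := Y.V v × X.V v
  map {s t} a := ((Y.map a).coprod (ζ ⟨s, t, a⟩)).prod (X.map a ∘ₗ LinearMap.snd ℂ _ _)

/-- The inclusion in the middle term of an extension. -/
def extInl {X Y : QRep I} (ζ : C1 X Y) : Hom Y (extRep ζ) :=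
  mkHom (fun v => LinearMap.inl ℂ _ _) fun s t a x => by
    refine Prod.ext ?_ ?_
    · change Y.map a x = Y.map a x + ζ ⟨s, t, a⟩ 0
      rw [map_zero, add_zero]
    · exact (map_zero (X.map a)).symm

/-- The projection from the middle term of an extension. -/
def extSnd {X Y : QRep I} (ζ : C1 X Y) : Hom (extRep ζ) X :=
  mkHom (fun _ => LinearMap.snd ℂ _ _) fun _ _ _ _ => rfl

theorem exists_inl_eq {X Y : QRep I} (ζ : C1 X Y) (v : I) (e : (extRep ζ).V v)
    (h : (extSnd ζ).1 v e = 0) : (extInl ζ).1 v e.1 = e := Prod.ext rfl h.symm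

/-- The (linear) inclusion of the space of the quotient in the middle term of an extension. -/
def extInr {X Y : QRep I} (ζ : C1 X Y) (v : I) : X.V v →ₗ[ℂ] (extRep ζ).V v :=
  LinearMap.inr ℂ (Y.V v) (X.V v)

theorem extInl_add_inr {X Y : QRep I} (ζ : C1 X Y) (v : I) (e : (extRep ζ).V v) :
    (extInl ζ).1 v e.1 + extInr ζ v ((extSnd ζ).1 v e) = e :=
  Prod.ext (add_zero e.1) (zero_add e.2)

theorem extRep_map_inr {X Y : QRep I} (ζ : C1 X Y) {s t : I} (a : s ⟶ t) (x : X.V s) :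
    (extRep ζ).map a (extInr ζ s x) = (extInl ζ).1 t (ζ ⟨s, t, a⟩ x) + extInr ζ t (X.map a x) := by
  refine Prod.ext ?_ ?_
  · change Y.map a 0 + ζ ⟨s, t, a⟩ x = ζ ⟨s, t, a⟩ x + 0
    rw [map_zero, zero_add, add_zero]
  · exact (zero_add (X.map a x)).symm

theorem extRep_finDim {X Y : QRep I} (hX : X.FinDim) (hY : Y.FinDim) (ζ : C1 X Y) :
    (extRep ζ).FinDim := fun v =>
  have := hX v
  have := hY v
  inferInstanceAs (Module.Finite ℂ (Y.V v × X.V v))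

/-- The cocycle of a split extension is a coboundary. -/
theorem mem_range_of_retraction {X Y : QRep I} (ζ : C1 X Y) (r : Hom (extRep ζ) Y)
    (h : ∀ v y, r.1 v ((extInl ζ).1 v y) = y) : ζ ∈ LinearMap.range (delta X Y) := by
  refine ⟨fun v => -(r.1 v ∘ₗ extInr ζ v), ?_⟩
  funext a
  refine LinearMap.ext fun x => ?_
  have h1 := hom_map r a.2.2 (extInr ζ a.1 x)
  rw [extRep_map_inr, map_add, h] at h1
  rw [delta_apply]
  simp only [LinearMap.neg_apply, LinearMap.comp_apply, map_neg]
  rw [← h1]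
  abel

/-- A homomorphism on `Y` extends to the middle term of an extension of `X` by `Y` if its target
has no extensions by `X`. -/
theorem exists_extend_extRep {X Y N : QRep I} (ζ : C1 X Y) (h : Hom Y N) (hN : ExtZero X N) :
    ∃ H : Hom (extRep ζ) N, ∀ v y, H.1 v ((extInl ζ).1 v y) = h.1 v y := by
  obtain ⟨w, hw⟩ := hN fun a => -(h.1 a.2.1 ∘ₗ ζ a)
  refine ⟨mkHom (fun v => (h.1 v).coprod (w v)) fun s t a e => ?_, fun v y => ?_⟩
  · have h1 := LinearMap.congr_fun (congrFun hw ⟨s, t, a⟩) e.2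
    rw [delta_apply] at h1
    change h.1 t (Y.map a e.1 + ζ ⟨s, t, a⟩ e.2) + w t (X.map a e.2) =
      N.map a (h.1 s e.1 + w s e.2)
    have h2 : w t (X.map a e.2) - N.map a (w s e.2) = -(h.1 t (ζ ⟨s, t, a⟩ e.2)) := h1
    rw [map_add, map_add, hom_map, sub_eq_iff_eq_add.1 h2]
    abel
  · change h.1 v y + w v 0 = h.1 v y
    rw [map_zero, add_zero]

variable [Fintype I]

/-- In a nonsplit extension `0 → Y → E → X → 0` with `Y` indecomposable, an indecomposable summand
of `E` to which `Y` maps nontrivially is not isomorphic to `Y` via this map, and maps nontrivially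
to `X`. -/
theorem summand_of_nonsplit {X Y : QRep I} (hY : Y.Indecomposable) {ζ : C1 X Y}
    (hζ : ζ ∉ LinearMap.range (delta X Y)) {J : Type} [Fintype J] {E : J → QRep I}
    (D : SumDecomp (extRep ζ) E) (j : J) (hE : (E j).Indecomposable) :
    (¬ ∀ v, Function.Bijective ((comp (D.p j) (extInl ζ)).1 v)) ∧
      comp (extSnd ζ) (D.i j) ≠ 0 := by
  have hnb : ¬ ∀ v, Function.Bijective ((comp (D.p j) (extInl ζ)).1 v) := fun hb => by
    let e := isoOfBijective _ hb
    exact hζ (mem_range_of_retraction ζ (comp e.symm.hom (D.p j))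
      fun v y => e.symm_hom_apply v y)
  refine ⟨hnb, fun h0 => hnb fun v => ?_⟩
  have h1 : ∀ v x, (extSnd ζ).1 v ((D.i j).1 v x) = 0 := fun v x =>
    congrArg (fun g : Hom (E j) X => g.1 v x) h0
  let u : Hom (E j) Y := mkHom (fun v => LinearMap.fst ℂ (Y.V v) (X.V v) ∘ₗ (D.i j).1 v)
    fun s t a x => by
      change ((D.i j).1 t ((E j).map a x)).1 = Y.map a ((D.i j).1 s x).1
      rw [hom_map]
      change Y.map a ((D.i j).1 s x).1 + ζ ⟨s, t, a⟩ ((D.i j).1 s x).2 = _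
      rw [show ((D.i j).1 s x).2 = 0 from h1 s x, map_zero, add_zero]
  have hu : ∀ v x, (comp (D.p j) (extInl ζ)).1 v (u.1 v x) = x := fun v x => by
    rw [comp_apply]
    change (D.p j).1 v ((extInl ζ).1 v ((D.i j).1 v x).1) = x
    rw [exists_inl_eq ζ v _ (h1 v x), D.p_i]
  exact Function.bijective_iff_has_inverse.2
    ⟨u.1 v, hY.section_of_retract hE.1 u _ hu v, hu v⟩

/-- If `Ext¹(X, Y) ≠ 0`, there is an indecomposable strictly between `Y` and `X`. -/
theorem exists_between_of_not_extZero {X Y : QRep I} (hXf : X.FinDim) (hYf : Y.FinDim)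
    (hY : Y.Indecomposable) (h : ¬ ExtZero X Y) : ∃ E : QRep I, E.FinDim ∧ E.Indecomposable ∧
      (∃ f : Hom Y E, f ≠ 0 ∧ ¬ ∀ v, Function.Bijective (f.1 v)) ∧ ∃ g : Hom E X, g ≠ 0 := by
  simp only [ExtZero, Function.Surjective, not_forall] at h
  obtain ⟨ζ, hζ⟩ := h
  obtain ⟨J, _, E, hE, ⟨D⟩⟩ := exists_sumDecomp (extRep ζ) (extRep_finDim hXf hYf ζ)
  obtain ⟨j, hj⟩ : ∃ j, comp (D.p j) (extInl ζ) ≠ 0 := by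
    by_contra! h0
    refine hY.1 (isZero_iff_idHom.2 (hom_ext fun v y => ?_))
    have : (extInl ζ).1 v y = 0 := by
      rw [← D.sum_i_p v ((extInl ζ).1 v y)]
      refine Finset.sum_eq_zero fun j _ => ?_
      have h0' : (D.p j).1 v ((extInl ζ).1 v y) = 0 :=
        congrArg (fun g : Hom Y (E j) => g.1 v y) (h0 j)
      rw [h0', map_zero]
    exact congrArg Prod.fst this
  obtain ⟨h1, h2⟩ := summand_of_nonsplit hY hζ D j (hE j).2
  exact ⟨E j, (hE j).1, (hE j).2, ⟨_, hj, h1⟩, _, h2⟩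

/-- If `Ext¹(X, Y) ≠ 0`, `Ext¹(X, N) = 0` and `h : Y → N` is nonzero, there is an indecomposable
strictly between `Y` and `X` over which `h` factors. -/
theorem exists_between_factoring {X Y N : QRep I} (hXf : X.FinDim) (hYf : Y.FinDim)
    (hY : Y.Indecomposable) (h : ¬ ExtZero X Y) (hN : ExtZero X N) (k : Hom Y N) (hk : k ≠ 0) :
    ∃ E : QRep I, E.FinDim ∧ E.Indecomposable ∧ (∃ (f : Hom Y E) (k' : Hom E N),
      comp k' f ≠ 0 ∧ ¬ ∀ v, Function.Bijective (f.1 v)) ∧ ∃ g : Hom E X, g ≠ 0 := by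
  simp only [ExtZero, Function.Surjective, not_forall] at h
  obtain ⟨ζ, hζ⟩ := h
  obtain ⟨J, _, E, hE, ⟨D⟩⟩ := exists_sumDecomp (extRep ζ) (extRep_finDim hXf hYf ζ)
  obtain ⟨H, hH⟩ := exists_extend_extRep ζ k hN
  obtain ⟨j, hj⟩ : ∃ j, comp (comp H (D.i j)) (comp (D.p j) (extInl ζ)) ≠ 0 := by
    by_contra! h0
    refine hk (hom_ext fun v y => ?_)
    rw [← hH, ← D.sum_i_p v ((extInl ζ).1 v y), map_sum]
    refine Finset.sum_eq_zero fun j _ => ?_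
    exact congrArg (fun g : Hom Y N => g.1 v y) (h0 j)
  obtain ⟨h1, h2⟩ := summand_of_nonsplit hY hζ D j (hE j).2
  exact ⟨E j, (hE j).1, (hE j).2, ⟨_, _, hj, h1⟩, _, h2⟩

/-! ### Existence of indecomposables -/

variable [∀ s t : I, Fintype (s ⟶ t)]

/-- Homomorphisms out of the middle term of an extension. -/
theorem homDim_extRep_left_le {X Y N : QRep I} (hX : X.FinDim) (hY : Y.FinDim) (hN : N.FinDim)
    (ζ : C1 X Y) : homDim (extRep ζ) N ≤ homDim X N +
      Module.finrank ℂ (LinearMap.range (compRight (N := N) (extInl ζ))) := by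
  have := hom_finite (extRep_finDim hX hY ζ) hN
  have := hom_finite hX hN
  rw [homDim, ← (compRight (N := N) (extInl ζ)).finrank_range_add_finrank_ker, add_comm]
  refine Nat.add_le_add_right ?_ _
  have hle : LinearMap.ker (compRight (N := N) (extInl ζ)) ≤
      LinearMap.range (compRight (N := N) (extSnd ζ)) := fun f hf => by
    have h0 : ∀ v y, f.1 v ((extInl ζ).1 v y) = 0 := fun v y =>
      congrArg (fun g : Hom Y N => g.1 v y) hf
    have h1 : ∀ v e, f.1 v (extInr ζ v ((extSnd ζ).1 v e)) = f.1 v e := fun v e => by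
      conv_rhs => rw [← extInl_add_inr ζ v e, map_add, h0, zero_add]
    refine ⟨mkHom (fun v => f.1 v ∘ₗ extInr ζ v) fun s t a x => ?_, hom_ext fun v e => h1 v e⟩
    rw [LinearMap.comp_apply, LinearMap.comp_apply, ← hom_map f, extRep_map_inr, map_add, h0,
      zero_add]
  exact (Submodule.finrank_mono hle).trans (LinearMap.finrank_range_le _)

/-- Homomorphisms into the middle term of an extension. -/
theorem homDim_extRep_right_le {X Y N : QRep I} (hX : X.FinDim) (hY : Y.FinDim) (hN : N.FinDim)
    (ζ : C1 X Y) : homDim N (extRep ζ) ≤ homDim N Y + homDim N X := by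
  have := hom_finite hN (extRep_finDim hX hY ζ)
  have := hom_finite hN hX
  have := hom_finite hN hY
  rw [homDim, ← (compLeft (X := N) (extSnd ζ)).finrank_range_add_finrank_ker, add_comm]
  refine Nat.add_le_add ?_ (Submodule.finrank_le _)
  have hle : LinearMap.ker (compLeft (X := N) (extSnd ζ)) ≤
      LinearMap.range (compLeft (X := N) (extInl ζ)) := fun f hf => by
    have h0 : ∀ v y, (extSnd ζ).1 v (f.1 v y) = 0 := fun v y =>
      congrArg (fun g : Hom N X => g.1 v y) hf
    refine ⟨mkHom (fun v => LinearMap.fst ℂ (Y.V v) (X.V v) ∘ₗ f.1 v) fun s t a x => ?_,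
      hom_ext fun v e => exists_inl_eq ζ v _ (h0 v e)⟩
    change (f.1 t (N.map a x)).1 = Y.map a (f.1 s x).1
    rw [hom_map]
    change Y.map a (f.1 s x).1 + ζ ⟨s, t, a⟩ (f.1 s x).2 = _
    rw [show (f.1 s x).2 = 0 from h0 s x, map_zero, add_zero]
  exact (Submodule.finrank_mono hle).trans (LinearMap.finrank_range_le _)

/-- A nonsplit extension has fewer endomorphisms than the direct sum. -/
theorem homDim_extRep_lt {X Y : QRep I} (hX : X.FinDim) (hY : Y.FinDim) (ζ : C1 X Y)
    (hζ : ζ ∉ LinearMap.range (delta X Y)) : homDim (extRep ζ) (extRep ζ) <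
      homDim Y Y + homDim Y X + homDim X Y + homDim X X := by
  have h1 := homDim_extRep_right_le hX hY (extRep_finDim hX hY ζ) ζ
  have h2 := homDim_extRep_left_le hX hY hX ζ
  have h3 := homDim_extRep_left_le hX hY hY ζ
  have := hom_finite hY hY
  have := hom_finite hY hX
  have h4 : Module.finrank ℂ (LinearMap.range (compRight (N := X) (extInl ζ))) ≤ homDim Y X :=
    Submodule.finrank_le _
  have h5 : Module.finrank ℂ (LinearMap.range (compRight (N := Y) (extInl ζ))) < homDim Y Y := by
    refine Submodule.finrank_lt fun htop => hζ ?_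
    obtain ⟨r, hr⟩ := htop.ge (Submodule.mem_top (x := idHom Y))
    exact mem_range_of_retraction ζ r fun v y => congrArg (fun g : Hom Y Y => g.1 v y) hr
  omega

/-- The decomposition of a direct sum of two representations. -/
def prodDecomp {M A B : QRep I} (e : Iso M (A.prod B)) :
    SumDecomp M (fun b : Bool => bif b then A else B) where
  i b := match b with
    | true => comp e.symm.hom (prodInl A B)
    | false => comp e.symm.hom (prodInr A B)
  p b := match b with
    | true => comp (prodFst A B) e.hom
    | false => comp (prodSnd A B) e.hom
  p_i b v := match b with
    | true => fun x : A.V v => congrArg ((prodFst A B).1 v) (e.hom_symm_apply v _)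
    | false => fun x : B.V v => congrArg ((prodSnd A B).1 v) (e.hom_symm_apply v _)
  p_i_ne b c h v := match b, c with
    | true, true => (h rfl).elim
    | false, false => (h rfl).elim
    | true, false => fun x : B.V v => congrArg ((prodFst A B).1 v) (e.hom_symm_apply v _)
    | false, true => fun x : A.V v => congrArg ((prodSnd A B).1 v) (e.hom_symm_apply v _)
  sum_i_p v x := by
    rw [Fintype.sum_bool]
    change e.symm.hom.1 v ((prodInl A B).1 v ((prodFst A B).1 v (e.hom.1 v x))) +
      e.symm.hom.1 v ((prodInr A B).1 v ((prodSnd A B).1 v (e.hom.1 v x))) = x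
    rw [← map_add, prod_eta, e.symm_hom_apply]

/-- If the Euler form is positive definite, there is an indecomposable for each dimension vector of
length `1`: a representation with the fewest endomorphisms among those of this dimension has no
extensions between complementary summands, so the Euler form takes a value at least `2` on it if it
decomposes. -/
theorem exists_indecomposable (hq : EulerPosDef I) {M : QRep I} (hM : M.FinDim)
    (h : euler M.dv M.dv = 1) :
    ∃ X : QRep I, X.FinDim ∧ X.Indecomposable ∧ X.dv = M.dv := by
  have hne : ((fun N : QRep I => homDim N N) '' {N | N.FinDim ∧ N.dv = M.dv}).Nonempty :=
    ⟨_, M, ⟨hM, rfl⟩, rfl⟩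
  obtain ⟨N, ⟨hN, hNM⟩, hmin⟩ := Nat.sInf_mem hne
  have hmin' : ∀ N' : QRep I, N'.FinDim → N'.dv = M.dv → homDim N N ≤ homDim N' N' :=
    fun N' h1 h2 => hmin.le.trans (Nat.sInf_le ⟨N', ⟨h1, h2⟩, rfl⟩)
  refine ⟨N, hN, ⟨fun h0 => ?_, ?_⟩, hNM⟩
  · have : N.dv = 0 := funext fun v => by
      have := h0 v
      exact Int.natCast_inj.2 (Module.finrank_zero_of_subsingleton (R := ℂ) (M := N.V v))
    rw [← hNM, this, map_zero] at h
    simp at h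
  rintro A B ⟨e⟩
  by_contra! hAB
  let D := prodDecomp e
  have hA : A.FinDim := D.finDim hN true
  have hB : B.FinDim := D.finDim hN false
  have hd : N.dv = A.dv + B.dv := by
    rw [D.dv_eq hN, Fintype.sum_bool]
    rfl
  have hend : homDim N N = homDim A A + homDim A B + homDim B A + homDim B B := by
    rw [D.homDim_left hN hN, Fintype.sum_bool]
    change homDim A N + homDim B N = _
    rw [D.homDim_right hN hA, D.homDim_right hN hB, Fintype.sum_bool, Fintype.sum_bool]
    change homDim A A + homDim A B + (homDim B A + homDim B B) = _
    ring
  have key : ∀ A B : QRep I, A.FinDim → B.FinDim → A.dv + B.dv = M.dv →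
      homDim A A + homDim A B + homDim B A + homDim B B = homDim N N → extDim B A = 0 := by
    intro A B hA hB hd hend
    rw [extDim_eq_zero_iff hB hA]
    by_contra h
    simp only [ExtZero, Function.Surjective, not_forall] at h
    obtain ⟨ζ, hζ⟩ := h
    have h1 := homDim_extRep_lt hB hA ζ hζ
    have h2 := hmin' (extRep ζ) (extRep_finDim hB hA ζ) (by rw [← hd]; exact dv_prod hA hB)
    omega
  have h1 := key A B hA hB (by rw [← hd, hNM]) hend.symm
  have h2 := key B A hB hA (by rw [add_comm, ← hd, hNM]) (by rw [hend]; ring)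
  have h3 := homDim_sub_extDim hA hB
  have h4 := homDim_sub_extDim hB hA
  have h5 := hq _ (dv_ne_zero hA hAB.1)
  have h6 := hq _ (dv_ne_zero hB hAB.2)
  rw [← hNM, hd] at h
  simp only [map_add, LinearMap.add_apply] at h
  omega

end extension

section paths

variable {I : Type} [Quiver.{0} I]

/-! ### Paths, and the projective and injective representations at a vertex -/

/-- The linear map of a path. -/
def pathMap (M : QRep I) {v : I} : ∀ {w : I}, Quiver.Path v w → M.V v →ₗ[ℂ] M.V w
  | _, .nil => LinearMap.id
  | _, .cons p a => M.map a ∘ₗ pathMap M p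

@[simp] theorem pathMap_nil (M : QRep I) {v : I} (x : M.V v) :
    pathMap M (Quiver.Path.nil : Quiver.Path v v) x = x := rfl

theorem pathMap_cons (M : QRep I) {v w u : I} (p : Quiver.Path v w) (a : w ⟶ u) (x : M.V v) :
    pathMap M (p.cons a) x = M.map a (pathMap M p x) := rfl

theorem pathMap_comp (M : QRep I) {v w u : I} (p : Quiver.Path v w) (q : Quiver.Path w u)
    (x : M.V v) : pathMap M (p.comp q) x = pathMap M q (pathMap M p x) := by
  induction q with
  | nil => rfl
  | cons q a ih => rw [Quiver.Path.comp_cons, pathMap_cons, pathMap_cons, ih]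

theorem pathMap_toPath (M : QRep I) {v w : I} (a : v ⟶ w) (x : M.V v) :
    pathMap M a.toPath x = M.map a x := rfl

theorem hom_pathMap {M N : QRep I} (f : Hom M N) {v w : I} (p : Quiver.Path v w) (x : M.V v) :
    f.1 w (pathMap M p x) = pathMap N p (f.1 v x) := by
  induction p with
  | nil => rfl
  | cons p a ih => rw [pathMap_cons, pathMap_cons, hom_map, ih]

/-- The indecomposable projective representation `P(v)`. -/
def projRep (v : I) : QRep I where
  V w := Quiver.Path v w →₀ ℂ
  map a := Finsupp.lmapDomain ℂ ℂ fun p => p.cons a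

/-- The basis element of `P(v)` given by a path. -/
def projBasis {v w : I} (p : Quiver.Path v w) : (projRep v).V w := Finsupp.single p (1 : ℂ)

theorem projRep_map {v w u : I} (p : Quiver.Path v w) (a : w ⟶ u) :
    (projRep v).map a (projBasis p) = projBasis (p.cons a) := Finsupp.mapDomain_single

theorem projBasis_eq_pathMap {v w : I} (p : Quiver.Path v w) :
    projBasis p = pathMap (projRep v) p (projBasis .nil) := by
  induction p with
  | nil => rfl
  | cons p a ih => rw [pathMap_cons, ← ih, projRep_map]

theorem projRep_linearMap_ext {v w : I} {E : Type} [AddCommGroup E] [Module ℂ E]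
    {f g : (projRep v).V w →ₗ[ℂ] E} (h : ∀ p, f (projBasis p) = g (projBasis p)) : f = g :=
  Finsupp.lhom_ext' fun p => LinearMap.ext_ring (h p)

/-- The linear map `P(v) → Z` at a vertex, given by an element of the space of `Z` at `v`. -/
def projLin (Z : QRep I) {v : I} (z : Z.V v) (w : I) : (projRep v).V w →ₗ[ℂ] Z.V w :=
  Finsupp.linearCombination ℂ fun p : Quiver.Path v w => pathMap Z p z

theorem projLin_basis (Z : QRep I) {v w : I} (z : Z.V v) (p : Quiver.Path v w) :
    projLin Z z w (projBasis p) = pathMap Z p z :=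
  (Finsupp.linearCombination_single ℂ (1 : ℂ) p).trans (one_smul ℂ _)

/-- The homomorphism `P(v) → Z` given by an element of the space of `Z` at `v`. -/
def projHom (Z : QRep I) {v : I} (z : Z.V v) : Hom (projRep v) Z :=
  ⟨projLin Z z, fun s t a => projRep_linearMap_ext fun p => by
    rw [LinearMap.comp_apply, LinearMap.comp_apply, projRep_map, projLin_basis, projLin_basis,
      pathMap_cons]⟩

theorem projHom_basis (Z : QRep I) {v w : I} (z : Z.V v) (p : Quiver.Path v w) :
    (projHom Z z).1 w (projBasis p) = pathMap Z p z := projLin_basis Z z p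

/-- Homomorphisms out of `P(v)`. -/
def projHomEquiv (Z : QRep I) (v : I) : Hom (projRep v) Z ≃ₗ[ℂ] Z.V v where
  toFun f := f.1 v (projBasis .nil)
  map_add' _ _ := rfl
  map_smul' _ _ := rfl
  invFun z := projHom Z z
  left_inv f := Subtype.ext <| funext fun w => projRep_linearMap_ext fun p => by
    rw [projHom_basis]
    conv_rhs => rw [projBasis_eq_pathMap p, hom_pathMap]
  right_inv z := projHom_basis Z z .nil

/-- The indecomposable injective representation `I(v)`. -/
def injRep (v : I) : QRep I where
  V w := Quiver.Path w v → ℂ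
  map a := LinearMap.funLeft ℂ ℂ fun p => a.toPath.comp p

theorem injRep_map {v w u : I} (a : w ⟶ u) (f : (injRep v).V w) (p : Quiver.Path u v) :
    (injRep v).map a f p = f (a.toPath.comp p) := rfl

theorem injRep_pathMap {v w u : I} (q : Quiver.Path w u) (f : (injRep v).V w)
    (p : Quiver.Path u v) : pathMap (injRep v) q f p = f (q.comp p) := by
  induction q with
  | nil => exact congrArg f (Quiver.Path.nil_comp p).symm
  | cons q a ih =>
    rw [pathMap_cons, injRep_map, ih, ← Quiver.Path.comp_assoc]
    rfl

/-- Homomorphisms into `I(v)`. -/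
def injHomEquiv (X : QRep I) (v : I) : Hom X (injRep v) ≃ₗ[ℂ] Module.Dual ℂ (X.V v) where
  toFun f := LinearMap.proj (R := ℂ) (φ := fun _ : Quiver.Path v v => ℂ) .nil ∘ₗ f.1 v
  map_add' _ _ := rfl
  map_smul' _ _ := rfl
  invFun l := mkHom (fun w => LinearMap.pi fun p : Quiver.Path w v => l ∘ₗ pathMap X p)
    fun s t a x => funext fun p => by
      change l (pathMap X p (X.map a x)) = l (pathMap X (a.toPath.comp p) x)
      rw [pathMap_comp, pathMap_toPath]
  left_inv f := hom_ext fun w x => funext fun p => by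
    change f.1 v (pathMap X p x) .nil = f.1 w x p
    rw [hom_pathMap, injRep_pathMap, Quiver.Path.comp_nil]
  right_inv l := rfl

variable [Fintype I] [∀ s t : I, Fintype (s ⟶ t)]

/-- A quiver with positive definite Euler form has no oriented cycles: the form would not be
positive at the characteristic function of a set of vertices each of which is the target of an arrow
from the set. -/
theorem wellFounded_arrow (hq : EulerPosDef I) :
    WellFounded fun u w : I => Nonempty (u ⟶ w) := by
  classical
  rw [WellFounded.wellFounded_iff_has_min]
  intro C ⟨c, hc⟩
  by_contra! h
  choose! f hf ha using h
  let a : C → Arr I := fun m => ⟨f m, m, (ha m m.2).some⟩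
  have ha' : Function.Injective a := fun m n hmn => by
    have : (a m).2.1 = (a n).2.1 := by rw [hmn]
    exact Subtype.ext this
  let x : I → ℤ := C.indicator 1
  have hx : x ≠ 0 := fun h0 => by
    have := congrFun h0 c
    simp [x, hc] at this
  have hpos := hq x hx
  have h0 : ∀ v, 0 ≤ x v := fun v => Set.indicator_nonneg (fun _ _ => zero_le_one) v
  have h1 : ∑ v, x v * x v = ∑ m : C, 1 := by
    have : ∀ v, x v * x v = C.indicator 1 v := fun v => by
      by_cases hv : v ∈ C <;> simp [x, hv]
    simp only [this, Set.indicator_apply, Pi.one_apply]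
    rw [Finset.sum_boole, Finset.sum_const, Finset.card_univ, Fintype.card_subtype]
    simp
  have h2 : ∑ m : C, (1 : ℤ) ≤ ∑ b : Arr I, x b.1 * x b.2.1 := by
    calc ∑ m : C, (1 : ℤ) = ∑ m : C, x (a m).1 * x (a m).2.1 :=
          Finset.sum_congr rfl fun m _ => by simp [x, a, hf m m.2]
      _ = ∑ b ∈ Finset.univ.map ⟨a, ha'⟩, x b.1 * x b.2.1 := by simp
      _ ≤ _ := Finset.sum_le_sum_of_subset_of_nonneg (Finset.subset_univ _)
          fun b _ _ => mul_nonneg (h0 _) (h0 _)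
  rw [euler_apply, h1] at hpos
  omega

/-- A path is trivial or ends with an arrow. -/
def pathEquiv (v w : I) :
    Quiver.Path v w ≃ PLift (v = w) ⊕ Σ u : I, Quiver.Path v u × (u ⟶ w) where
  toFun p := match w, p with
    | _, .nil => .inl ⟨rfl⟩
    | _, .cons p a => .inr ⟨_, p, a⟩
  invFun x := match x with
    | .inl ⟨h⟩ => h ▸ .nil
    | .inr ⟨_, p, a⟩ => p.cons a
  left_inv p := by cases p <;> rfl
  right_inv x := by
    rcases x with ⟨⟨rfl⟩⟩ | ⟨u, p, a⟩ <;> rfl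

theorem finite_path (hq : EulerPosDef I) (v w : I) : Finite (Quiver.Path v w) := by
  induction w using (wellFounded_arrow hq).induction with
  | _ w ih =>
  have : ∀ u, Finite (Quiver.Path v u × (u ⟶ w)) := fun u => by
    by_cases h : Nonempty (u ⟶ w)
    · have := ih u h
      infer_instance
    · rw [not_nonempty_iff] at h
      infer_instance
  exact Finite.of_equiv _ (pathEquiv v w).symm

/-- The number of paths from `v` to `w`. -/
def pathCount (v w : I) : ℤ := Nat.card (Quiver.Path v w)

/-- The number of arrows from `v` to `w`. -/
def arrowCount (v w : I) : ℤ := Fintype.card (v ⟶ w)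

open Classical in
theorem pathCount_eq (hq : EulerPosDef I) (v w : I) :
    pathCount v w = (if v = w then 1 else 0) + ∑ u, pathCount v u * arrowCount u w := by
  have := fun u => finite_path hq v u
  rw [pathCount, Nat.card_congr (pathEquiv v w), Nat.card_sum, Nat.card_sigma]
  simp only [Nat.card_prod, Nat.card_eq_fintype_card (α := _ ⟶ _)]
  push_cast
  congr 1
  by_cases h : v = w
  · subst h
    simp
  · simp [h]

open Classical in
/-- Counting paths by their first arrow; this is the previous formula, as a one-sided inverse of a
square matrix is two-sided. -/
theorem pathCount_eq' (hq : EulerPosDef I) (v w : I) :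
    pathCount v w = (if v = w then 1 else 0) + ∑ u, arrowCount v u * pathCount u w := by
  let N : Matrix I I ℤ := fun v w => pathCount v w
  let A : Matrix I I ℤ := fun v w => arrowCount v w
  have h1 : N * (1 - A) = 1 := by
    ext v w
    rw [mul_sub, mul_one, Matrix.sub_apply, Matrix.mul_apply, Matrix.one_apply]
    simp only [N, A]
    rw [pathCount_eq hq v w]
    ring
  have h2 : (1 - A) * N = 1 := mul_eq_one_comm.1 h1
  have h3 := congrFun (congrFun h2 v) w
  rw [sub_mul, one_mul, Matrix.sub_apply, Matrix.mul_apply, Matrix.one_apply] at h3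
  simp only [N, A] at h3
  linarith

theorem sum_arr {f : I → I → ℤ} : ∑ a : Arr I, f a.1 a.2.1 = ∑ s, ∑ t, arrowCount s t * f s t := by
  rw [Fintype.sum_sigma]
  refine Finset.sum_congr rfl fun s _ => ?_
  rw [Fintype.sum_sigma]
  refine Finset.sum_congr rfl fun t _ => ?_
  simp [arrowCount]

theorem euler_pathCount_left (hq : EulerPosDef I) (v : I) (n : I → ℤ) :
    euler (fun w => pathCount v w) n = n v := by
  classical
  rw [euler_apply, sum_arr (f := fun s t => pathCount v s * n t), Finset.sum_comm,
    ← Finset.sum_sub_distrib]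
  have : ∀ t, pathCount v t * n t - ∑ s, arrowCount s t * (pathCount v s * n t) =
      if v = t then n t else 0 := fun t => by
    rw [pathCount_eq hq v t, add_mul, Finset.sum_mul]
    have h : ∀ s, arrowCount s t * (pathCount v s * n t) = pathCount v s * arrowCount s t * n t :=
      fun s => by ring
    simp only [h, add_sub_cancel_right]
    split_ifs <;> simp
  simp [this]

theorem euler_pathCount_right (hq : EulerPosDef I) (v : I) (n : I → ℤ) :
    euler n (fun w => pathCount w v) = n v := by
  classical
  rw [euler_apply, sum_arr (f := fun s t => n s * pathCount t v), ← Finset.sum_sub_distrib]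
  have : ∀ s, n s * pathCount s v - ∑ t, arrowCount s t * (n s * pathCount t v) =
      if s = v then n s else 0 := fun s => by
    rw [pathCount_eq' hq s v, mul_add, Finset.mul_sum]
    have h : ∀ t, arrowCount s t * (n s * pathCount t v) = n s * (arrowCount s t * pathCount t v) :=
      fun t => by ring
    simp only [h, add_sub_cancel_right]
    split_ifs <;> simp
  simp [this]

theorem eq_zero_of_pathCount_left (hq : EulerPosDef I) (f : (I → ℤ) →ₗ[ℤ] ℤ)
    (h : ∀ v, f (fun w => pathCount v w) = 0) : f = 0 := by
  classical
  refine LinearMap.pi_ext' fun v => LinearMap.ext_ring ?_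
  have hv : (Pi.single v 1 : I → ℤ) =
      (fun w => pathCount v w) - ∑ u, arrowCount v u • fun w => pathCount u w := by
    funext w
    rw [Pi.sub_apply, pathCount_eq' hq v w, Finset.sum_apply]
    simp [Pi.single_apply, eq_comm]
  change f (Pi.single v 1) = 0
  rw [hv, map_sub, h, map_sum, Finset.sum_eq_zero, sub_zero]
  intro u _
  rw [map_smul, h, smul_zero]

theorem eq_zero_of_pathCount_right (hq : EulerPosDef I) (f : (I → ℤ) →ₗ[ℤ] ℤ)
    (h : ∀ v, f (fun w => pathCount w v) = 0) : f = 0 := by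
  classical
  refine LinearMap.pi_ext' fun v => LinearMap.ext_ring ?_
  have hv : (Pi.single v 1 : I → ℤ) =
      (fun w => pathCount w v) - ∑ u, arrowCount u v • fun w => pathCount w u := by
    funext w
    rw [Pi.sub_apply, pathCount_eq hq w v, Finset.sum_apply]
    simp [Pi.single_apply, mul_comm]
  change f (Pi.single v 1) = 0
  rw [hv, map_sub, h, map_sum, Finset.sum_eq_zero, sub_zero]
  intro u _
  rw [map_smul, h, smul_zero]

theorem projRep_finDim (hq : EulerPosDef I) (v : I) : (projRep v).FinDim := fun w => by
  have := finite_path hq v w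
  exact inferInstanceAs (Module.Finite ℂ (Quiver.Path v w →₀ ℂ))

theorem injRep_finDim (hq : EulerPosDef I) (v : I) : (injRep v).FinDim := fun w => by
  have := finite_path hq w v
  exact inferInstanceAs (Module.Finite ℂ (Quiver.Path w v → ℂ))

theorem dv_projRep (hq : EulerPosDef I) (v : I) : (projRep v).dv = fun w => pathCount v w :=
  funext fun w => by
    have := finite_path hq v w
    have := Fintype.ofFinite (Quiver.Path v w)
    change ((Module.finrank ℂ (Quiver.Path v w →₀ ℂ) : ℕ) : ℤ) = _
    rw [Module.finrank_finsupp_self, pathCount, Nat.card_eq_fintype_card]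

theorem dv_injRep (hq : EulerPosDef I) (v : I) : (injRep v).dv = fun w => pathCount w v :=
  funext fun w => by
    have := finite_path hq w v
    have := Fintype.ofFinite (Quiver.Path w v)
    change ((Module.finrank ℂ (Quiver.Path w v → ℂ) : ℕ) : ℤ) = _
    rw [Module.finrank_fintype_fun_eq_card, pathCount, Nat.card_eq_fintype_card]

theorem homDim_projRep (Z : QRep I) (v : I) : (homDim (projRep v) Z : ℤ) = Z.dv v := by
  rw [homDim, (projHomEquiv Z v).finrank_eq]
  rfl

theorem homDim_injRep (X : QRep I) (v : I) : (homDim X (injRep v) : ℤ) = X.dv v := by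
  rw [homDim, (injHomEquiv X v).finrank_eq, Subspace.dual_finrank_eq]
  rfl

theorem extZero_projRep (hq : EulerPosDef I) (v : I) {N : QRep I} (hN : N.FinDim) :
    ExtZero (projRep v) N := by
  rw [← extDim_eq_zero_iff (projRep_finDim hq v) hN]
  have h := homDim_sub_extDim (projRep_finDim hq v) hN
  rw [dv_projRep hq, euler_pathCount_left hq, homDim_projRep] at h
  omega

theorem extZero_injRep (hq : EulerPosDef I) (v : I) {N : QRep I} (hN : N.FinDim) :
    ExtZero N (injRep v) := by
  rw [← extDim_eq_zero_iff hN (injRep_finDim hq v)]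
  have h := homDim_sub_extDim hN (injRep_finDim hq v)
  rw [dv_injRep hq, euler_pathCount_right hq, homDim_injRep] at h
  omega

/-- A representation without extensions by the `P(v)` is projective: every 1-cochain is a sum of
images of 1-cochains with values in some `P(v)`. -/
theorem extZero_of_projRep {C X : QRep I} (hX : X.FinDim) (h : ∀ v, ExtZero C (projRep v)) :
    ExtZero C X := fun ζ => by
  classical
  suffices ζ ∈ LinearMap.range (delta C X) from this
  have h1 : ζ = ∑ a : Arr I, Pi.single a (ζ a) := (Finset.univ_sum_single ζ).symm
  rw [h1]
  refine Submodule.sum_mem _ fun a _ => ?_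
  have := hX a.2.1
  let b := Module.finBasis ℂ (X.V a.2.1)
  have h2 : Pi.single a (ζ a) = ∑ k, (Pi.single a ((b.coord k ∘ₗ ζ a).smulRight (b k)) : C1 C X) := by
    funext c
    rw [Finset.sum_apply]
    by_cases hc : c = a
    · subst hc
      simp only [Pi.single_eq_same]
      refine LinearMap.ext fun x => ?_
      rw [LinearMap.sum_apply]
      exact (b.sum_repr (ζ c x)).symm
    · simp only [Pi.single_eq_of_ne hc, Finset.sum_const_zero]
  rw [h2]
  refine Submodule.sum_mem _ fun k _ => ?_
  obtain ⟨w, hw⟩ := h a.2.1 (Pi.single a ((b.coord k ∘ₗ ζ a).smulRight (projBasis .nil)))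
  refine ⟨fun v => (projHom X (b k)).1 v ∘ₗ w v, funext fun c => LinearMap.ext fun x => ?_⟩
  rw [delta_comp_left, hw]
  by_cases hc : c = a
  · subst hc
    rw [Pi.single_eq_same, Pi.single_eq_same]
    simp only [LinearMap.smulRight_apply, map_smul, projHom_basis, pathMap_nil]
  · rw [Pi.single_eq_of_ne hc, Pi.single_eq_of_ne hc, LinearMap.zero_apply, map_zero,
      LinearMap.zero_apply]

end paths

section translation

variable {I : Type} [Quiver.{0} I] [Fintype I] [∀ s t : I, Fintype (s ⟶ t)]

/-! ### The Auslander-Reiten formulas -/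

/-- Families of linear maps against the arrows: the space dual to `C1 Y M`. -/
abbrev D1 (M Y : QRep I) : Type := ∀ a : Arr I, M.V a.2.1 →ₗ[ℂ] Y.V a.1

/-- The space that both `Hom(τ⁻¹ M, Y)` and `Hom(M, τ Y)` are identified with. It is the annihilator
of the coboundaries in `C1 Y M`, hence dual to `Ext¹(Y, M)`. -/
def Theta (M Y : QRep I) : Submodule ℂ (D1 M Y) where
  carrier := {θ | ∀ (j : I) (m : M.V j), ∑ s : I, ∑ a : (s ⟶ j), Y.map a (θ ⟨s, j, a⟩ m) =
    ∑ t : I, ∑ a : (j ⟶ t), θ ⟨j, t, a⟩ (M.map a m)}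
  add_mem' {θ θ'} h h' j m := by
    simp only [Pi.add_apply, LinearMap.add_apply, map_add, Finset.sum_add_distrib, h j m, h' j m]
  zero_mem' j m := by simp
  smul_mem' c θ h j m := by
    simp only [Pi.smul_apply, LinearMap.smul_apply, map_smul, ← Finset.smul_sum, h j m]

/-- Composition of an element of `Theta` with homomorphisms. -/
def Theta.comp {M' M Y Y' : QRep I} (g : Hom Y Y') (θ : Theta M Y) (f : Hom M' M) :
    Theta M' Y' :=
  ⟨fun a => g.1 a.1 ∘ₗ θ.1 a ∘ₗ f.1 a.2.1, fun j m => by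
    simp only [LinearMap.comp_apply, ← hom_map, ← map_sum]
    rw [θ.2 j (f.1 j m)]
    simp only [hom_map, map_sum]⟩

theorem Theta.comp_apply {M' M Y Y' : QRep I} (g : Hom Y Y') (θ : Theta M Y) (f : Hom M' M)
    (a : Arr I) (m : M'.V a.2.1) :
    (Theta.comp g θ f).1 a m = g.1 a.1 (θ.1 a (f.1 a.2.1 m)) := rfl

/-- The class of `p ⊗ m` in `τ⁻¹ M`. -/
def tauInvMk (M : QRep I) {v : I} (a : Arr I) (p : Quiver.Path a.1 v) :
    M.V a.2.1 →ₗ[ℂ] M.tauInv.V v :=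
  open Classical in
  (tauInvSpan M v).mkQ ∘ₗ
    LinearMap.single ℂ (fun a : Arr I => Quiver.Path a.1 v →₀ M.V a.2.1) a ∘ₗ Finsupp.lsingle p

theorem tauInvMk_apply (M : QRep I) {v : I} (a : Arr I) (p : Quiver.Path a.1 v) (m : M.V a.2.1) :
    tauInvMk M a p m = (tauInvSpan M v).mkQ (tauInvElem M v a p m) := rfl

theorem tauInvMk_map (M : QRep I) {v w : I} (a : Arr I) (p : Quiver.Path a.1 v) (b : v ⟶ w)
    (m : M.V a.2.1) : M.tauInv.map b (tauInvMk M a p m) = tauInvMk M a (p.cons b) m := by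
  rw [tauInvMk_apply, tauInvMk_apply, ← tauInvStep_elem]
  rfl

theorem tauInvMk_pathMap (M : QRep I) {v : I} (a : Arr I) (p : Quiver.Path a.1 v) (m : M.V a.2.1) :
    pathMap M.tauInv p (tauInvMk M a .nil m) = tauInvMk M a p m := by
  induction p with
  | nil => rfl
  | cons p b ih => rw [pathMap_cons, ih, tauInvMk_map]

theorem tauInvMk_rel (M : QRep I) {v j : I} (p : Quiver.Path j v) (m : M.V j) :
    ∑ s : I, ∑ a : (s ⟶ j), tauInvMk M ⟨s, j, a⟩ (a.toPath.comp p) m =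
      ∑ t : I, ∑ a : (j ⟶ t), tauInvMk M ⟨j, t, a⟩ p (M.map a m) := by
  have h : (tauInvSpan M v).mkQ (tauInvRel M v j p m) = 0 :=
    (Submodule.Quotient.mk_eq_zero _).2 (Submodule.subset_span ⟨j, p, m, rfl⟩)
  rw [tauInvRel, map_sub, map_sum, map_sum] at h
  simp only [map_sum] at h
  exact sub_eq_zero.1 h

/-- The universal element of `Theta M (τ⁻¹ M)`. -/
def tauInvUniv (M : QRep I) : Theta M M.tauInv :=
  ⟨fun a => tauInvMk M a .nil, fun j m => by
    refine Eq.trans (Finset.sum_congr rfl fun s _ => Finset.sum_congr rfl fun a _ => ?_)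
      (tauInvMk_rel M .nil m)
    exact tauInvMk_map M ⟨s, j, a⟩ .nil a m⟩

theorem tauInv_linearMap_ext {M : QRep I} {v : I} {E : Type} [AddCommGroup E] [Module ℂ E]
    {f g : M.tauInv.V v →ₗ[ℂ] E}
    (h : ∀ a p m, f (tauInvMk M a p m) = g (tauInvMk M a p m)) : f = g := by
  classical
  refine Submodule.linearMap_qext _ (LinearMap.pi_ext' fun a => Finsupp.lhom_ext' fun p =>
    LinearMap.ext fun m => ?_)
  have := h a p m
  simp only [tauInvMk] at this
  convert this using 1 <;>
  · simp only [LinearMap.comp_apply]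
    congr!

theorem tauInv_hom_ext {M Y : QRep I} {f g : Hom M.tauInv Y}
    (h : ∀ a m, f.1 _ ((tauInvUniv M).1 a m) = g.1 _ ((tauInvUniv M).1 a m)) : f = g :=
  Subtype.ext <| funext fun v => tauInv_linearMap_ext fun a p m => by
    rw [← tauInvMk_pathMap, hom_pathMap, hom_pathMap]
    exact congrArg _ (h a m)

/-- The linear map on `⨁_{a : s → t} P(s) ⊗ M_t` given by a family of linear maps. -/
def tauInvLin {M Y : QRep I} (θ : D1 M Y) (v : I) :
    (∀ a : Arr I, Quiver.Path a.1 v →₀ M.V a.2.1) →ₗ[ℂ] Y.V v :=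
  ∑ a : Arr I, Finsupp.lsum ℂ (fun p : Quiver.Path a.1 v => pathMap Y p ∘ₗ θ a) ∘ₗ LinearMap.proj a

theorem tauInvLin_elem {M Y : QRep I} (θ : D1 M Y) {v : I} (a : Arr I) (p : Quiver.Path a.1 v)
    (m : M.V a.2.1) : tauInvLin θ v (tauInvElem M v a p m) = pathMap Y p (θ a m) := by
  classical
  rw [tauInvLin, LinearMap.sum_apply, Finset.sum_eq_single a]
  · simp [tauInvElem]
  · intro c _ hc
    simp [tauInvElem, hc]
  · simp

theorem pathMap_toPath_comp (M : QRep I) {v w u : I} (a : v ⟶ w) (p : Quiver.Path w u)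
    (x : M.V v) : pathMap M (a.toPath.comp p) x = pathMap M p (M.map a x) :=
  pathMap_comp M a.toPath p x

theorem tauInvSpan_le_ker {M Y : QRep I} (θ : Theta M Y) (v : I) :
    tauInvSpan M v ≤ LinearMap.ker (tauInvLin θ.1 v) := by
  refine Submodule.span_le.2 ?_
  rintro _ ⟨j, p, m, rfl⟩
  rw [SetLike.mem_coe, LinearMap.mem_ker, tauInvRel, map_sub]
  simp only [map_sum, tauInvLin_elem, pathMap_toPath_comp]
  simp only [← map_sum]
  rw [θ.2 j m]
  simp only [map_sum, sub_self]

/-- The linear map on `τ⁻¹ M` at a vertex given by an element of `Theta M Y`. -/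
def tauInvDescLin {M Y : QRep I} (θ : Theta M Y) (v : I) : M.tauInv.V v →ₗ[ℂ] Y.V v :=
  (tauInvSpan M v).liftQ (tauInvLin θ.1 v) (tauInvSpan_le_ker θ v)

theorem tauInvDescLin_mk {M Y : QRep I} (θ : Theta M Y) {v : I} (a : Arr I)
    (p : Quiver.Path a.1 v) (m : M.V a.2.1) :
    tauInvDescLin θ v (tauInvMk M a p m) = pathMap Y p (θ.1 a m) := tauInvLin_elem θ.1 a p m

/-- The homomorphism `τ⁻¹ M → Y` given by an element of `Theta M Y`. -/
def tauInvDesc {M Y : QRep I} (θ : Theta M Y) : Hom M.tauInv Y :=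
  ⟨tauInvDescLin θ, fun s t b => tauInv_linearMap_ext fun a p m => by
    rw [LinearMap.comp_apply, LinearMap.comp_apply, tauInvMk_map, tauInvDescLin_mk,
      tauInvDescLin_mk, pathMap_cons]⟩

@[simp] theorem tauInvDesc_univ {M Y : QRep I} (θ : Theta M Y) (a : Arr I) (m : M.V a.2.1) :
    (tauInvDesc θ).1 a.1 ((tauInvUniv M).1 a m) = θ.1 a m :=
  tauInvDescLin_mk θ a .nil m

/-- Homomorphisms out of `τ⁻¹ M`. -/
def tauInvHomEquiv (M Y : QRep I) : Hom M.tauInv Y ≃ₗ[ℂ] Theta M Y where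
  toFun f := Theta.comp f (tauInvUniv M) (idHom M)
  map_add' _ _ := rfl
  map_smul' _ _ := rfl
  invFun := tauInvDesc
  left_inv f := tauInv_hom_ext fun a m => by
    rw [tauInvDesc_univ, Theta.comp_apply, idHom_apply]
  right_inv θ := Subtype.ext <| funext fun a => LinearMap.ext fun m => tauInvDesc_univ θ a m

theorem tau_pathMap (Y : QRep I) {v w : I} (q : Quiver.Path v w) (x : Y.tau.V v) (a : Arr I)
    (r : Quiver.Path w a.2.1) : (pathMap Y.tau q x).1 a r = x.1 a (q.comp r) := by
  induction q with
  | nil => exact congrArg (x.1 a) (Quiver.Path.nil_comp r).symm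
  | cons q b ih =>
    change (pathMap Y.tau q x).1 a (b.toPath.comp r) = _
    rw [ih, ← Quiver.Path.comp_assoc]
    rfl

/-- The universal element of `Theta (τ Y) Y`. -/
def tauUniv (Y : QRep I) : Theta Y.tau Y :=
  ⟨fun a => { toFun x := x.1 a .nil, map_add' _ _ := rfl, map_smul' _ _ := rfl },
    fun j x => (x.2 j .nil).symm⟩

theorem tauUniv_apply (Y : QRep I) (a : Arr I) (x : Y.tau.V a.2.1) :
    (tauUniv Y).1 a x = x.1 a .nil := rfl

theorem tau_ext {Y : QRep I} {v : I} {x y : Y.tau.V v}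
    (h : ∀ a (q : Quiver.Path v a.2.1), (tauUniv Y).1 a (pathMap Y.tau q x) =
      (tauUniv Y).1 a (pathMap Y.tau q y)) : x = y :=
  Subtype.ext <| funext fun a => funext fun q => by
    have := h a q
    rwa [tauUniv_apply, tauUniv_apply, tau_pathMap, tau_pathMap, Quiver.Path.comp_nil] at this

/-- The homomorphism `M → τ Y` given by an element of `Theta M Y`. -/
def tauLift {M Y : QRep I} (θ : Theta M Y) : Hom M Y.tau :=
  mkHom (fun v =>
    { toFun m := ⟨fun a q => θ.1 a (pathMap M q m), fun j p => (θ.2 j (pathMap M p m)).symm⟩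
      map_add' m n := Subtype.ext <| funext fun a => funext fun q => by
        simp only [map_add]
        rfl
      map_smul' c m := Subtype.ext <| funext fun a => funext fun q => by
        simp only [map_smul]
        rfl })
    fun s t b m => Subtype.ext <| funext fun a => funext fun q =>
      congrArg (θ.1 a) (pathMap_comp M b.toPath q m).symm

@[simp] theorem tauUniv_lift {M Y : QRep I} (θ : Theta M Y) (a : Arr I) (m : M.V a.2.1) :
    (tauUniv Y).1 a ((tauLift θ).1 _ m) = θ.1 a m := rfl

/-- Homomorphisms into `τ Y`. -/
def tauHomEquiv (M Y : QRep I) : Hom M Y.tau ≃ₗ[ℂ] Theta M Y where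
  toFun f := Theta.comp (idHom Y) (tauUniv Y) f
  map_add' f g := Subtype.ext <| funext fun a => LinearMap.ext fun m =>
    map_add ((tauUniv Y).1 a) (f.1 _ m) (g.1 _ m)
  map_smul' c f := Subtype.ext <| funext fun a => LinearMap.ext fun m =>
    map_smul ((tauUniv Y).1 a) c (f.1 _ m)
  invFun := tauLift
  left_inv f := hom_ext fun v m => tau_ext fun a q => by
    rw [← hom_pathMap, ← hom_pathMap, tauUniv_lift, Theta.comp_apply, idHom_apply]
  right_inv θ := Subtype.ext <| funext fun a => LinearMap.ext fun m => tauUniv_lift θ a m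

/-- The trace pairing of `C1 Y M` and `D1 M Y`. -/
def tracePairing (M Y : QRep I) : D1 M Y →ₗ[ℂ] Module.Dual ℂ (C1 Y M) :=
  LinearMap.mk₂ ℂ (fun θ ζ => ∑ a, LinearMap.trace ℂ _ (θ a ∘ₗ ζ a))
    (fun θ θ' ζ => by simp only [Pi.add_apply, LinearMap.add_comp, map_add, Finset.sum_add_distrib])
    (fun c θ ζ => by simp only [Pi.smul_apply, LinearMap.smul_comp, map_smul, ← Finset.smul_sum])
    (fun θ ζ ζ' => by simp only [Pi.add_apply, LinearMap.comp_add, map_add, Finset.sum_add_distrib])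
    (fun c θ ζ => by simp only [Pi.smul_apply, LinearMap.comp_smul, map_smul, ← Finset.smul_sum])

theorem tracePairing_apply {M Y : QRep I} (θ : D1 M Y) (ζ : C1 Y M) :
    tracePairing M Y θ ζ = ∑ a, LinearMap.trace ℂ _ (θ a ∘ₗ ζ a) := rfl

theorem eq_zero_of_trace {U V : Type} [AddCommGroup U] [Module ℂ U] [AddCommGroup V] [Module ℂ V]
    [Module.Finite ℂ U] [Module.Finite ℂ V] (f : U →ₗ[ℂ] V)
    (h : ∀ g : V →ₗ[ℂ] U, LinearMap.trace ℂ V (f ∘ₗ g) = 0) : f = 0 := by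
  refine LinearMap.ext fun u => (Module.forall_dual_apply_eq_zero_iff ℂ (f u)).1 fun l => ?_
  rw [← LinearMap.trace_smulRight, ← h (l.smulRight u)]
  exact congrArg _ (LinearMap.ext fun v => (map_smul f _ _).symm)

theorem tracePairing_injective {M Y : QRep I} (hM : M.FinDim) (hY : Y.FinDim) :
    Function.Injective (tracePairing M Y) := by
  classical
  have := fun v => hM v
  have := fun v => hY v
  rw [injective_iff_map_eq_zero]
  intro θ h
  funext a
  refine eq_zero_of_trace _ fun g => ?_
  have h1 := LinearMap.congr_fun h (Pi.single a g)
  rw [tracePairing_apply, Finset.sum_eq_single a] at h1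
  · rwa [Pi.single_eq_same] at h1
  · intro c _ hc
    rw [Pi.single_eq_of_ne hc, LinearMap.comp_zero, map_zero]
  · simp

theorem tracePairing_bijective {M Y : QRep I} (hM : M.FinDim) (hY : Y.FinDim) :
    Function.Bijective (tracePairing M Y) := by
  have := fun v => hM v
  have := fun v => hY v
  refine ⟨tracePairing_injective hM hY, ?_⟩
  refine (LinearMap.injective_iff_surjective_of_finrank_eq_finrank ?_).1
    (tracePairing_injective hM hY)
  rw [Subspace.dual_finrank_eq, Module.finrank_pi_fintype, Module.finrank_pi_fintype]
  exact Finset.sum_congr rfl fun a _ => by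
    rw [Module.finrank_linearMap, Module.finrank_linearMap, mul_comm]

theorem tracePairing_delta {M Y : QRep I} (hM : M.FinDim) (hY : Y.FinDim) (θ : D1 M Y)
    (f : C0 Y M) : tracePairing M Y θ (delta Y M f) = ∑ j, LinearMap.trace ℂ (Y.V j)
      ((∑ s, ∑ a : (s ⟶ j), Y.map a ∘ₗ θ ⟨s, j, a⟩ -
        ∑ t, ∑ a : (j ⟶ t), θ ⟨j, t, a⟩ ∘ₗ M.map a) ∘ₗ f j) := by
  have := fun v => hM v
  have := fun v => hY v
  have h1 : ∀ (s t : I) (a : s ⟶ t), LinearMap.trace ℂ (Y.V s)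
      (θ ⟨s, t, a⟩ ∘ₗ delta Y M f ⟨s, t, a⟩) =
        LinearMap.trace ℂ (Y.V t) ((Y.map a ∘ₗ θ ⟨s, t, a⟩) ∘ₗ f t) -
          LinearMap.trace ℂ (Y.V s) ((θ ⟨s, t, a⟩ ∘ₗ M.map a) ∘ₗ f s) := fun s t a => by
    change LinearMap.trace ℂ (Y.V s)
      (θ ⟨s, t, a⟩ ∘ₗ (f t ∘ₗ Y.map a - M.map a ∘ₗ f s)) = _
    rw [LinearMap.comp_sub, map_sub, ← LinearMap.comp_assoc, ← LinearMap.comp_assoc,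
      LinearMap.trace_comp_comm', ← LinearMap.comp_assoc]
  rw [tracePairing_apply, Fintype.sum_sigma]
  simp only [Fintype.sum_sigma, h1, Finset.sum_sub_distrib, LinearMap.sub_comp, map_sub]
  rw [Finset.sum_comm]
  have h2 : ∀ j (g : M.V j →ₗ[ℂ] Y.V j), LinearMap.trace ℂ (Y.V j) (g ∘ₗ f j) =
      (LinearMap.trace ℂ (Y.V j) ∘ₗ LinearMap.lcomp ℂ (Y.V j) (f j)) g := fun _ _ => rfl
  simp only [h2, map_sum]

theorem mem_theta_iff {M Y : QRep I} (hM : M.FinDim) (hY : Y.FinDim) (θ : D1 M Y) :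
    θ ∈ Theta M Y ↔ tracePairing M Y θ ∈ (LinearMap.range (delta Y M)).dualAnnihilator := by
  classical
  have := fun v => hM v
  have := fun v => hY v
  rw [Submodule.mem_dualAnnihilator]
  constructor
  · rintro h _ ⟨f, rfl⟩
    rw [tracePairing_delta hM hY]
    refine Finset.sum_eq_zero fun j _ => ?_
    rw [sub_eq_zero.2, LinearMap.zero_comp, map_zero]
    refine LinearMap.ext fun m => ?_
    simpa only [LinearMap.sum_apply, LinearMap.comp_apply] using h j m
  · intro h j m
    have h1 := eq_zero_of_trace (∑ s, ∑ a : (s ⟶ j), Y.map a ∘ₗ θ ⟨s, j, a⟩ -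
        ∑ t, ∑ a : (j ⟶ t), θ ⟨j, t, a⟩ ∘ₗ M.map a) fun g => by
      have h2 := h _ ⟨Pi.single j g, rfl⟩
      rw [tracePairing_delta hM hY, Finset.sum_eq_single j] at h2
      · rwa [Pi.single_eq_same] at h2
      · intro c _ hc
        rw [Pi.single_eq_of_ne hc, LinearMap.comp_zero, map_zero]
      · simp
    have h2 := LinearMap.congr_fun (sub_eq_zero.1 h1) m
    simpa only [LinearMap.sum_apply, LinearMap.comp_apply] using h2

/-- `Theta M Y` is dual to `Ext¹(Y, M)`. -/
theorem finrank_theta {M Y : QRep I} (hM : M.FinDim) (hY : Y.FinDim) :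
    Module.finrank ℂ (Theta M Y) = extDim Y M := by
  have := c1_finite hY hM
  let e := LinearEquiv.ofBijective _ (tracePairing_bijective hM hY)
  have h : Theta M Y = (LinearMap.range (delta Y M)).dualAnnihilator.comap e.toLinearMap :=
    Submodule.ext fun θ => mem_theta_iff hM hY θ
  rw [h, Submodule.comap_equiv_eq_map_symm, LinearEquiv.finrank_map_eq, extDim,
    (Subspace.quotEquivAnnihilator _).finrank_eq]

/-- A cocycle that pairs to zero with `Theta M Y` is a coboundary. -/
theorem mem_range_delta_of_pairing {M Y : QRep I} (hM : M.FinDim) (hY : Y.FinDim) (ζ : C1 Y M)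
    (h : ∀ θ : Theta M Y, tracePairing M Y θ.1 ζ = 0) : ζ ∈ LinearMap.range (delta Y M) := by
  rw [← Subspace.forall_mem_dualAnnihilator_apply_eq_zero_iff]
  intro φ hφ
  obtain ⟨θ, rfl⟩ := (tracePairing_bijective hM hY).2 φ
  exact h ⟨θ, (mem_theta_iff hM hY θ).2 hφ⟩

theorem homDim_tauInv {M Y : QRep I} (hM : M.FinDim) (hY : Y.FinDim) :
    homDim M.tauInv Y = extDim Y M := by
  rw [homDim, (tauInvHomEquiv M Y).finrank_eq, finrank_theta hM hY]

theorem homDim_tau {M Y : QRep I} (hM : M.FinDim) (hY : Y.FinDim) :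
    homDim M Y.tau = extDim Y M := by
  rw [homDim, (tauHomEquiv M Y).finrank_eq, finrank_theta hM hY]

theorem tau_finDim (hq : EulerPosDef I) {Y : QRep I} (hY : Y.FinDim) : Y.tau.FinDim := fun v => by
  have := fun v => hY v
  have := fun w => finite_path hq v w
  exact Module.Finite.of_injective
    ({ toFun x := x.1, map_add' _ _ := rfl, map_smul' _ _ := rfl } :
      Y.tau.V v →ₗ[ℂ] ∀ a : Arr I, Quiver.Path v a.2.1 → Y.V a.1) Subtype.val_injective

theorem tauInv_finDim (hq : EulerPosDef I) {M : QRep I} (hM : M.FinDim) :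
    M.tauInv.FinDim := fun v => by
  have := fun v => hM v
  have := fun w => finite_path hq w v
  have : ∀ a : Arr I, Module.Finite ℂ (Quiver.Path a.1 v →₀ M.V a.2.1) := fun a => inferInstance
  exact inferInstanceAs (Module.Finite ℂ
    ((∀ a : Arr I, Quiver.Path a.1 v →₀ M.V a.2.1) ⧸ tauInvSpan M v))

end translation

section projective

variable {I : Type} [Quiver.{0} I]

/-! ### The translations of indecomposable representations -/

/-- A nonzero homomorphism from an indecomposable to a projective representation is injective: its
image is projective. -/
theorem Indecomposable.injective_of_extZero {Y Q : QRep I} (hY : Y.Indecomposable) (hYf : Y.FinDim)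
    (hQ : ∀ N : QRep I, N.FinDim → ExtZero Q N) (f : Hom Y Q) (hf : f ≠ 0) (v : I) :
    Function.Injective (f.1 v) := by
  obtain ⟨s, hs⟩ := exists_lift (toIm f) (toIm_surjective f)
    ((hQ _ (subrep_finDim hYf)).of_injective _ subIncl_injective) (idHom (im f))
  have h := hY.section_of_retract (im_not_isZero hf) s (toIm f) hs
  intro x y hxy
  rw [← h v x, ← h v y]
  exact congrArg (s.1 v) (Subtype.ext hxy)

/-- An indecomposable with a nonzero homomorphism to a projective representation is projective. -/
theorem Indecomposable.extZero_left {Y Q : QRep I} (hY : Y.Indecomposable) (hYf : Y.FinDim)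
    (hQ : ∀ N : QRep I, N.FinDim → ExtZero Q N) (f : Hom Y Q) (hf : f ≠ 0) {N : QRep I}
    (hN : N.FinDim) : ExtZero Y N :=
  (hQ N hN).of_injective f (hY.injective_of_extZero hYf hQ f hf)

/-- An indecomposable with a nonzero homomorphism from an injective representation is injective. -/
theorem Indecomposable.extZero_right {M Q : QRep I} (hM : M.Indecomposable) (hMf : M.FinDim)
    (hQ : ∀ N : QRep I, N.FinDim → ExtZero N Q) (f : Hom Q M) (hf : f ≠ 0) {N : QRep I}
    (hN : N.FinDim) : ExtZero N M := by
  have him : ∀ N : QRep I, N.FinDim → ExtZero N (im f) := fun N hN =>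
    (hQ N hN).of_surjective _ (toIm_surjective f)
  obtain ⟨r, hr⟩ := exists_extension (range_stable f) (quotMk (range_stable f))
    (fun v x => by rw [← LinearMap.mem_ker, ker_quotMk]) (him _ (quotRep_finDim hMf))
    (idHom (im f))
  have h := hM.section_of_retract (im_not_isZero hf) (subIncl (range_stable f)) r hr
  exact (him N hN).of_surjective (subIncl (range_stable f)) fun v x => ⟨r.1 v x, h v x⟩

variable [Fintype I] [∀ s t : I, Fintype (s ⟶ t)]

theorem homDim_congr_left {X X' : QRep I} (e : Iso X X') (Y : QRep I) :
    homDim X Y = homDim X' Y :=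
  LinearEquiv.finrank_eq
    { compRight (N := Y) e.symm.hom with
      invFun := compRight (N := Y) e.hom
      left_inv := fun f => hom_ext fun v x => congrArg (f.1 v) (e.symm_hom_apply v x)
      right_inv := fun f => hom_ext fun v x => congrArg (f.1 v) (e.hom_symm_apply v x) }

theorem isZero_of_homDim {X : QRep I} (hX : X.FinDim) (h : homDim X X = 0) : X.IsZero :=
  isZero_iff_idHom.2 ((homDim_eq_zero_iff hX hX).1 h _)

theorem homDim_self_pos {X : QRep I} (hX : X.FinDim) (h : ¬ X.IsZero) : 0 < homDim X X :=
  Nat.pos_of_ne_zero fun h0 => h (isZero_of_homDim hX h0)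

/-- A representation with one-dimensional endomorphism ring is indecomposable. -/
theorem indecomposable_of_homDim {X : QRep I} (hX : X.FinDim) (h : homDim X X = 1) :
    X.Indecomposable := by
  refine ⟨fun h0 => ?_, fun A B ⟨e⟩ => ?_⟩
  · rw [(homDim_eq_zero_iff hX hX).2 fun f => hom_eq_zero_of_isZero_left h0 f] at h
    omega
  · let D := prodDecomp e
    have hA : A.FinDim := D.finDim hX true
    have hB : B.FinDim := D.finDim hX false
    rw [D.homDim_right hX hX, Fintype.sum_bool, D.homDim_left hX (D.finDim hX true),
      D.homDim_left hX (D.finDim hX false), Fintype.sum_bool, Fintype.sum_bool] at h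
    by_contra! h'
    have h1 : 0 < homDim A A := homDim_self_pos hA h'.1
    have h2 : 0 < homDim B B := homDim_self_pos hB h'.2
    simp only [cond_true, cond_false] at h
    omega

theorem extZero_of_tau_isZero (hq : EulerPosDef I) {Y N : QRep I} (hY : Y.FinDim) (hN : N.FinDim)
    (h : Y.tau.IsZero) : ExtZero Y N := by
  rw [← extDim_eq_zero_iff hY hN, ← homDim_tau hN hY,
    homDim_eq_zero_iff hN (tau_finDim hq hY)]
  exact fun f => hom_eq_zero_of_isZero_right h f

theorem tau_isZero (hq : EulerPosDef I) {Y : QRep I} (hY : Y.FinDim)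
    (h : ∀ N : QRep I, N.FinDim → ExtZero Y N) : Y.tau.IsZero := by
  have ht := tau_finDim hq hY
  refine isZero_of_homDim ht ?_
  rw [homDim_tau ht hY, extDim_eq_zero_iff hY ht]
  exact h _ ht

theorem tauInv_isZero (hq : EulerPosDef I) {M : QRep I} (hM : M.FinDim)
    (h : ∀ N : QRep I, N.FinDim → ExtZero N M) : M.tauInv.IsZero := by
  have ht := tauInv_finDim hq hM
  refine isZero_of_homDim ht ?_
  rw [homDim_tauInv hM ht, extDim_eq_zero_iff ht hM]
  exact h _ ht

theorem homDim_projRep_eq_zero (hq : EulerPosDef I) {Y : QRep I} (hY : Y.Indecomposable)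
    (hYf : Y.FinDim) (h : ¬ Y.tau.IsZero) (v : I) : homDim Y (projRep v) = 0 := by
  rw [homDim_eq_zero_iff hYf (projRep_finDim hq v)]
  by_contra! h'
  obtain ⟨f, hf⟩ := h'
  exact h (tau_isZero hq hYf fun N hN =>
    hY.extZero_left hYf (fun N hN => extZero_projRep hq v hN) f hf hN)

theorem homDim_injRep_eq_zero (hq : EulerPosDef I) {M : QRep I} (hM : M.Indecomposable)
    (hMf : M.FinDim) (h : ¬ M.tauInv.IsZero) (v : I) : homDim (injRep v) M = 0 := by
  rw [homDim_eq_zero_iff (injRep_finDim hq v) hMf]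
  by_contra! h'
  obtain ⟨f, hf⟩ := h'
  exact h (tauInv_isZero hq hMf fun N hN =>
    hM.extZero_right hMf (fun N hN => extZero_injRep hq v hN) f hf hN)

/-- On indecomposables without projective summands, `τ` acts on dimension vectors by the Coxeter
transformation. -/
theorem euler_tau (hq : EulerPosDef I) {Y : QRep I} (hY : Y.Indecomposable) (hYf : Y.FinDim)
    (h : ¬ Y.tau.IsZero) (z : I → ℤ) : euler z Y.tau.dv = -euler Y.dv z := by
  have h1 : euler.flip Y.tau.dv + euler Y.dv = 0 := eq_zero_of_pathCount_left hq _ fun v => by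
    have hp := projRep_finDim hq v
    have ht := tau_finDim hq hYf
    have h1 := homDim_sub_extDim hp ht
    have h2 := homDim_sub_extDim hYf hp
    rw [(extDim_eq_zero_iff hp ht).2 (extZero_projRep hq v ht), homDim_tau hp hYf] at h1
    rw [homDim_projRep_eq_zero hq hY hYf h] at h2
    rw [dv_projRep hq] at h1 h2
    rw [LinearMap.add_apply, LinearMap.flip_apply, ← h1, ← h2]
    simp
  have h2 := LinearMap.congr_fun h1 z
  rw [LinearMap.add_apply, LinearMap.flip_apply, LinearMap.zero_apply] at h2
  linarith

theorem euler_tauInv (hq : EulerPosDef I) {M : QRep I} (hM : M.Indecomposable) (hMf : M.FinDim)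
    (h : ¬ M.tauInv.IsZero) (z : I → ℤ) : euler M.tauInv.dv z = -euler z M.dv := by
  have h1 : euler M.tauInv.dv + euler.flip M.dv = 0 := eq_zero_of_pathCount_right hq _ fun v => by
    have hp := injRep_finDim hq v
    have ht := tauInv_finDim hq hMf
    have h1 := homDim_sub_extDim ht hp
    have h2 := homDim_sub_extDim hp hMf
    rw [(extDim_eq_zero_iff ht hp).2 (extZero_injRep hq v ht), homDim_tauInv hMf hp] at h1
    rw [homDim_injRep_eq_zero hq hM hMf h] at h2
    rw [dv_injRep hq] at h1 h2
    rw [LinearMap.add_apply, LinearMap.flip_apply, ← h1, ← h2]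
    simp
  have h2 := LinearMap.congr_fun h1 z
  rw [LinearMap.add_apply, LinearMap.flip_apply, LinearMap.zero_apply] at h2
  linarith

/-- The counit `τ⁻¹ τ Y → Y` of the adjunction between `τ⁻¹` and `τ`. -/
def counit (Y : QRep I) : Hom Y.tau.tauInv Y := tauInvDesc (tauUniv Y)

theorem counit_univ (Y : QRep I) (a : Arr I) (x : Y.tau.V a.2.1) :
    (counit Y).1 a.1 ((tauInvUniv Y.tau).1 a x) = (tauUniv Y).1 a x :=
  tauInvDesc_univ _ a x

/-- The elements of `Theta X Y` have values in the image of the counit. -/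
theorem theta_mem_range_counit {X Y : QRep I} (θ : Theta X Y) (a : Arr I) (x : X.V a.2.1) :
    θ.1 a x ∈ LinearMap.range ((counit Y).1 a.1) := by
  rw [← tauUniv_lift θ, ← counit_univ]
  exact ⟨_, rfl⟩

/-- If `τ Y ≠ 0`, then the cokernel of the counit is projective, and hence zero. -/
theorem counit_surjective (hq : EulerPosDef I) {Y : QRep I} (hY : Y.Indecomposable)
    (hYf : Y.FinDim) (h : ¬ Y.tau.IsZero) (v : I) : Function.Surjective ((counit Y).1 v) := by
  have ht := tau_finDim hq hYf
  have htt := tauInv_finDim hq ht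
  let C := quotRep (range_stable (counit Y))
  let π : Hom Y C := quotMk (range_stable (counit Y))
  have hCf : C.FinDim := quotRep_finDim hYf
  have hπ : ∀ v, Function.Surjective (π.1 v) := quotMk_surjective
  have hπ0 : ∀ v x, π.1 v x = 0 ↔ x ∈ LinearMap.range ((counit Y).1 v) := fun v x => by
    rw [← LinearMap.mem_ker, ker_quotMk]
  have hC : ∀ v, ExtZero C (projRep v) := fun j ζ => by
    have hp := projRep_finDim hq j
    obtain ⟨w, hw⟩ := mem_range_delta_of_pairing hp hYf (fun a => ζ a ∘ₗ π.1 a.1) fun θ => by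
      have := fun v => hp v
      have := fun v => hYf v
      rw [tracePairing_apply]
      refine Finset.sum_eq_zero fun a _ => ?_
      rw [LinearMap.trace_comp_comm', LinearMap.comp_assoc,
        show π.1 a.1 ∘ₗ θ.1 a = 0 from LinearMap.ext fun x =>
          (hπ0 _ _).2 (theta_mem_range_counit θ a x), LinearMap.comp_zero, map_zero]
    have hw0 : ∀ v x, w v ((counit Y).1 v x) = 0 := by
      have h0 : delta _ _ (fun v => w v ∘ₗ (counit Y).1 v) = 0 := funext fun a =>
        LinearMap.ext fun x => by
          rw [delta_comp_right, hw, LinearMap.comp_apply, (hπ0 _ _).2 ⟨x, rfl⟩, map_zero]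
          rfl
      have h1 : homDim Y.tau.tauInv (projRep j) = 0 := by
        rw [homDim_tauInv ht hp, extDim_eq_zero_iff hp ht]
        exact extZero_projRep hq j ht
      have h2 := (homDim_eq_zero_iff htt hp).1 h1 (homOfDelta _ h0)
      exact fun v x => congrArg (fun f : Hom Y.tau.tauInv (projRep j) => f.1 v x) h2
    choose w' hw' using fun v => exists_factor (π.1 v) (w v) fun x hx => by
      obtain ⟨y, rfl⟩ := (hπ0 _ _).1 hx
      exact hw0 v y
    refine ⟨w', funext fun a => LinearMap.ext fun x => ?_⟩
    obtain ⟨y, rfl⟩ := hπ _ x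
    rw [← delta_comp_right, ← LinearMap.comp_apply, ← congrFun hw a]
    rw [show (fun v => w' v ∘ₗ π.1 v) = w from funext fun v => LinearMap.ext (hw' v)]
  have h0 : π = 0 := by
    by_contra h0
    exact h (tau_isZero hq hYf fun N hN =>
      hY.extZero_left hYf (fun N hN => extZero_of_projRep hN hC) π h0 hN)
  intro y
  exact (hπ0 v y).1 (by rw [h0]; rfl)

theorem dv_tauInv_tau (hq : EulerPosDef I) {Y : QRep I} (hY : Y.Indecomposable)
    (hYf : Y.FinDim) (h : ¬ Y.tau.IsZero) : Y.tau.tauInv.dv = Y.dv := funext fun v => by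
  have ht := tau_finDim hq hYf
  have hi := injRep_finDim hq v
  have h0 := extZero_injRep hq v hYf
  rw [← homDim_injRep, homDim_tauInv ht hi]
  have h1 := homDim_sub_extDim hi ht
  rw [homDim_tau hi hYf, (extDim_eq_zero_iff hYf hi).2 h0, euler_tau hq hY hYf h, dv_injRep hq,
    euler_pathCount_right hq] at h1
  push_cast at h1
  linarith

theorem exists_iso_tauInv_tau (hq : EulerPosDef I) {Y : QRep I} (hY : Y.Indecomposable)
    (hYf : Y.FinDim) (h : ¬ Y.tau.IsZero) : Nonempty (Iso Y.tau.tauInv Y) :=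
  ⟨isoOfBijective (counit Y) (bijective_of_surjective (tauInv_finDim hq (tau_finDim hq hYf)) hYf _
    (counit_surjective hq hY hYf h) (tdim_eq_of_dv_eq (dv_tauInv_tau hq hY hYf h)).le)⟩

theorem homDim_tau_tau (hq : EulerPosDef I) {X : QRep I} (hX : X.Indecomposable)
    (hXf : X.FinDim) (h : ¬ X.tau.IsZero) (Y : QRep I) : homDim X.tau Y.tau = homDim X Y := by
  obtain ⟨e⟩ := exists_iso_tauInv_tau hq hX hXf h
  rw [← homDim_congr_left e, homDim, homDim, (tauHomEquiv _ _).finrank_eq,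
    (tauInvHomEquiv _ _).finrank_eq]

theorem Indecomposable.tau (hq : EulerPosDef I) {X : QRep I} (hX : X.Indecomposable)
    (hXf : X.FinDim) (h : ¬ X.tau.IsZero) : X.tau.Indecomposable :=
  indecomposable_of_homDim (tau_finDim hq hXf)
    ((homDim_tau_tau hq hX hXf h X).trans (hX.homDim_self hq hXf))

/-- `τ⁻¹` on homomorphisms. -/
def tauInvMap {M M' : QRep I} (f : Hom M M') : Hom M.tauInv M'.tauInv :=
  tauInvDesc (Theta.comp (idHom _) (tauInvUniv M') f)

theorem tauInvMap_univ {M M' : QRep I} (f : Hom M M') (a : Arr I) (m : M.V a.2.1) :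
    (tauInvMap f).1 a.1 ((tauInvUniv M).1 a m) = (tauInvUniv M').1 a (f.1 a.2.1 m) :=
  tauInvDesc_univ _ a m

theorem tauInvMap_comp {M M' M'' : QRep I} (g : Hom M' M'') (f : Hom M M') :
    tauInvMap (comp g f) = comp (tauInvMap g) (tauInvMap f) :=
  tauInv_hom_ext fun a m => by
    rw [tauInvMap_univ, comp_apply, comp_apply, tauInvMap_univ, tauInvMap_univ]

theorem tauInvMap_id (M : QRep I) : tauInvMap (idHom M) = idHom M.tauInv :=
  tauInv_hom_ext fun a m => by
    rw [tauInvMap_univ]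
    rfl

theorem tauInvMap_zero (M M' : QRep I) : tauInvMap (0 : Hom M M') = 0 :=
  tauInv_hom_ext fun a m => by
    rw [tauInvMap_univ, hom_zero_apply, map_zero, hom_zero_apply]

theorem tauInvMap_sum {M M' : QRep I} {J : Type} [Fintype J] (f : J → Hom M M') :
    tauInvMap (∑ j, f j) = ∑ j, tauInvMap (f j) :=
  tauInv_hom_ext fun a m => by
    simp only [tauInvMap_univ, hom_sum_apply, map_sum]

/-- Isomorphic representations have isomorphic translates. -/
def Iso.tauInv {M M' : QRep I} (e : Iso M M') : Iso M.tauInv M'.tauInv :=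
  have h : ∀ {M M' : QRep I} (e : Iso M M') v x,
      (tauInvMap e.symm.hom).1 v ((tauInvMap e.hom).1 v x) = x := fun {M M'} e v x => by
    rw [← comp_apply, ← tauInvMap_comp,
      show comp e.symm.hom e.hom = idHom M from hom_ext e.symm_hom_apply,
      tauInvMap_id, idHom_apply]
  isoOfInverse (tauInvMap e.hom) (tauInvMap e.symm.hom) (h e) (h e.symm)

end projective

section finiteness

/-! ### Finiteness and directedness -/

variable {I : Type} [Quiver.{0} I] [Fintype I] [∀ s t : I, Fintype (s ⟶ t)]

/-- A positive definite Euler form has finitely many positive roots, since a root is determined up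
to sign by its residue class modulo 2. -/
theorem finite_roots (hq : EulerPosDef I) :
    {x : I → ℤ | 0 ≤ x ∧ euler x x = 1}.Finite := by
  refine Set.Finite.of_injOn (t := Set.univ) (f := fun x v => (x v : ZMod 2))
    (fun _ _ => Set.mem_univ _) ?_ Set.finite_univ
  rintro x ⟨hx0, hx⟩ y ⟨hy0, hy⟩ hxy
  have h1 : ∀ v, ∃ z, x v - y v = 2 * z := fun v => by
    have h := (ZMod.intCast_eq_intCast_iff_dvd_sub _ _ _).1 (congrFun hxy v).symm
    exact_mod_cast h
  choose z hz using h1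
  have hxz : x = y + z + z := funext fun v => by
    simp only [Pi.add_apply]
    linarith [hz v]
  have h2 : euler z z + euler (y + z) (y + z) = 1 := by
    rw [hxz] at hx
    simp only [map_add, LinearMap.add_apply] at hx ⊢
    linarith
  by_cases hz0 : z = 0
  · rw [hxz, hz0]
    simp
  · have hw0 : y + z = 0 := by
      by_contra hw0
      linarith [hq z hz0, hq _ hw0]
    have hxy' : x = -y := by
      rw [hxz, eq_neg_of_add_eq_zero_right hw0]
      abel
    have hy1 : y = 0 := le_antisymm (fun v => by
      have := hx0 v
      rw [hxy'] at this
      simpa using this) hy0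
    rw [hy1] at hy
    simp at hy

theorem Indecomposable.dv_mem_roots (hq : EulerPosDef I) {X : QRep I} (hX : X.Indecomposable)
    (hXf : X.FinDim) : X.dv ∈ {x : I → ℤ | 0 ≤ x ∧ euler x x = 1} :=
  ⟨X.dv_nonneg, hX.euler_self hq hXf⟩

theorem exists_tdim_bound (hq : EulerPosDef I) :
    ∃ D : ℕ, ∀ X : QRep I, X.Indecomposable → X.FinDim → X.tdim ≤ D := by
  obtain ⟨D, hD⟩ := ((finite_roots hq).image fun x => ∑ v, x v).bddAbove
  refine ⟨D.toNat, fun X hX hXf => ?_⟩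
  have h1 : ∑ v, X.dv v ≤ D := hD ⟨_, hX.dv_mem_roots hq hXf, rfl⟩
  have h2 : (X.tdim : ℤ) = ∑ v, X.dv v := by simp [tdim, dv]
  omega

theorem iterate_tau (hq : EulerPosDef I) {X : QRep I} (hX : X.Indecomposable) (hXf : X.FinDim)
    (h : ∀ k, ¬ (tau^[k] X).IsZero) (k : ℕ) :
    (tau^[k] X).Indecomposable ∧ (tau^[k] X).FinDim := by
  induction k with
  | zero => exact ⟨hX, hXf⟩
  | succ k ih =>
    have h1 := h (k + 1)
    rw [Function.iterate_succ_apply'] at h1 ⊢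
    exact ⟨ih.1.tau hq ih.2 h1, tau_finDim hq ih.2⟩

/-- `τ` is nilpotent: otherwise there would be a periodic orbit, and the sum of its dimension
vectors would be fixed by the Coxeter transformation. -/
theorem exists_iterate_tau_isZero (hq : EulerPosDef I) {X : QRep I} (hX : X.Indecomposable)
    (hXf : X.FinDim) : ∃ k, (tau^[k] X).IsZero := by
  by_contra! h
  have hk := iterate_tau hq hX hXf h
  let x : ℕ → I → ℤ := fun k => (tau^[k] X).dv
  have hstep : ∀ k z, euler z (x (k + 1)) = -euler (x k) z := fun k z => by
    have h1 := h (k + 1)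
    simp only [x, Function.iterate_succ_apply'] at h1 ⊢
    exact euler_tau hq (hk k).1 (hk k).2 h1 z
  obtain ⟨a, b, hab, hxab⟩ : ∃ a b, a < b ∧ x a = x b := by
    have := (finite_roots hq).to_subtype
    obtain ⟨a, b, hab, h'⟩ := Finite.exists_ne_map_eq_of_infinite
      fun k : ℕ => (⟨x k, (hk k).1.dv_mem_roots hq (hk k).2⟩ :
        {x : I → ℤ | 0 ≤ x ∧ euler x x = 1})
    have h' := congrArg Subtype.val h'
    rcases lt_or_gt_of_ne hab with h1 | h1
    · exact ⟨a, b, h1, h'⟩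
    · exact ⟨b, a, h1, h'.symm⟩
  let s := ∑ k ∈ Finset.Ico a b, x k
  have hs : s = ∑ k ∈ Finset.Ico a b, x (k + 1) := by
    have h1 := Finset.sum_Ico_sub (fun k => x k) hab.le
    rw [← hxab, sub_self, Finset.sum_sub_distrib, sub_eq_zero] at h1
    exact h1.symm
  have hss : euler s s = -euler s s := by
    calc euler s s = euler s (∑ k ∈ Finset.Ico a b, x (k + 1)) := congrArg (euler s) hs
      _ = -∑ k ∈ Finset.Ico a b, euler (x k) s := by
        rw [map_sum, Finset.sum_congr rfl fun k _ => hstep k s, Finset.sum_neg_distrib]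
      _ = -euler s s := by
        rw [← LinearMap.sum_apply, ← map_sum]
  have hs0 : s ≠ 0 := fun h0 => by
    have h1 : x a ≤ s := Finset.single_le_sum (f := x) (fun k _ => dv_nonneg _)
      (Finset.mem_Ico.2 ⟨le_rfl, hab⟩)
    rw [h0] at h1
    exact dv_ne_zero (hk a).2 (h a) (le_antisymm h1 (dv_nonneg _))
  have := hq s hs0
  omega

theorem bijective_of_iso (hq : EulerPosDef I) {X Y : QRep I} (hX : X.Indecomposable)
    (hXf : X.FinDim) (hY : Y.Indecomposable) (e : Iso X Y) (f : Hom X Y) (hf : f ≠ 0) (v : I) :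
    Function.Bijective (f.1 v) := by
  refine hX.bijective_of_comp_ne_zero hq hXf hY f e.symm.hom (fun h => hf (hom_ext fun v x => ?_)) v
  have h1 := congrArg (fun g : Hom X X => e.hom.1 v (g.1 v x)) h
  simp only [comp_apply, Iso.hom_symm_apply, hom_zero_apply, map_zero] at h1
  exact h1

/-- There are no oriented cycles of nonzero nonisomorphisms between indecomposables. The height of
`X` is given lexicographically by the least `k` with `τᵏ X = 0` and by the dimension of
`τᵏ⁻¹ X`. -/
theorem exists_height (hq : EulerPosDef I) : ∃ ν : QRep I → ℕ, ∀ X Y : QRep I,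
    X.Indecomposable → X.FinDim → Y.Indecomposable → Y.FinDim → ∀ f : Hom X Y, f ≠ 0 →
    (¬ ∀ v, Function.Bijective (f.1 v)) → ν X < ν Y := by
  obtain ⟨D, hD⟩ := exists_tdim_bound hq
  let d : QRep I → ℕ := fun X => sInf {k | (tau^[k] X).IsZero}
  let ν : QRep I → ℕ := fun X => d X * (D + 1) + (tau^[d X - 1] X).tdim
  have hd : ∀ X : QRep I, X.Indecomposable → X.FinDim → d X = d X.tau + 1 := fun X hX hXf => by
    refine (Nat.sInf_add (n := 1) (p := fun k => (tau^[k] X).IsZero) ?_).symm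
    refine Nat.pos_of_ne_zero fun h0 => ?_
    rcases Nat.sInf_eq_zero.1 h0 with h0 | h0
    · exact hX.1 h0
    · obtain ⟨k, hk⟩ := exists_iterate_tau_isZero hq hX hXf
      exact Set.notMem_empty k (h0 ▸ hk)
  have hd0 : ∀ X : QRep I, X.IsZero → d X = 0 := fun X hX => Nat.sInf_eq_zero.2 (Or.inl hX)
  have hν0 : ∀ X : QRep I, X.Indecomposable → X.FinDim → X.tau.IsZero → ν X = D + 1 + X.tdim :=
    fun X hX hXf h => by
      have h1 : d X = 1 := by rw [hd X hX hXf, hd0 _ h]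
      simp only [ν, h1, one_mul]
      rfl
  have hν1 : ∀ X : QRep I, X.Indecomposable → X.FinDim → ¬ X.tau.IsZero →
      ν X = ν X.tau + (D + 1) := fun X hX hXf h => by
    have h1 := hd X hX hXf
    have h2 := hd X.tau (hX.tau hq hXf h) (tau_finDim hq hXf)
    simp only [ν]
    rw [h1, h2, Nat.add_sub_cancel, Nat.add_sub_cancel, Function.iterate_succ_apply]
    ring
  have key : ∀ n : ℕ, ∀ X Y : QRep I, d X = n → X.Indecomposable → X.FinDim → Y.Indecomposable →
      Y.FinDim → ∀ f : Hom X Y, f ≠ 0 → Nonempty (Iso X Y) ∨ ν X < ν Y := fun n => by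
    induction n with
    | zero =>
      intro X Y hn hX hXf
      rw [hd X hX hXf] at hn
      omega
    | succ n ih =>
      intro X Y hn hX hXf hY hYf f hf
      by_cases hX0 : X.tau.IsZero
      · have h1 := hν0 X hX hXf hX0
        by_cases hY0 : Y.tau.IsZero
        · have h2 := hν0 Y hY hYf hY0
          have hinj := hX.injective_of_extZero hXf
            (fun N hN => extZero_of_tau_isZero hq hYf hN hY0) f hf
          rcases (tdim_le_of_injective hYf f hinj).lt_or_eq with h | h
          · right
            omega
          · exact .inl ⟨isoOfBijective f (bijective_of_injective hXf hYf f hinj h.ge)⟩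
        · right
          have h2 := hν1 Y hY hYf hY0
          have h3 := hd Y.tau (hY.tau hq hYf hY0) (tau_finDim hq hYf)
          have h4 := hD X hX hXf
          have h5 : D + 1 ≤ ν Y.tau := by
            simp only [ν]
            rw [h3]
            exact le_add_right (Nat.le_mul_of_pos_left _ (Nat.succ_pos _))
          omega
      · have hhom : 0 < homDim X.tau Y.tau := by
          rw [homDim_tau_tau hq hX hXf hX0, homDim_pos_iff hXf hYf]
          exact ⟨f, hf⟩
        obtain ⟨g, hg⟩ := (homDim_pos_iff (tau_finDim hq hXf) (tau_finDim hq hYf)).1 hhom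
        have hY0 : ¬ Y.tau.IsZero := fun h => hg (hom_eq_zero_of_isZero_right h g)
        have h1 := hd X hX hXf
        rcases ih X.tau Y.tau (by omega) (hX.tau hq hXf hX0) (tau_finDim hq hXf)
          (hY.tau hq hYf hY0) (tau_finDim hq hYf) g hg with ⟨⟨e⟩⟩ | h
        · obtain ⟨e1⟩ := exists_iso_tauInv_tau hq hX hXf hX0
          obtain ⟨e2⟩ := exists_iso_tauInv_tau hq hY hYf hY0
          exact .inl ⟨(e1.symm.trans e.tauInv).trans e2⟩
        · right
          have h2 := hν1 X hX hXf hX0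
          have h3 := hν1 Y hY hYf hY0
          omega
  refine ⟨ν, fun X Y hX hXf hY hYf f hf hb => ?_⟩
  rcases key _ X Y rfl hX hXf hY hYf f hf with ⟨⟨e⟩⟩ | h
  · exact absurd (bijective_of_iso hq hX hXf hY e f hf) hb
  · exact h

/-- An indecomposable is determined by its dimension vector. -/
theorem exists_iso_of_dv_eq (hq : EulerPosDef I) {X Y : QRep I} (hX : X.Indecomposable)
    (hXf : X.FinDim) (hY : Y.Indecomposable) (hYf : Y.FinDim) (h : X.dv = Y.dv) :
    Nonempty (Iso X Y) := by
  obtain ⟨ν, hν⟩ := exists_height hq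
  have hpos : ∀ {X Y : QRep I}, X.Indecomposable → X.FinDim → Y.FinDim → X.dv = Y.dv →
      ∃ f : Hom X Y, f ≠ 0 := fun {X Y} hX hXf hYf h => by
    have h1 := homDim_sub_extDim hXf hYf
    rw [← h, hX.euler_self hq hXf] at h1
    exact (homDim_pos_iff hXf hYf).1 (by omega)
  obtain ⟨f, hf⟩ := hpos hX hXf hYf h
  obtain ⟨g, hg⟩ := hpos hY hYf hXf h.symm
  by_cases hf' : ∀ v, Function.Bijective (f.1 v)
  · exact ⟨isoOfBijective f hf'⟩
  by_cases hg' : ∀ v, Function.Bijective (g.1 v)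
  · exact ⟨(isoOfBijective g hg').symm⟩
  exact absurd (hν X Y hX hXf hY hYf f hf hf') (hν Y X hY hYf hX hXf g hg hg').asymm

end finiteness

section mult

variable {I : Type} [Quiver.{0} I]

/-! ### Multiplicities -/

/-- The linear map from `Nⁿ` at a vertex with given components. -/
def dsumDescLin {n : ℕ} {N M : QRep I} (i : Fin n → Hom N M) (v : I) :
    (Fin n → N.V v) →ₗ[ℂ] M.V v :=
  ∑ k, (i k).1 v ∘ₗ LinearMap.proj k

theorem dsumDescLin_apply {n : ℕ} {N M : QRep I} (i : Fin n → Hom N M) (v : I)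
    (x : Fin n → N.V v) : dsumDescLin i v x = ∑ k, (i k).1 v (x k) := by
  simp only [dsumDescLin, LinearMap.sum_apply, LinearMap.comp_apply, LinearMap.proj_apply]

/-- The homomorphism from `Nⁿ` with given components. -/
def dsumDesc {n : ℕ} {N M : QRep I} (i : Fin n → Hom N M) : Hom (dsum fun _ : Fin n => N) M :=
  mkHom (dsumDescLin i) fun s t a x => by
    refine (dsumDescLin_apply i t fun k => N.map a (x k)).trans ?_
    refine Eq.trans ?_ (congrArg (M.map a) (dsumDescLin_apply i s x)).symm
    simp only [map_sum, hom_map]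

/-- The homomorphism to `Nⁿ` with given components. -/
def dsumLift {n : ℕ} {N M : QRep I} (p : Fin n → Hom M N) : Hom M (dsum fun _ : Fin n => N) :=
  mkHom (fun v => LinearMap.pi fun k => (p k).1 v) fun _ _ a x => funext fun k => hom_map (p k) a x

/-- The projection from `Nⁿ` to a component. -/
def dsumProj {n : ℕ} (N : QRep I) (k : Fin n) : Hom (dsum fun _ : Fin n => N) N :=
  mkHom (fun v => LinearMap.proj (R := ℂ) (φ := fun _ : Fin n => N.V v) k) fun _ _ _ _ => rfl

theorem dsumProj_incl {n : ℕ} (N : QRep I) (k l : Fin n) (v : I) (x : N.V v) :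
    (dsumProj N k).1 v ((dsumIncl (fun _ : Fin n => N) l).1 v x) = if k = l then x else 0 := by
  by_cases h : k = l
  · subst h
    rw [if_pos rfl]
    exact @Pi.single_eq_same (Fin n) (fun _ => N.V v) _ (Classical.decEq _) k x
  · rw [if_neg h]
    exact @Pi.single_eq_of_ne (Fin n) (fun _ => N.V v) _ (Classical.decEq _) _ _ h x

/-- `Nⁿ` is a direct summand of `M` if and only if there are `n` homomorphisms `N → M` and
`M → N` that compose to the identity matrix. -/
theorem summand_iff {n : ℕ} {N M : QRep I} :
    (∃ X : QRep I, Nonempty (Iso M ((dsum fun _ : Fin n => N).prod X))) ↔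
      ∃ (i : Fin n → Hom N M) (p : Fin n → Hom M N), ∀ k l v x,
        (p k).1 v ((i l).1 v x) = if k = l then x else 0 := by
  constructor
  · rintro ⟨X, ⟨e⟩⟩
    refine ⟨fun k => comp e.symm.hom (comp (prodInl _ X) (dsumIncl (fun _ : Fin n => N) k)),
      fun k => comp (dsumProj N k) (comp (prodFst _ X) e.hom), fun k l v x => ?_⟩
    rw [← dsumProj_incl]
    simp only [comp_apply, Iso.hom_symm_apply, prodFst_inl]
  · rintro ⟨i, p, h⟩
    refine ⟨_, ⟨isoProdKer (dsumDesc i) (dsumLift p) fun v x => funext fun k => ?_⟩⟩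
    change (p k).1 v ((dsumDesc i).1 v x) = x k
    rw [show (dsumDesc i).1 v x = _ from dsumDescLin_apply i v x, map_sum]
    refine (Finset.sum_congr rfl fun l _ => h k l v (x l)).trans ?_
    exact (Finset.sum_ite_eq Finset.univ k x).trans (if_pos (Finset.mem_univ k))

variable [Fintype I] [∀ s t : I, Fintype (s ⟶ t)]

theorem exists_smul_iso (hq : EulerPosDef I) {B X : QRep I} (hB : B.Indecomposable)
    (hBf : B.FinDim) (e : Iso B X) (f : Hom B X) : ∃ c : ℂ, ∀ v x, f.1 v x = c • e.hom.1 v x := by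
  obtain ⟨c, hc⟩ := (hB.brick_and_extZero hq hBf).1 (comp e.symm.hom f)
  refine ⟨c, fun v x => ?_⟩
  rw [← map_smul, ← hc, comp_apply, e.hom_symm_apply]

/-- The multiplicity counts the summands in any decomposition (Krull-Remak-Schmidt). -/
theorem mult_eq_card (hq : EulerPosDef I) {B M : QRep I} (hB : B.Indecomposable)
    (hBf : B.FinDim) {J : Type} [Fintype J] {X : J → QRep I} (D : SumDecomp M X)
    (hX : ∀ j, (X j).Indecomposable ∨ (X j).IsZero) :
    B.mult M = Nat.card {j // Nonempty (Iso B (X j))} := by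
  classical
  set S := {j // Nonempty (Iso B (X j))}
  let e : ∀ j : S, Iso B (X j) := fun j => j.2.some
  rw [mult, if_neg hB.1]
  refine IsGreatest.csSup_eq ⟨summand_iff.2 ?_, ?_⟩
  · let c : Fin (Nat.card S) ≃ S := (Finite.equivFin S).symm
    refine ⟨fun k => comp (D.i (c k)) (e (c k)).hom, fun k => comp (e (c k)).symm.hom (D.p (c k)),
      fun k l v x => ?_⟩
    simp only [comp_apply]
    split_ifs with h
    · subst h
      rw [D.p_i, Iso.symm_hom_apply]
    · rw [D.p_i_ne _ _ fun h' => h (c.injective (Subtype.ext h')), map_zero]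
  · intro n hn
    obtain ⟨i, p, h⟩ := summand_iff.1 hn
    choose A hA using fun (j : S) (k : Fin n) =>
      exists_smul_iso hq hB hBf (e j) (comp (D.p j) (i k))
    choose C hC using fun (k : Fin n) (j : S) =>
      (hB.brick_and_extZero hq hBf).1 (comp (p k) (comp (D.i j) (e j).hom))
    have h0 : ∀ k l j, ¬ Nonempty (Iso B (X j)) →
        comp (comp (p k) (D.i j)) (comp (D.p j) (i l)) = 0 := fun k l j hj => by
      by_contra h0
      rcases hX j with h1 | h1
      · exact hj ⟨isoOfBijective _ (hB.bijective_of_comp_ne_zero hq hBf h1 _ _ h0)⟩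
      · rw [hom_eq_zero_of_isZero_right h1 (comp (D.p j) (i l))] at h0
        exact h0 (hom_ext fun v x => map_zero ((comp (p k) (D.i j)).1 v))
    have hx : ∃ v, ∃ x : B.V v, x ≠ 0 := by
      by_contra! hx
      exact hB.1 fun v => ⟨fun x y => by rw [hx v x, hx v y]⟩
    obtain ⟨v, x, hx⟩ := hx
    let A' : Matrix S (Fin n) ℂ := A
    let C' : Matrix (Fin n) S ℂ := C
    have hCA : C' * A' = 1 := by
      ext k l
      refine smul_left_injective ℂ hx ?_
      have h2 : ∀ j : S, (p k).1 v ((D.i j).1 v ((D.p j).1 v ((i l).1 v x))) =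
          (C' k j * A' j l) • x := fun j => by
        rw [mul_comm, mul_smul, ← comp_apply (D.p j), hA, map_smul, map_smul]
        congr 1
        exact hC k j v x
      have h1 := h k l v x
      rw [← D.sum_i_p v ((i l).1 v x), map_sum,
        ← Finset.sum_subset (Finset.subset_univ (Finset.univ.filter
          fun j => Nonempty (Iso B (X j)))),
        Finset.sum_subtype (p := fun j => Nonempty (Iso B (X j))) _ (by simp)] at h1
      · rw [Finset.sum_congr rfl fun j _ => h2 j, ← Finset.sum_smul] at h1
        rw [Matrix.mul_apply, Matrix.one_apply]
        refine h1.trans ?_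
        split_ifs <;> simp
      · intro j _ hj
        exact congrArg (fun f : Hom B B => f.1 v x) (h0 k l j (by simpa using hj))
    have h3 : (C' * A').rank ≤ C'.rank := Matrix.rank_mul_le_left _ _
    rw [hCA, Matrix.rank_one, Fintype.card_fin] at h3
    have h4 := C'.rank_le_card_width
    rw [Nat.card_eq_fintype_card]
    exact h3.trans h4

/-- The inverse translation of a direct sum. -/
def SumDecomp.tauInv {M : QRep I} {J : Type} [Fintype J] {X : J → QRep I} (D : SumDecomp M X) :
    SumDecomp M.tauInv fun j => (X j).tauInv where
  i j := tauInvMap (D.i j)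
  p j := tauInvMap (D.p j)
  p_i j v x := by
    rw [← comp_apply, ← tauInvMap_comp,
      show comp (D.p j) (D.i j) = idHom _ from hom_ext (D.p_i j), tauInvMap_id, idHom_apply]
  p_i_ne j k h v x := by
    rw [← comp_apply, ← tauInvMap_comp,
      show comp (D.p j) (D.i k) = 0 from hom_ext (D.p_i_ne j k h), tauInvMap_zero, hom_zero_apply]
  sum_i_p v x := by
    have h1 : ∑ j, comp (D.i j) (D.p j) = idHom M := hom_ext fun v x => by
      rw [hom_sum_apply]
      exact D.sum_i_p v x
    have h2 := tauInvMap_id M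
    rw [← h1, tauInvMap_sum] at h2
    have h3 := congrArg (fun f : Hom M.tauInv M.tauInv => f.1 v x) h2
    simpa only [hom_sum_apply, tauInvMap_comp, comp_apply, idHom_apply] using h3

theorem exists_iso_tau (hq : EulerPosDef I) {X Y : QRep I} (hX : X.Indecomposable) (hXf : X.FinDim)
    (hY : Y.Indecomposable) (hYf : Y.FinDim) (h0 : ¬ X.tauInv.IsZero) (h : Y.dv = X.tauInv.dv) :
    ¬ Y.tau.IsZero ∧ Nonempty (Iso Y.tau X) := by
  have h1 := euler_tauInv hq hX hXf h0
  have hY0 : ¬ Y.tau.IsZero := fun hY0 => by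
    have h2 := homDim_sub_extDim hYf hXf
    rw [(extDim_eq_zero_iff hYf hXf).2 (extZero_of_tau_isZero hq hYf hXf hY0), h, h1,
      hX.euler_self hq hXf] at h2
    omega
  refine ⟨hY0, exists_iso_of_dv_eq hq (hY.tau hq hYf hY0) (tau_finDim hq hYf) hX hXf ?_⟩
  have h2 : ∀ z, euler z (Y.tau.dv - X.dv) = 0 := fun z => by
    rw [map_sub, euler_tau hq hY hYf hY0, h, h1, neg_neg, sub_self]
  by_contra h3
  exact (hq _ (sub_ne_zero.2 h3)).ne' (h2 _)

theorem tauInv_indecomposable (hq : EulerPosDef I) {X : QRep I} (hX : X.Indecomposable)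
    (hXf : X.FinDim) (h0 : ¬ X.tauInv.IsZero) : X.tauInv.Indecomposable := by
  have h1 := euler_tauInv hq hX hXf h0
  obtain ⟨Y, hYf, hY, hYX⟩ := exists_indecomposable hq (tauInv_finDim hq hXf)
    (by rw [h1, h1, neg_neg, hX.euler_self hq hXf])
  obtain ⟨hY0, ⟨e⟩⟩ := exists_iso_tau hq hX hXf hY hYf h0 hYX
  obtain ⟨e'⟩ := exists_iso_tauInv_tau hq hY hYf hY0
  exact hY.of_iso (e'.symm.trans e.tauInv)

theorem iso_tau_iff (hq : EulerPosDef I) {B X : QRep I} (hB : B.Indecomposable) (hBf : B.FinDim)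
    (hX : X.Indecomposable) (hXf : X.FinDim) :
    Nonempty (Iso B.tau X) ↔ Nonempty (Iso B X.tauInv) := by
  constructor
  · rintro ⟨e⟩
    obtain ⟨e'⟩ := exists_iso_tauInv_tau hq hB hBf fun h => hX.1 (e.isZero_iff.1 h)
    exact ⟨e'.symm.trans e.tauInv⟩
  · rintro ⟨e⟩
    exact (exists_iso_tau hq hX hXf hB hBf (fun h => hB.1 (e.isZero_iff.2 h)) e.dv_eq).2

/-- The multiplicities of `τ B` in `M` and of `B` in `τ⁻¹ M` agree. -/
theorem mult_tau (hq : EulerPosDef I) {B M : QRep I} (hB : B.Indecomposable) (hBf : B.FinDim)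
    (hM : M.FinDim) : B.tau.mult M = B.mult M.tauInv := by
  obtain ⟨J, _, X, hX, ⟨D⟩⟩ := exists_sumDecomp M hM
  have h1 : ∀ j, ((X j).tauInv).Indecomposable ∨ ((X j).tauInv).IsZero := fun j => by
    by_cases h : ((X j).tauInv).IsZero
    · exact .inr h
    · exact .inl (tauInv_indecomposable hq (hX j).2 (hX j).1 h)
  rw [mult_eq_card hq hB hBf D.tauInv h1]
  by_cases h : B.tau.IsZero
  · have : IsEmpty {j // Nonempty (Iso B (X j).tauInv)} := ⟨fun ⟨j, hj⟩ => by
      obtain ⟨e⟩ := (iso_tau_iff hq hB hBf (hX j).2 (hX j).1).2 hj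
      exact (hX j).2.1 (e.isZero_iff.1 h)⟩
    rw [mult, if_pos h, Nat.card_of_isEmpty]
  · rw [mult_eq_card hq (hB.tau hq hBf h) (tau_finDim hq hBf) D fun j => .inl (hX j).2]
    exact Nat.card_congr (Equiv.subtypeEquivRight fun j =>
      iso_tau_iff hq hB hBf (hX j).2 (hX j).1)

end mult

/-! ### Homomorphisms to a simple representation of a special quiver -/

section simple

variable {I : Type} [Quiver.{0} I]

theorem simple_finDim (i : I) : (simple i).FinDim := fun v =>
  inferInstanceAs (Module.Finite ℂ (PLift (v = i) → ℂ))

/-- The coordinate of the space of `S(i)` at `i`. -/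
def simpleCoord (i : I) (x : (simple i).V i) : ℂ := x ⟨rfl⟩

theorem simple_ext {i v : I} {x y : (simple i).V v}
    (h : ∀ hv : v = i, simpleCoord i (hv ▸ x) = simpleCoord i (hv ▸ y)) : x = y :=
  funext fun ⟨hv⟩ => by
    subst hv
    exact h rfl

theorem simple_surjective {i : I} {Z : QRep I} (g : Hom Z (simple i)) (hg : g ≠ 0) (v : I) :
    Function.Surjective (g.1 v) := by
  obtain ⟨w, x, hx⟩ := (hom_ne_zero_iff g).1 hg
  have hx' : ∃ hw : w = i, simpleCoord i (hw ▸ g.1 w x) ≠ 0 := by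
    by_contra! h
    refine hx (simple_ext fun hw => ?_)
    subst hw
    exact h rfl
  obtain ⟨rfl, hx'⟩ := hx'
  intro y
  by_cases hv : v = w
  · subst hv
    refine ⟨(simpleCoord v y / simpleCoord v (g.1 v x)) • x, ?_⟩
    rw [map_smul]
    exact simple_ext fun _ => div_mul_cancel₀ _ hx'
  · exact ⟨0, simple_ext fun h => absurd h hv⟩

theorem simple_not_isZero (i : I) : ¬ (simple i).IsZero := fun h => by
  have := h i
  have h1 : (fun _ => 1 : PLift (i = i) → ℂ) = fun _ => 0 :=
    Subsingleton.elim (α := (simple i).V i) _ _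
  exact one_ne_zero (congrFun h1 ⟨rfl⟩)

theorem simple_brick (i : I) : Brick (simple i) := fun f => by
  refine ⟨simpleCoord i (f.1 i (fun _ => 1 : PLift (i = i) → ℂ)), fun v x => ?_⟩
  refine simple_ext fun hv => ?_
  subst hv
  have hx : x = simpleCoord v x • (fun _ => 1 : PLift (v = v) → ℂ) :=
    simple_ext fun _ => (mul_one (simpleCoord v x)).symm
  have h1 : f.1 v x = simpleCoord v x • f.1 v (fun _ => 1 : PLift (v = v) → ℂ) :=
    (congrArg (f.1 v) hx).trans (map_smul (f.1 v) _ _)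
  rw [h1]
  exact mul_comm _ _

variable [Fintype I] [∀ s t : I, Fintype (s ⟶ t)]

theorem simple_indecomposable (i : I) : (simple i).Indecomposable :=
  indecomposable_of_homDim (simple_finDim i)
    ((simple_brick i).homDim_eq_one (simple_not_isZero i))

/-- By directedness, two indecomposables cannot have both homomorphisms and extensions. -/
theorem extZero_of_hom_ne_zero (hq : EulerPosDef I) {X Y : QRep I} (hX : X.Indecomposable)
    (hXf : X.FinDim) (hY : Y.Indecomposable) (hYf : Y.FinDim) (f : Hom X Y) (hf : f ≠ 0) :
    ExtZero X Y := by
  obtain ⟨ν, hν⟩ := exists_height hq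
  by_contra h
  obtain ⟨E, hEf, hE, ⟨a, ha, ha'⟩, b, hb⟩ := exists_between_of_not_extZero hXf hYf hY h
  have h1 := hν Y E hY hYf hE hEf a ha ha'
  have hle : ∀ {A B : QRep I}, A.Indecomposable → A.FinDim → B.Indecomposable → B.FinDim →
      ∀ f : Hom A B, f ≠ 0 → Nonempty (Iso A B) ∨ ν A < ν B := fun {A B} hA hAf hB hBf f hf => by
    by_cases hb : ∀ v, Function.Bijective (f.1 v)
    · exact .inl ⟨isoOfBijective f hb⟩
    · exact .inr (hν A B hA hAf hB hBf f hf hb)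
  rcases hle hE hEf hX hXf b hb with ⟨⟨e⟩⟩ | h2
  · rcases hle hX hXf hY hYf f hf with ⟨⟨e'⟩⟩ | h3
    · exact ha' (bijective_of_iso hq hY hYf hE (e.trans e').symm a ha)
    · have hf' : comp f e.hom ≠ 0 := fun h0 => hf (hom_ext fun v x => by
        have := congrArg (fun g : Hom E Y => g.1 v (e.symm.hom.1 v x)) h0
        simpa only [comp_apply, e.hom_symm_apply, hom_zero_apply] using this)
      by_cases hb' : ∀ v, Function.Bijective ((comp f e.hom).1 v)
      · exact ha' (bijective_of_iso hq hY hYf hE (isoOfBijective _ hb').symm a ha)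
      · exact absurd (hν E Y hE hEf hY hYf _ hf' hb') h1.asymm
  · rcases hle hX hXf hY hYf f hf with ⟨⟨e'⟩⟩ | h3
    · have hb' : comp e'.hom b ≠ 0 := fun h0 => hb (hom_ext fun v x => by
        have := congrArg (fun g : Hom E Y => e'.symm.hom.1 v (g.1 v x)) h0
        simpa only [comp_apply, e'.symm_hom_apply, hom_zero_apply, map_zero] using this)
      by_cases hb'' : ∀ v, Function.Bijective ((comp e'.hom b).1 v)
      · exact ha' (bijective_of_iso hq hY hYf hE (isoOfBijective _ hb'').symm a ha)
      · exact absurd (hν E Y hE hEf hY hYf _ hb' hb'') h1.asymm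
    · omega

theorem homDim_eq_zero_of_not_extZero (hq : EulerPosDef I) {X Y : QRep I} (hX : X.Indecomposable)
    (hXf : X.FinDim) (hY : Y.Indecomposable) (hYf : Y.FinDim) (h : ¬ ExtZero X Y) :
    homDim X Y = 0 := by
  rw [homDim_eq_zero_iff hXf hYf]
  intro f
  by_contra hf
  exact h (extZero_of_hom_ne_zero hq hX hXf hY hYf f hf)

/-- For a special quiver, the dimension vector `x` of an indecomposable satisfies
`⟨x, e_i⟩ ≤ 1`. -/
theorem euler_simple_le_one (hq : EulerPosDef I) (hs : IsSpecialQuiver I) (i : I) {M : QRep I}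
    (hM : M.FinDim) (h : euler M.dv M.dv = 1) : euler M.dv (simple i).dv ≤ 1 := by
  obtain ⟨X, hXf, hX, hXM⟩ := exists_indecomposable hq hM h
  rw [← hXM, ← homDim_sub_extDim hXf (simple_finDim i)]
  have h1 : homDim X (simple i) ≤ 1 := hs i X hXf hX
  omega

/-- If `⟨x, e_i⟩ = 1`, then `⟨e_i, x⟩ ≥ -1` as otherwise `x + e_i` would be a root. -/
theorem neg_one_le_euler_simple (hq : EulerPosDef I) (hs : IsSpecialQuiver I) (i : I) {X : QRep I}
    (hX : X.FinDim) (h : euler X.dv X.dv = 1) (h1 : euler X.dv (simple i).dv = 1) :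
    -1 ≤ euler (simple i).dv X.dv := by
  have hS := simple_indecomposable i
  have hSf := simple_finDim i
  have hSS := hS.euler_self hq hSf
  by_contra! h2
  have hd : (X.prod (simple i)).dv = X.dv + (simple i).dv := dv_prod hX hSf
  have hne : X.dv + (simple i).dv ≠ 0 := fun h0 => by
    have h3 : euler (X.dv + (simple i).dv) (simple i).dv = 0 := by rw [h0]; simp
    rw [map_add, LinearMap.add_apply] at h3
    omega
  have hpos := hq _ hne
  have h3 := euler_simple_le_one hq hs i (prod_finDim hX hSf)
  rw [hd] at h3
  simp only [map_add, LinearMap.add_apply] at hpos h3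
  have := h3 (by omega)
  omega

/-- For fixed `g : Z → S(i)`, the indecomposables `Y` that violate the factorization property of
`exists_comp_ne_zero`. -/
structure Bad (i : I) {Z : QRep I} (g : Hom Z (simple i)) (Y : QRep I) : Prop where
  indec : Y.Indecomposable
  finDim : Y.FinDim
  exists_simple : ∃ k : Hom Y (simple i), k ≠ 0
  exists_hom : ∃ f : Hom Y Z, f ≠ 0
  comp_eq_zero : ∀ f : Hom Y Z, comp g f = 0

theorem homDim_ker {Z N : QRep I} (g : Hom Z N) (Y : QRep I) (h : ∀ f : Hom Y Z, comp g f = 0) :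
    homDim Y (ker g) = homDim Y Z := by
  refine LinearEquiv.finrank_eq (LinearEquiv.ofBijective
    (compLeft (X := Y) (subIncl (ker_stable g))) ⟨fun f f' hf => hom_ext fun v x =>
      subIncl_injective v (congrArg (fun k : Hom Y Z => k.1 v x) hf), fun f => ?_⟩)
  exact ⟨subLift (ker_stable g) f fun v x => congrArg (fun k : Hom Y N => k.1 v x) (h f), rfl⟩

/-- There is no bad `Y` of maximal height: computing with the Euler form, the kernel of `g` is the sum
of two indecomposables, and `f : Y → Z` is injective, which leads to a contradiction. -/
theorem not_bad_of_maximal (hq : EulerPosDef I) (hs : IsSpecialQuiver I) (i : I) {ν : QRep I → ℕ}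
    (hν : ∀ X Y : QRep I, X.Indecomposable → X.FinDim → Y.Indecomposable → Y.FinDim →
      ∀ f : Hom X Y, f ≠ 0 → (¬ ∀ v, Function.Bijective (f.1 v)) → ν X < ν Y)
    {Z : QRep I} (hZ : Z.Indecomposable) (hZf : Z.FinDim) (g : Hom Z (simple i)) (hg : g ≠ 0)
    {Y : QRep I} (hY : Bad i g Y) (hmax : ∀ Y', Bad i g Y' → ν Y' ≤ ν Y) : False := by
  classical
  obtain ⟨hYi, hYf, ⟨k, hk⟩, ⟨f, hf⟩, hgf⟩ := hY
  have hS : (simple i).Indecomposable := simple_indecomposable i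
  have hSf : (simple i).FinDim := simple_finDim i
  have hsurj := simple_surjective g hg
  have hfb : ¬ ∀ v, Function.Bijective (f.1 v) := fun hb => hg <| hom_ext fun v x => by
    obtain ⟨y, rfl⟩ := (hb v).2 x
    exact congrArg (fun k : Hom Y (simple i) => k.1 v y) (hgf f)
  have hYZ := hν Y Z hYi hYf hZ hZf f hf hfb
  have hSS := hS.euler_self hq hSf
  have hYY := hYi.euler_self hq hYf
  have hZZ := hZ.euler_self hq hZf
  have hom_S : ∀ {X : QRep I}, X.Indecomposable → X.FinDim → ∀ k : Hom X (simple i), k ≠ 0 →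
      homDim X (simple i) = 1 ∧ extDim X (simple i) = 0 ∧ euler X.dv (simple i).dv = 1 := fun {X} hX hXf k hk => by
    have h1 : homDim X (simple i) ≤ 1 := hs i X hXf hX
    have h2 := (homDim_pos_iff hXf hSf).2 ⟨k, hk⟩
    have h3 := (extDim_eq_zero_iff hXf hSf).2 (extZero_of_hom_ne_zero hq hX hXf hS hSf k hk)
    have h4 := homDim_sub_extDim hXf hSf
    exact ⟨by omega, h3, by omega⟩
  obtain ⟨hYS1, hYS2, hYS⟩ := hom_S hYi hYf k hk
  obtain ⟨hZS1, hZS2, hZS⟩ := hom_S hZ hZf g hg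
  have hYZe := (extDim_eq_zero_iff hYf hZf).2 (extZero_of_hom_ne_zero hq hYi hYf hZ hZf f hf)
  have hYZ0 := homDim_sub_extDim hYf hZf
  have hYZp := (homDim_pos_iff hYf hZf).2 ⟨f, hf⟩
  have hSZ := neg_one_le_euler_simple hq hs i hZf hZZ hZS
  have hSY := neg_one_le_euler_simple hq hs i hYf hYY hYS
  -- All homomorphisms `Y → Z` land in the kernel `K` of `g`. The long exact sequences give
  -- `dim End K = 1 - ⟨S(i), Z⟩ ≤ 2` and `dim Ext¹(Y, K) = 1`.
  set K := ker g with hK_def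
  have hKf : K.FinDim := subrep_finDim hZf
  have hKd : K.dv = Z.dv - (simple i).dv := dv_ker hZf g hsurj
  have hι : ∀ v, Function.Injective ((subIncl (ker_stable g)).1 v) := subIncl_injective
  have hKSx : ExtZero K (simple i) :=
    (extZero_of_hom_ne_zero hq hZ hZf hS hSf g hg).of_injective _ hι
  have hKS : homDim K (simple i) = 0 := by
    have h1 := homDim_sub_extDim hKf hSf
    rw [hKd, map_sub, LinearMap.sub_apply, (extDim_eq_zero_iff hKf hSf).2 hKSx] at h1
    omega
  have hKZ : extDim K Z = 0 := (extDim_eq_zero_iff hKf hZf).2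
    ((hZ.brick_and_extZero hq hZf).2.of_injective _ hι)
  have hKK : homDim K K = 1 - euler (simple i).dv Z.dv := by
    have h1 := homDim_ker g K fun f => (homDim_eq_zero_iff hKf hSf).1 hKS _
    have h2 := homDim_sub_extDim hKf hZf
    rw [hKd, map_sub, LinearMap.sub_apply] at h2
    rw [← hK_def] at h1
    omega
  have hYK := homDim_ker g Y hgf
  rw [← hK_def] at hYK
  have hYKe : extDim Y K = 1 := by
    have h1 := homDim_sub_extDim hYf hKf
    rw [hKd, map_sub] at h1
    omega
  -- As `Y` has homomorphisms to a summand `X a` of `K` and extensions with a summand `X b`, and never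
  -- both for the same summand, the bound on `End K` forces `K = X a ⊕ X b` with `X a` and `X b`
  -- orthogonal.
  obtain ⟨J, _, X, hX, ⟨D⟩⟩ := exists_sumDecomp K hKf
  have hXf := fun j => (hX j).1
  have hXi := fun j => (hX j).2
  rw [D.homDim_right hKf hYf] at hYK
  rw [D.extDim_right hKf hYf] at hYKe
  obtain ⟨a, -, ha⟩ := Finset.exists_ne_zero_of_sum_ne_zero (hYK.trans_ne hYZp.ne')
  obtain ⟨b, -, hb⟩ := Finset.exists_ne_zero_of_sum_ne_zero (hYKe.trans_ne one_ne_zero)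
  obtain ⟨fa, hfa⟩ := (homDim_pos_iff hYf (hXf a)).1 (Nat.pos_of_ne_zero ha)
  have hYa := (extDim_eq_zero_iff hYf (hXf a)).2
    (extZero_of_hom_ne_zero hq hYi hYf (hXi a) (hXf a) fa hfa)
  have hYb : homDim Y (X b) = 0 := homDim_eq_zero_of_not_extZero hq hYi hYf (hXi b) (hXf b)
    fun h => hb ((extDim_eq_zero_iff hYf (hXf b)).2 h)
  have hab : a ≠ b := fun h => hb (h ▸ hYa)
  have hsum' : ∑ c : J × J, homDim (X c.1) (X c.2) = homDim K K := by
    rw [Fintype.sum_prod_type_right]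
    simp only [← D.homDim_left hKf (hXf _)]
    rw [← D.homDim_right hKf hKf]
  have hsum : ∑ c : J × J, homDim (X c.1) (X c.2) ≤ 2 := by omega
  have hdiag := fun j => (hXi j).homDim_self hq (hXf j)
  have hdiag2 : 2 ≤ homDim K K := by
    rw [← hsum']
    refine le_trans ?_ (Finset.sum_le_sum_of_subset (Finset.subset_univ {(a, a), (b, b)}))
    rw [Finset.sum_pair fun h => hab (congrArg Prod.fst h), hdiag, hdiag]
  have hoff : ∀ c d, (c, d) ≠ (a, a) → (c, d) ≠ (b, b) → homDim (X c) (X d) = 0 := fun c d h1 h2 => by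
    have h3 : ({(a, a), (b, b), (c, d)} : Finset (J × J)).sum (fun c => homDim (X c.1) (X c.2)) ≤ 2 :=
      (Finset.sum_le_sum_of_subset (Finset.subset_univ _)).trans hsum
    rw [Finset.sum_insert, Finset.sum_pair h2.symm, hdiag, hdiag] at h3
    · change 1 + (1 + homDim (X c) (X d)) ≤ 2 at h3
      omega
    · simp only [Finset.mem_insert, Finset.mem_singleton, not_or]
      exact ⟨fun h => hab (congrArg Prod.fst h), h1.symm⟩
  have huniv : (Finset.univ : Finset J) = {a, b} := by
    ext c
    simp only [Finset.mem_univ, Finset.mem_insert, Finset.mem_singleton, true_iff]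
    by_contra! h
    have h1 := hoff c c (fun h' => h.1 (congrArg Prod.fst h')) fun h' => h.2 (congrArg Prod.fst h')
    rw [hdiag] at h1
    omega
  have hba : homDim (X b) (X a) = 0 := hoff b a (fun h => hab (congrArg Prod.fst h).symm)
    fun h => hab (congrArg Prod.snd h)
  rw [huniv, Finset.sum_pair hab] at hYK hYKe
  have hKd' := D.dv_eq hKf
  rw [huniv, Finset.sum_pair hab, hKd] at hKd'
  have hKS' := D.homDim_left hKf hSf
  have hKSe := D.extDim_left hKf hSf
  rw [(extDim_eq_zero_iff hKf hSf).2 hKSx] at hKSe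
  rw [huniv, Finset.sum_pair hab] at hKS' hKSe
  -- Equality holds in all bounds, which determines the Euler form on `S(i)`, `X a` and `X b`.
  have haS : euler (X a).dv (simple i).dv = 0 := by
    have := homDim_sub_extDim (hXf a) hSf
    omega
  have hbS : euler (X b).dv (simple i).dv = 0 := by
    have := homDim_sub_extDim (hXf b) hSf
    omega
  have haa := (hXi a).euler_self hq (hXf a)
  have hbb := (hXi b).euler_self hq (hXf b)
  have hSX : ∀ j, euler (X j).dv (simple i).dv = 0 → -1 ≤ euler (simple i).dv (X j).dv := fun j hj => by
    have hne : (simple i).dv + (X j).dv ≠ 0 := fun h0 => by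
      have h3 : euler ((simple i).dv + (X j).dv) (simple i).dv = 0 := by rw [h0]; simp
      rw [map_add, LinearMap.add_apply] at h3
      omega
    have hpos := hq _ hne
    have hjj := (hXi j).euler_self hq (hXf j)
    simp only [map_add, LinearMap.add_apply] at hpos
    omega
  have hSa' := hSX a haS
  have hSb' := hSX b hbS
  have hSK : euler (simple i).dv Z.dv - euler (simple i).dv (simple i).dv = euler (simple i).dv (X a).dv + euler (simple i).dv (X b).dv := by
    rw [← map_sub, hKd', map_add]
  have hSa : euler (simple i).dv (X a).dv = -1 := by omega
  have hSb : euler (simple i).dv (X b).dv = -1 := by omega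
  have hYa' := homDim_sub_extDim hYf (hXf a)
  have hYb' := homDim_sub_extDim hYf (hXf b)
  -- By maximality of `Y` there is no extension of `X a` by `Y`: an indecomposable between them over
  -- which `Y → S(i)` factors would be bad as well.
  have haSx : ExtZero (X a) (simple i) := (extDim_eq_zero_iff (hXf a) hSf).1 (by omega)
  have haY : ExtZero (X a) Y := by
    by_contra h
    obtain ⟨E, hEf, hE, ⟨u, k', hk', hu⟩, r, hr⟩ :=
      exists_between_factoring (hXf a) hYf hYi h haSx k hk
    have hu0 : u ≠ 0 := by
      rintro rfl
      exact hk' (hom_ext fun v x => map_zero (k'.1 v))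
    have hk0 : k' ≠ 0 := by
      rintro rfl
      exact hk' rfl
    have hYE := hν Y E hYi hYf hE hEf u hu0 hu
    have hEZ : comp (subIncl (ker_stable g)) (comp (D.i a) r) ≠ 0 := fun h0 =>
      hr <| hom_ext fun v x => D.injective_i a v <| hι v <|
        (congrArg (fun l : Hom E Z => l.1 v x) h0).trans
          (by rw [hom_zero_apply, hom_zero_apply, map_zero, map_zero])
    obtain ⟨l, hl⟩ : ∃ l : Hom E Z, comp g l ≠ 0 := by
      by_contra! hl
      exact absurd (hmax E ⟨hE, hEf, ⟨k', hk0⟩, ⟨_, hEZ⟩, hl⟩) hYE.not_ge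
    obtain ⟨c, hc⟩ := (finrank_eq_one_iff_of_nonzero' (comp g l) hl).1
      (hom_S hE hEf k' hk0).1 k'
    refine hk' (hom_ext fun v x => ?_)
    have h1 := congrArg (fun m : Hom Y (simple i) => c • m.1 v x) (hgf (comp l u))
    rw [← hc]
    simpa using h1
  have haY' := homDim_sub_extDim (hXf a) hYf
  rw [(extDim_eq_zero_iff (hXf a) hYf).2 haY] at haY'
  -- Positivity at `Y - X a - S(i)` forces `⟨S(i), Y⟩ = -1`.
  have hne1 : Y.dv - (X a).dv - (simple i).dv ≠ 0 := fun h0 => by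
    have h1 : euler (Y.dv - (X a).dv - (simple i).dv) (X a).dv = 0 := by rw [h0]; simp
    simp only [map_sub, LinearMap.sub_apply] at h1
    omega
  have hpos1 := hq _ hne1
  simp only [map_sub, LinearMap.sub_apply] at hpos1
  have hx : euler (simple i).dv Y.dv = -1 := by omega
  -- `Y + X b + S(i)` is not a root, since `⟨·, S(i)⟩` takes the value `2` at it.
  have hbY : 1 ≤ euler (X b).dv Y.dv := by
    by_contra! h
    have hd : ((Y.prod (X b)).prod (simple i)).dv = Y.dv + (X b).dv + (simple i).dv := by
      rw [dv_prod (prod_finDim hYf (hXf b)) hSf, dv_prod hYf (hXf b)]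
    have hne : Y.dv + (X b).dv + (simple i).dv ≠ 0 := fun h0 => by
      have h1 : euler (Y.dv + (X b).dv + (simple i).dv) (simple i).dv = 0 := by rw [h0]; simp
      simp only [map_add, LinearMap.add_apply] at h1
      omega
    have hpos := hq _ hne
    have h3 := euler_simple_le_one hq hs i (prod_finDim (prod_finDim hYf (hXf b)) hSf)
    rw [hd] at h3
    simp only [map_add, LinearMap.add_apply] at hpos h3
    have := h3 (by omega)
    omega
  -- Positivity at `Y - Z` now shows that `Z` has no extensions by `Y`, so `f` is injective or
  -- surjective, and hence injective as `g f = 0`.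
  have hne2 : Y.dv - Z.dv ≠ 0 := fun h0 => by
    obtain ⟨e⟩ := exists_iso_of_dv_eq hq hYi hYf hZ hZf (sub_eq_zero.1 h0)
    exact hfb (bijective_of_iso hq hYi hYf hZ e f hf)
  have hpos2 := hq _ hne2
  have hZd : Z.dv = (X a).dv + (X b).dv + (simple i).dv := by
    rw [← hKd', sub_add_cancel]
  have hZY : euler Z.dv Y.dv = euler (X a).dv Y.dv + euler (X b).dv Y.dv + euler (simple i).dv Y.dv := by
    rw [hZd]
    simp only [map_add, LinearMap.add_apply]
  simp only [map_sub, LinearMap.sub_apply] at hpos2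
  have hZYh : homDim Z Y = 0 := (homDim_eq_zero_iff hZf hYf).2 fun l => by
    by_contra hl
    by_cases hlb : ∀ v, Function.Bijective (l.1 v)
    · exact hfb (bijective_of_iso hq hYi hYf hZ (isoOfBijective l hlb).symm f hf)
    · exact absurd (hν Z Y hZ hZf hYi hYf l hl hlb) hYZ.asymm
  have hZYx : ExtZero Z Y := by
    rw [← extDim_eq_zero_iff hZf hYf]
    have := homDim_sub_extDim hZf hYf
    omega
  have hinj : ∀ v, Function.Injective (f.1 v) := by
    refine (injective_or_surjective hq hYi hYf hZ hZf f hf hZYx).resolve_right fun hsf => ?_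
    refine hg (hom_ext fun v x => ?_)
    obtain ⟨y, rfl⟩ := hsf v x
    exact congrArg (fun k : Hom Y (simple i) => k.1 v y) (hgf f)
  -- But a nonzero homomorphism `X b → Y` composes with `f` to zero, because `Hom(Y, X b) = 0` and
  -- `Hom(X b, X a) = 0`.
  obtain ⟨j, hj⟩ : ∃ j : Hom (X b) Y, j ≠ 0 := by
    refine (homDim_pos_iff (hXf b) hYf).1 ?_
    have := homDim_sub_extDim (hXf b) hYf
    omega
  let f' : Hom Y K := subLift (ker_stable g) f fun v x =>
    congrArg (fun k : Hom Y (simple i) => k.1 v x) (hgf f)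
  have h1 : comp (D.p b) f' = 0 := (homDim_eq_zero_iff hYf (hXf b)).1 hYb _
  have h2 : comp (D.p a) (comp f' j) = 0 := (homDim_eq_zero_iff (hXf b) (hXf a)).1 hba _
  refine hj (hom_ext fun v x => hinj v ?_)
  have h3 : f'.1 v (j.1 v x) = 0 := by
    rw [← D.sum_i_p v (f'.1 v (j.1 v x)), huniv, Finset.sum_pair hab,
      show (D.p b).1 v (f'.1 v (j.1 v x)) = 0 from
        congrArg (fun l : Hom Y (X b) => l.1 v (j.1 v x)) h1,
      show (D.p a).1 v (f'.1 v (j.1 v x)) = 0 from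
        congrArg (fun l : Hom (X b) (X a) => l.1 v x) h2, map_zero, map_zero, add_zero]
  rw [hom_zero_apply, map_zero]
  exact congrArg Subtype.val h3

/-- For a special quiver, if `Y` and `Z` are indecomposables with nonzero homomorphisms `Y → Z`,
`Y → S(i)` and `g : Z → S(i)`, then some homomorphism `Y → Z` has nonzero composite with `g`. -/
theorem exists_comp_ne_zero (hq : EulerPosDef I) (hs : IsSpecialQuiver I) (i : I) {Y Z : QRep I}
    (hY : Y.Indecomposable) (hYf : Y.FinDim) (hZ : Z.Indecomposable) (hZf : Z.FinDim)
    (k : Hom Y (simple i)) (hk : k ≠ 0) (g : Hom Z (simple i)) (hg : g ≠ 0) (f : Hom Y Z)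
    (hf : f ≠ 0) : ∃ f : Hom Y Z, comp g f ≠ 0 := by
  obtain ⟨ν, hν⟩ := exists_height hq
  by_contra! h
  have hbdd : BddAbove (ν '' {Y | Bad i g Y}) := ⟨ν Z, by
    rintro _ ⟨Y, ⟨hY, hYf, -, ⟨f, hf⟩, hgf⟩, rfl⟩
    refine (hν Y Z hY hYf hZ hZf f hf fun hb => hg <| hom_ext fun v x => ?_).le
    obtain ⟨y, rfl⟩ := (hb v).2 x
    exact congrArg (fun k : Hom Y (simple i) => k.1 v y) (hgf f)⟩
  obtain ⟨Y', hY', hmax⟩ := Nat.sSup_mem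
    ((show {Y | Bad i g Y}.Nonempty from ⟨Y, hY, hYf, ⟨k, hk⟩, ⟨f, hf⟩, h⟩).image ν) hbdd
  exact not_bad_of_maximal hq hs i hν hZ hZf g hg hY' fun Y'' hY'' =>
    hmax ▸ le_csSup hbdd ⟨Y'', hY'', rfl⟩

end simple

end QRep

/-! ### The poset `𝒫_i(Q)` -/

section poset

variable {I : Type} [Quiver.{0} I]

theorem P.eq_of_iso {i : I} {B B' : P i} (e : QRep.Iso B.rep B'.rep) : B = B' := by
  refine Subtype.ext ?_
  rw [← B.1.out_eq, ← B'.1.out_eq]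
  exact Quotient.sound ⟨e⟩

theorem P.indecomposable {i : I} (B : P i) : B.rep.Indecomposable := B.2.2.1

theorem P.finDim {i : I} (B : P i) : B.rep.FinDim := B.2.1

variable [Fintype I] [∀ s t : I, Fintype (s ⟶ t)]

theorem P.exists_hom_simple {i : I} (B : P i) : ∃ k : QRep.Hom B.rep (QRep.simple i), k ≠ 0 :=
  (QRep.homDim_pos_iff B.finDim (QRep.simple_finDim i)).1 (Nat.pos_of_ne_zero B.2.2.2)

theorem P.finite (hq : EulerPosDef I) (i : I) : Finite (P i) := by
  have := (QRep.finite_roots hq).to_subtype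
  refine Finite.of_injective (fun B : P i => (⟨B.rep.dv, B.indecomposable.dv_mem_roots hq B.finDim⟩ :
    {x : I → ℤ | 0 ≤ x ∧ QRep.euler x x = 1})) fun B B' h => ?_
  obtain ⟨e⟩ := QRep.exists_iso_of_dv_eq hq B.indecomposable B.finDim B'.indecomposable B'.finDim
    (congrArg Subtype.val h)
  exact P.eq_of_iso e

/-- The relation `⊴` on `𝒫_i(Q)` is transitive since homomorphisms between elements of `𝒫_i(Q)` can
be chosen compatible with the homomorphisms to `S(i)`. -/
theorem P.isPartialOrder (hq : EulerPosDef I) (hs : IsSpecialQuiver I) (i : I) :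
    IsPartialOrder (P i) P.le where
  refl B := ⟨QRep.idHom B.rep, fun h => B.indecomposable.1 (QRep.isZero_iff_idHom.2 h)⟩
  trans B B' B'' := by
    rintro ⟨f, hf⟩ ⟨f', hf'⟩
    obtain ⟨k, hk⟩ := B.exists_hom_simple
    obtain ⟨k', hk'⟩ := B'.exists_hom_simple
    obtain ⟨k'', hk''⟩ := B''.exists_hom_simple
    obtain ⟨g', hg'⟩ := QRep.exists_comp_ne_zero hq hs i B'.indecomposable B'.finDim
      B''.indecomposable B''.finDim k' hk' k'' hk'' f' hf'
    obtain ⟨g, hg⟩ := QRep.exists_comp_ne_zero hq hs i B.indecomposable B.finDim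
      B'.indecomposable B'.finDim k hk _ hg' f hf
    refine ⟨QRep.comp g' g, fun h => hg (QRep.hom_ext fun v x => ?_)⟩
    have := congrArg (fun l : QRep.Hom B.rep B''.rep => k''.1 v (l.1 v x)) h
    simpa using this
  antisymm B B' := by
    rintro ⟨f, hf⟩ ⟨g, hg⟩
    obtain ⟨ν, hν⟩ := QRep.exists_height hq
    by_cases hf' : ∀ v, Function.Bijective (f.1 v)
    · exact P.eq_of_iso (QRep.isoOfBijective f hf')
    by_cases hg' : ∀ v, Function.Bijective (g.1 v)
    · exact (P.eq_of_iso (QRep.isoOfBijective g hg')).symm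
    exact absurd (hν _ _ B.indecomposable B.finDim B'.indecomposable B'.finDim f hf hf')
      (hν _ _ B'.indecomposable B'.finDim B.indecomposable B.finDim g hg hg').asymm

end poset

/-! ### The order on the vertices of `𝒫_M^∞` -/

section vert

variable {I : Type} [Quiver.{0} I] [Fintype I] [∀ s t : I, Fintype (s ⟶ t)] {i : I} {M : QRep I}

/-- The vertices of `𝒫_M^∞` as the points of the chains and the point `v_∞`. -/
def vertEquiv (i : I) (M : QRep I) : Vert i M ≃ Option (Σ B : P i, Fin (chainLength i M B)) where
  toFun v := match v with
    | .copy B n => some ⟨B, n⟩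
    | .infty => none
  invFun x := match x with
    | some ⟨B, n⟩ => .copy B n
    | none => .infty
  left_inv v := by cases v <;> rfl
  right_inv x := by rcases x with _ | ⟨B, n⟩ <;> rfl

theorem chainLength_pos (B : P i) : 0 < chainLength i M B := by simp [chainLength]

namespace Vert

theorem le_refl (v : Vert i M) : v.le v := .refl

theorem le_trans {u v w : Vert i M} (h : u.le v) (h' : v.le w) : u.le w := .trans h h'

theorem infty_le {v : Vert i M} (h : (Vert.infty : Vert i M).le v) : v = .infty := by
  rcases h.cases_head with h | ⟨u, hu, -⟩
  · exact h.symm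
  · exact hu.elim

theorem _root_.QuiverCrystal.P.lt_of_lt_of_le (hP : IsPartialOrder (P i) P.le) {B B' B'' : P i} (h : B.lt B') (h' : B'.le B'') :
    B.lt B'' := by
  refine ⟨hP.trans _ _ _ h.1 h', ?_⟩
  rintro rfl
  exact h.2 (hP.antisymm _ _ h.1 h')

/-- Paths in `𝒫_M^∞` between points of chains. -/
theorem of_copy_le (hP : IsPartialOrder (P i) P.le) {B B' : P i} {m : Fin (chainLength i M B)} {n : Fin (chainLength i M B')}
    (h : (Vert.copy B m).le (.copy B' n)) : B.lt B' ∨ B = B' ∧ (m : ℕ) ≤ n := by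
  have key : ∀ v : Vert i M, (Vert.copy B m).le v → ∀ B' n, v = .copy B' n →
      B.lt B' ∨ B = B' ∧ (m : ℕ) ≤ n := by
    intro v h
    induction h with
    | refl =>
      rintro B' n h
      cases h
      exact .inr ⟨rfl, le_rfl⟩
    | @tail u w _ huw ih =>
      rintro B'' n rfl
      cases u with
      | infty => exact huw.elim
      | copy B' k =>
        have h1 := ih B' k rfl
        rcases huw with ⟨rfl, h2⟩ | ⟨h2, -, -⟩
        · rcases h1 with h1 | ⟨rfl, h1⟩
          · exact .inl h1
          · exact .inr ⟨rfl, by omega⟩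
        · rcases h1 with h1 | ⟨rfl, -⟩
          · exact .inl (P.lt_of_lt_of_le hP h1 h2.1.1)
          · exact .inl h2.1
  exact key _ h B' n rfl

theorem copy_le_copy {B : P i} {m n : Fin (chainLength i M B)} (h : (m : ℕ) ≤ n) :
    (Vert.copy B m).le (.copy B n) := by
  obtain ⟨n, hn⟩ := n
  induction n with
  | zero =>
    have : m = ⟨0, hn⟩ := Fin.ext (by simpa using h)
    rw [this]
    exact le_refl _
  | succ n ih =>
    rcases Nat.lt_or_ge (m : ℕ) (n + 1) with h1 | h1
    · exact .tail (ih (by omega) (Nat.le_of_lt_succ h1)) (.inl ⟨rfl, rfl⟩)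
    · have : m = ⟨n + 1, hn⟩ := Fin.ext (Nat.le_antisymm h h1)
      rw [this]
      exact le_refl _

theorem last_le_of_arrow {B : P i} {v : Vert i M} (m : Fin (chainLength i M B))
    (h : ∀ n : Fin (chainLength i M B), (n : ℕ) + 1 = chainLength i M B →
      Vert.arrow (.copy B n) v) : (Vert.copy B m).le v := by
  have hm := m.2
  refine le_trans (copy_le_copy (n := ⟨chainLength i M B - 1, by omega⟩) ?_) (.single (h _ ?_)) <;>
  · simp only
    omega

theorem copy_le_of_lt [Finite (P i)] (hP : IsPartialOrder (P i) P.le) {B B' : P i} (h : B.lt B')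
    (m : Fin (chainLength i M B)) (n : Fin (chainLength i M B')) :
    (Vert.copy B m).le (.copy B' n) := by
  have : IsTrans (P i) P.lt := ⟨fun A B C h h' => P.lt_of_lt_of_le hP h h'.1⟩
  have : IsTrans (P i) fun C B : P i => B.lt C :=
    ⟨fun A B C h h' => P.lt_of_lt_of_le hP h' h.1⟩
  have : Std.Irrefl fun C B : P i => B.lt C := ⟨fun B h => h.2 rfl⟩
  have : Std.Irrefl (P.lt (i := i)) := ⟨fun B h => h.2 rfl⟩
  have hwf : WellFounded (P.lt (i := i)) := Finite.wellFounded_of_trans_of_irrefl _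
  have hwf' : WellFounded fun C B : P i => B.lt C := Finite.wellFounded_of_trans_of_irrefl _
  induction B using hwf'.induction with
  | _ B ih =>
  -- a minimal element above `B` and below `B'` covers `B`
  obtain ⟨C, ⟨hC, hCB'⟩, hmin⟩ :=
    hwf.has_min {C | B.lt C ∧ C.le B'} ⟨B', h, hP.refl B'⟩
  have hBC : B.covers C := ⟨hC, fun ⟨E, hE, hE'⟩ =>
    hmin E ⟨hE, hP.trans _ _ _ hE'.1 hCB'⟩ hE'⟩
  have h1 : (Vert.copy B m).le (.copy C ⟨0, chainLength_pos C⟩) :=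
    last_le_of_arrow m fun n hn => Or.inr ⟨hBC, hn, rfl⟩
  refine le_trans h1 ?_
  by_cases hCB : C = B'
  · subst hCB
    exact copy_le_copy (Nat.zero_le _)
  · exact ih C hC ⟨hCB', hCB⟩ _

theorem le_infty [Finite (P i)] (hP : IsPartialOrder (P i) P.le) (v : Vert i M) :
    v.le .infty := by
  cases v with
  | infty => exact le_refl _
  | copy B m =>
    have : IsTrans (P i) fun C B : P i => B.lt C :=
      ⟨fun A B C h h' => P.lt_of_lt_of_le hP h' h.1⟩
    have : Std.Irrefl fun C B : P i => B.lt C := ⟨fun B h => h.2 rfl⟩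
    have hwf : WellFounded fun C B : P i => B.lt C := Finite.wellFounded_of_trans_of_irrefl _
    obtain ⟨C, hBC, hmax⟩ := hwf.has_min {C | B.le C} ⟨B, hP.refl B⟩
    have hC : C.isMaximal := fun E hE => by
      by_contra hne
      exact hmax E (hP.trans _ _ _ hBC hE) ⟨hE, fun h => hne h.symm⟩
    have h1 : ∀ n, (Vert.copy C n : Vert i M).le .infty := fun n =>
      last_le_of_arrow n fun n hn => ⟨hC, hn⟩
    by_cases hCB : B = C
    · subst hCB
      exact h1 m
    · exact le_trans (copy_le_of_lt hP ⟨hBC, hCB⟩ m ⟨0, chainLength_pos C⟩) (h1 _)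

end Vert

theorem Vert.finite [Finite (P i)] : Finite (Vert i M) :=
  Finite.of_equiv _ (vertEquiv i M).symm

end vert

section closure

variable {I : Type} [Quiver.{0} I] [Fintype I] [∀ s t : I, Fintype (s ⟶ t)] {i : I} {M : QRep I}

/-! ### The closure operator -/

theorem infty_notMem_white : (Vert.infty : Vert i M) ∉ white i M := by
  rintro ⟨B, n, h, -⟩
  cases h

theorem IsMor.map_infty {W₁ W₂ : Set (Vert i M)} {f : Vert i M → Vert i M} (hf : IsMor W₁ W₂ f) :
    f .infty = .infty := Vert.infty_le (hf.2.1 _ (Set.mem_insert _ _))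

theorem subset_stepOp (f : Vert i M → Vert i M) (V : Set (Vert i M)) : V ⊆ stepOp f V :=
  fun v hv => ⟨v, .inr hv, Vert.le_refl v⟩

/-- A set of vertices that is a lower set and stable under `f`. -/
structure Closed (f : Vert i M → Vert i M) (D : Set (Vert i M)) : Prop where
  lower : ∀ {v w}, v.le w → w ∈ D → v ∈ D
  map_mem : ∀ {r}, r ∈ red i M → r ∈ D → f r ∈ D

theorem stepOp_subset {f : Vert i M → Vert i M} {D V : Set (Vert i M)} (hD : Closed f D)
    (h : V ⊆ D) : stepOp f V ⊆ D := by
  rintro v ⟨w, hw | hw, hvw⟩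
  · obtain ⟨r, ⟨hr, ⟨u, hu, hru⟩⟩, rfl⟩ := hw
    exact hD.lower hvw (hD.map_mem hr (hD.lower hru (h hu)))
  · exact hD.lower hvw (h hw)

theorem iterate_stepOp_subset {f : Vert i M → Vert i M} {D V : Set (Vert i M)} (hD : Closed f D)
    (h : V ⊆ D) (k : ℕ) : (stepOp f)^[k] V ⊆ D := by
  induction k with
  | zero => exact h
  | succ k ih =>
    rw [Function.iterate_succ_apply']
    exact stepOp_subset hD ih

theorem subset_iterate_stepOp (f : Vert i M → Vert i M) (V : Set (Vert i M)) (k : ℕ) :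
    V ⊆ (stepOp f)^[k] V := by
  induction k with
  | zero => exact le_rfl
  | succ k ih =>
    rw [Function.iterate_succ_apply']
    exact ih.trans (subset_stepOp f _)

theorem exists_iterate_eq [Finite (P i)] (f : Vert i M → Vert i M) (V : Set (Vert i M)) :
    ∃ k, (stepOp f)^[k] V = (stepOp f)^[k + 1] V := by
  have : Finite (Vert i M) := Vert.finite
  have hmono : Monotone fun k => (stepOp f)^[k] V := monotone_nat_of_le_succ fun k => by
    rw [Function.iterate_succ_apply']
    exact subset_stepOp f _
  obtain ⟨k, hk⟩ := WellFoundedGT.monotone_chain_condition ⟨_, hmono⟩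
  exact ⟨k, hk (k + 1) (Nat.le_succ k)⟩

/-- `hull f` is a fixed point of the operator `Φ`. -/
theorem stepOp_hull [Finite (P i)] (f : Vert i M → Vert i M) : stepOp f (hull f) = hull f := by
  have h := Nat.sInf_mem (exists_iterate_eq f (white i M \ f '' red i M))
  exact (h.trans (Function.iterate_succ_apply' _ _ _)).symm

theorem hull_closed [Finite (P i)] (f : Vert i M → Vert i M) : Closed f (hull f) where
  lower {v w} h hw := by
    rw [← stepOp_hull]
    exact ⟨w, .inr hw, h⟩
  map_mem {r} hr h := by
    rw [← stepOp_hull]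
    exact ⟨f r, .inl ⟨r, ⟨hr, r, h, Vert.le_refl r⟩, rfl⟩, Vert.le_refl _⟩

theorem subset_hull (f : Vert i M → Vert i M) : white i M \ f '' red i M ⊆ hull f :=
  subset_iterate_stepOp f _ _

theorem hull_subset {f : Vert i M → Vert i M} {D : Set (Vert i M)} (hD : Closed f D)
    (h : white i M \ f '' red i M ⊆ D) : hull f ⊆ D := iterate_stepOp_subset hD h _

/-! ### Augmenting chains -/

/-- The list `r₁, …, r_n` of red vertices is an alternating chain
`w ⊵ r₁, f(r₁) ⊵ r₂, …, f(r_n) = v_∞`. -/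
def IsAugmenting (f : Vert i M → Vert i M) : Vert i M → List (Vert i M) → Prop
  | w, [] => w = .infty
  | w, r :: l => r ∈ red i M ∧ r.le w ∧ IsAugmenting f (f r) l

theorem IsAugmenting.drop {f : Vert i M → Vert i M} {r : Vert i M} (l l' : List (Vert i M))
    {w : Vert i M} (h : IsAugmenting f w (l ++ r :: l')) : IsAugmenting f (f r) l' := by
  induction l generalizing w with
  | nil => exact h.2.2
  | cons r' l ih => exact ih h.2.2

theorem IsAugmenting.congr {f g : Vert i M → Vert i M} {w : Vert i M} {l : List (Vert i M)}
    (h : IsAugmenting f w l) (hfg : ∀ r ∈ l, f r = g r) : IsAugmenting g w l := by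
  induction l generalizing w with
  | nil => exact h
  | cons r l ih =>
    have h1 := ih h.2.2 fun r' hr' => hfg r' (List.mem_cons_of_mem r hr')
    rw [hfg r List.mem_cons_self] at h1
    exact ⟨h.1, h.2.1, h1⟩

open Classical in
/-- Redirecting a red vertex to a white vertex outside of the image of `f`. -/
theorem IsMor.update {f : Vert i M → Vert i M} (hf : IsMor (red i M) (white i M) f)
    {r w : Vert i M} (hr : r ∈ red i M) (hw : w ∈ white i M \ f '' red i M) (hrw : r.le w) :
    IsMor (red i M) (white i M) (Function.update f r w) := by
  refine ⟨fun v hv => ?_, fun v hv => ?_, ?_⟩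
  · by_cases h : v = r
    · subst h
      rw [Function.update_self]
      exact .inr hw.1
    · rw [Function.update_of_ne h]
      exact hf.1 hv
  · by_cases h : v = r
    · subst h
      rwa [Function.update_self]
    · rw [Function.update_of_ne h]
      exact hf.2.1 v hv
  · rintro v ⟨hv, hv'⟩ v' ⟨hv1, hv1'⟩ hvv'
    by_cases h : v = r
    · by_cases h' : v' = r
      · rw [h, h']
      · rw [h, Function.update_self, Function.update_of_ne h'] at hvv'
        exact absurd ⟨v', hv1, hvv'.symm⟩ hw.2
    · by_cases h' : v' = r
      · rw [h', Function.update_self, Function.update_of_ne h] at hvv'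
        exact absurd ⟨v, hv, hvv'⟩ hw.2
      · rw [Function.update_of_ne h, Function.update_of_ne h'] at hvv'
        rw [Function.update_of_ne h] at hv'
        rw [Function.update_of_ne h'] at hv1'
        exact hf.2.2 ⟨hv, hv'⟩ ⟨hv1, hv1'⟩ hvv'

open Classical in
theorem image_update {f : Vert i M → Vert i M} (hf : IsMor (red i M) (white i M) f)
    {r w : Vert i M} (hr : r ∈ red i M) (hw : w ∈ white i M) :
    (Function.update f r w '' red i M) \ {.infty} =
      insert w ((f '' red i M) \ {.infty, f r}) := by
  ext v
  simp only [Set.mem_sdiff, Set.mem_image, Set.mem_singleton_iff, Set.mem_insert_iff, not_or]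
  constructor
  · rintro ⟨⟨s, hs, rfl⟩, hv⟩
    by_cases h : s = r
    · subst h
      exact .inl (Function.update_self _ _ _)
    · rw [Function.update_of_ne h] at hv ⊢
      refine .inr ⟨⟨s, hs, rfl⟩, hv, fun h' => h (hf.2.2 ⟨hs, hv⟩ ⟨hr, ?_⟩ h')⟩
      rwa [← h']
  · rintro (rfl | ⟨⟨s, hs, rfl⟩, hv, hv'⟩)
    · exact ⟨⟨r, hr, Function.update_self _ _ _⟩, fun h => infty_notMem_white (h ▸ hw)⟩
    · have h : s ≠ r := by
        rintro rfl
        exact hv' rfl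
      exact ⟨⟨s, hs, Function.update_of_ne h _ _⟩, hv⟩

/-- Along an augmenting chain that starts in a white vertex `w` outside of the image of `f`, the
morphism `f` can be changed to one whose image also contains `w`. -/
theorem exists_augmented {f : Vert i M → Vert i M} (hf : IsMor (red i M) (white i M) f)
    {w : Vert i M} (hw : w ∈ white i M \ f '' red i M) {l : List (Vert i M)}
    (hl : IsAugmenting f w l) : ∃ g, IsMor (red i M) (white i M) g ∧
      (g '' red i M) \ {.infty} = insert w ((f '' red i M) \ {.infty}) := by
  classical
  induction hn : l.length using Nat.strong_induction_on generalizing f w l with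
  | _ n ih =>
  subst hn
  cases l with
  | nil => exact absurd (hl ▸ hw.1) infty_notMem_white
  | cons r l =>
    obtain ⟨hr, hrw, hl⟩ := hl
    by_cases hrl : r ∈ l
    · -- a repetition gives a shorter chain
      obtain ⟨l₁, l₂, rfl⟩ := List.append_of_mem hrl
      refine ih (r :: l₂).length ?_ hf hw (l := r :: l₂) ⟨hr, hrw, hl.drop⟩ rfl
      simp only [List.length_cons, List.length_append]
      omega
    · have hg := hf.update hr hw hrw
      have hgi := image_update hf hr hw.1
      by_cases hfr : f r = .infty
      · refine ⟨_, hg, ?_⟩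
        rw [hgi, hfr, Set.pair_eq_singleton]
      · have hfrw : f r ∈ white i M := (hf.1 (.inr hr)).resolve_left hfr
        have hfr' : f r ∉ Function.update f r w '' red i M := fun h => by
          have h1 : f r ∈ (Function.update f r w '' red i M) \ {.infty} := ⟨h, hfr⟩
          rw [hgi] at h1
          rcases h1 with h1 | h1
          · exact hw.2 ⟨r, hr, h1⟩
          · exact h1.2 (.inr rfl)
        obtain ⟨g, hg', hgi'⟩ := ih l.length (Nat.lt_succ_self _) hg ⟨hfrw, hfr'⟩
          (hl.congr fun s hs => (Function.update_of_ne (fun h : s = r => hrl (h ▸ hs)) _ _).symm) rfl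
        refine ⟨g, hg', ?_⟩
        rw [hgi', hgi, Set.insert_comm]
        congr 1
        ext v
        simp only [Set.mem_insert_iff, Set.mem_sdiff, Set.mem_singleton_iff, not_or]
        constructor
        · rintro (rfl | h)
          · exact ⟨⟨r, hr, rfl⟩, hfr⟩
          · exact ⟨h.1, h.2.1⟩
        · intro h
          by_cases h' : v = f r
          · exact .inl h'
          · exact .inr ⟨h.1, h.2, h'⟩

/-- If `v_∞` is in the closure of the set of white vertices outside of the image of `f`, then there
is an augmenting chain. -/
theorem exists_isAugmenting [Finite (P i)] {f : Vert i M → Vert i M}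
    (h : Vert.infty ∈ hull f) :
    ∃ w ∈ white i M \ f '' red i M, ∃ l, IsAugmenting f w l := by
  let step : Vert i M → Vert i M → Prop := fun u u' => ∃ r ∈ red i M, r.le u ∧ u' = f r
  let D : Set (Vert i M) := {v | ∃ w ∈ white i M \ f '' red i M, ∃ u,
    Relation.ReflTransGen step w u ∧ v.le u}
  have hD : Closed f D :=
    { lower := fun hvw ⟨w, hw, u, hwu, hu⟩ => ⟨w, hw, u, hwu, Vert.le_trans hvw hu⟩
      map_mem := fun hr ⟨w, hw, u, hwu, hu⟩ =>
        ⟨w, hw, _, hwu.tail ⟨_, hr, hu, rfl⟩, Vert.le_refl _⟩ }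
  obtain ⟨w, hw, u, hwu, hu⟩ := hull_subset hD (fun w hw => ⟨w, hw, w, .refl, Vert.le_refl w⟩) h
  rw [Vert.infty_le hu] at hwu
  refine ⟨w, hw, ?_⟩
  clear hw
  induction hwu using Relation.ReflTransGen.head_induction_on with
  | refl => exact ⟨[], rfl⟩
  | head h _ ih =>
    obtain ⟨r, hr, hru, rfl⟩ := h
    obtain ⟨l, hl⟩ := ih
    exact ⟨r :: l, hr, hru, hl⟩

/-- For `⪯`-minimal `f` there is no augmenting chain, since the augmented morphism would be strictly
smaller. -/
theorem infty_notMem_hull [Finite (P i)] (hP : IsPartialOrder (P i) P.le)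
    {f : Vert i M → Vert i M} (hf : IsPrecMinimal f) : Vert.infty ∉ hull f := by
  classical
  have : Finite (Vert i M) := Vert.finite
  intro h
  obtain ⟨w, hw, l, hl⟩ := exists_isAugmenting h
  have hinf : (Vert.infty : Vert i M) ∈ f '' red i M := by
    have key : ∀ (l : List (Vert i M)) (w : Vert i M), w ≠ .infty → IsAugmenting f w l →
        (Vert.infty : Vert i M) ∈ f '' red i M := fun l => by
      induction l with
      | nil => exact fun w hw h => absurd h hw
      | cons r l ih =>
        rintro w hw ⟨hr, -, h⟩
        by_cases hfr : f r = .infty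
        · exact ⟨r, hr, hfr⟩
        · exact ih _ hfr h
    exact key l w (fun h => infty_notMem_white (h ▸ hw.1)) hl
  obtain ⟨g, hg, hgi⟩ := exists_augmented hf.1 hw hl
  have hgf : precLe g f := by
    refine ⟨fun v => if v = w then .infty else v, ⟨fun v hv => ?_, fun v _ => ?_, ?_⟩, ?_⟩
    · by_cases h : v = w
      · exact .inl (if_pos h)
      · simpa only [if_neg h] using hv
    · by_cases h : v = w
      · simpa only [if_pos h] using Vert.le_infty hP v
      · simpa only [if_neg h] using Vert.le_refl v
    · rintro v ⟨-, hv⟩ v' ⟨-, hv'⟩ hvv'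
      by_cases h : v = w
      · exact absurd (if_pos h) hv
      · by_cases h' : v' = w
        · exact absurd (if_pos h') hv'
        · simpa only [if_neg h, if_neg h'] using hvv'
    · have hgi' := fun v => Set.ext_iff.1 hgi v
      simp only [Set.mem_sdiff, Set.mem_singleton_iff, Set.mem_insert_iff] at hgi'
      ext v
      constructor
      · intro hv
        by_cases h : v = .infty
        · exact ⟨w, ((hgi' w).2 (.inl rfl)).1, (if_pos rfl).trans h.symm⟩
        · refine ⟨v, ((hgi' v).2 (.inr ⟨hv, h⟩)).1, if_neg ?_⟩
          rintro rfl
          exact hw.2 hv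
      · rintro ⟨u, hu, rfl⟩
        by_cases h : u = w
        · simpa only [if_pos h] using hinf
        · simp only [if_neg h]
          by_cases h' : u = .infty
          · rwa [h']
          · exact (((hgi' u).1 ⟨hu, h'⟩).resolve_left h).1
  obtain ⟨ρ, hρ, hρi⟩ := hf.2 g hg hgf
  have h1 : (g '' red i M) \ {.infty} ⊆ ρ '' ((f '' red i M) \ {.infty}) := by
    rintro v ⟨hv, hv'⟩
    rw [hρi] at hv
    obtain ⟨u, hu, rfl⟩ := hv
    refine ⟨u, ⟨hu, ?_⟩, rfl⟩
    rintro rfl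
    exact hv' hρ.map_infty
  have h2 := (Set.ncard_le_ncard h1 (Set.toFinite _)).trans (Set.ncard_image_le (Set.toFinite _))
  rw [hgi, Set.ncard_insert_of_notMem (fun h => hw.2 h.1) (Set.toFinite _)] at h2
  omega

end closure

section excess

variable {I : Type} [Quiver.{0} I] [Fintype I] [∀ s t : I, Fintype (s ⟶ t)] {i : I} {M : QRep I}

/-! ### Maximizing `F_i(M, V)` -/

/-- The number of white minus the number of red vertices in a set. -/
def excess (D : Set (Vert i M)) : ℤ := (white i M ∩ D).ncard - (red i M ∩ D).ncard

/-- Lower sets that do not contain `v_∞`. -/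
structure IsFiniteLower (D : Set (Vert i M)) : Prop where
  lower : ∀ {v w : Vert i M}, v.le w → w ∈ D → v ∈ D
  infty_notMem : Vert.infty ∉ D

theorem excess_union [Finite (P i)] {D C : Set (Vert i M)} (h : Disjoint D C) :
    excess (D ∪ C) = excess D + excess C := by
  have : Finite (Vert i M) := Vert.finite
  simp only [excess, Set.inter_union_distrib_left]
  rw [Set.ncard_union_eq (h.mono Set.inter_subset_right Set.inter_subset_right),
    Set.ncard_union_eq (h.mono Set.inter_subset_right Set.inter_subset_right)]
  push_cast
  ring

/-- In a lower set, a morphism `f` cancels the red vertices against white ones, except for those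
that `f` maps out of the set. -/
theorem excess_eq [Finite (P i)] {f : Vert i M → Vert i M}
    (hf : IsMor (red i M) (white i M) f) {D : Set (Vert i M)} (hD : IsFiniteLower D) :
    excess D = ((white i M ∩ D) \ f '' red i M).ncard - ((red i M ∩ D) \ f ⁻¹' D).ncard := by
  have : Finite (Vert i M) := Vert.finite
  have h1 := Set.ncard_inter_add_ncard_sdiff_eq_ncard (white i M ∩ D) (f '' red i M)
    (Set.toFinite _)
  have h2 := Set.ncard_inter_add_ncard_sdiff_eq_ncard (red i M ∩ D) (f ⁻¹' D) (Set.toFinite _)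
  have h3 : white i M ∩ D ∩ f '' red i M = f '' (red i M ∩ D ∩ f ⁻¹' D) := by
    ext v
    constructor
    · rintro ⟨⟨hv, hvD⟩, r, hr, rfl⟩
      exact ⟨r, ⟨⟨hr, hD.lower (hf.2.1 r (.inr hr)) hvD⟩, hvD⟩, rfl⟩
    · rintro ⟨r, ⟨⟨hr, -⟩, hrD⟩, rfl⟩
      refine ⟨⟨(hf.1 (.inr hr)).resolve_left fun h => ?_, hrD⟩, r, hr, rfl⟩
      exact hD.infty_notMem (h ▸ hrD)
  have h4 : (white i M ∩ D ∩ f '' red i M).ncard = (red i M ∩ D ∩ f ⁻¹' D).ncard := by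
    rw [h3]
    refine Set.InjOn.ncard_image (hf.2.2.mono ?_)
    rintro r ⟨⟨hr, -⟩, hrD⟩
    exact ⟨hr, fun h => hD.infty_notMem (h ▸ hrD)⟩
  rw [excess]
  omega

theorem excess_le [Finite (P i)] {f : Vert i M → Vert i M}
    (hf : IsMor (red i M) (white i M) f) {D : Set (Vert i M)} (hD : IsFiniteLower D) :
    excess D ≤ (white i M \ f '' red i M).ncard := by
  have : Finite (Vert i M) := Vert.finite
  rw [excess_eq hf hD]
  have h1 : ((white i M ∩ D) \ f '' red i M).ncard ≤ (white i M \ f '' red i M).ncard :=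
    Set.ncard_le_ncard (Set.sdiff_subset_sdiff_left Set.inter_subset_left) (Set.toFinite _)
  omega

theorem excess_hull [Finite (P i)] {f : Vert i M → Vert i M}
    (hf : IsMor (red i M) (white i M) f) (h : Vert.infty ∉ hull f) :
    excess (hull f) = (white i M \ f '' red i M).ncard := by
  rw [excess_eq hf ⟨(hull_closed f).lower, h⟩]
  have h1 : (white i M ∩ hull f) \ f '' red i M = white i M \ f '' red i M := by
    ext v
    exact ⟨fun hv => ⟨hv.1.1, hv.2⟩, fun hv => ⟨⟨hv.1, subset_hull f hv⟩, hv.2⟩⟩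
  have h2 : (red i M ∩ hull f) \ f ⁻¹' hull f = ∅ :=
    Set.sdiff_eq_empty.2 fun r hr => (hull_closed f).map_mem hr.1 hr.2
  rw [h1, h2, Set.ncard_empty, Nat.cast_zero, sub_zero]

/-- `hull f` is the least lower set of maximal excess. -/
theorem hull_subset_of_excess [Finite (P i)] {f : Vert i M → Vert i M}
    (hf : IsMor (red i M) (white i M) f) {D : Set (Vert i M)} (hD : IsFiniteLower D)
    (h : ((white i M \ f '' red i M).ncard : ℤ) ≤ excess D) : hull f ⊆ D := by
  have : Finite (Vert i M) := Vert.finite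
  rw [excess_eq hf hD] at h
  have hs : (white i M ∩ D) \ f '' red i M ⊆ white i M \ f '' red i M :=
    Set.sdiff_subset_sdiff_left Set.inter_subset_left
  have h1 := Set.ncard_le_ncard hs (Set.toFinite _)
  have h2 : (red i M ∩ D) \ f ⁻¹' D = ∅ := (Set.ncard_eq_zero (Set.toFinite _)).1 (by omega)
  have h3 := Set.eq_of_subset_of_ncard_le hs (by omega) (Set.toFinite _)
  refine hull_subset ⟨hD.lower, fun hr hrD => Set.sdiff_eq_empty.1 h2 ⟨hr, hrD⟩⟩ ?_
  rw [← h3]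
  exact fun v hv => hv.1.2

/-- The lower set of vertices given by an element of `𝒮_i(Q)`. -/
def fullDown (M : QRep I) (V : Set (P i)) : Set (Vert i M) := {v | ∃ B n, v = .copy B n ∧ B.leS V}

theorem fullDown_isFiniteLower (hP : IsPartialOrder (P i) P.le) (V : Set (P i)) :
    IsFiniteLower (fullDown M V) where
  lower {v w} h := by
    rintro ⟨B', n, rfl, B'', hB'', h'⟩
    cases v with
    | infty => cases Vert.infty_le h
    | copy B m =>
      rcases Vert.of_copy_le hP h with h1 | ⟨rfl, -⟩
      · exact ⟨B, m, rfl, B'', hB'', hP.trans _ _ _ h1.1 h'⟩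
      · exact ⟨B, m, rfl, B'', hB'', h'⟩
  infty_notMem := by
    rintro ⟨B, n, h, -⟩
    cases h

theorem ncard_copies [Finite (P i)] (p : P i → Prop) (c : P i → ℕ)
    (hc : ∀ B, c B ≤ chainLength i M B) :
    ({v : Vert i M | ∃ B n, v = .copy B n ∧ (n : ℕ) < c B} ∩
      {v | ∃ B n, v = .copy B n ∧ p B}).ncard = ∑ᶠ (B : P i) (_ : p B), c B := by
  classical
  have := Fintype.ofFinite (P i)
  have h1 : ∑ᶠ (B : P i) (_ : p B), c B = ∑ B : {B // p B}, c B := by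
    rw [← finsum_eq_sum_of_fintype]
    exact (finsum_set_coe_eq_finsum_mem (f := c) {B | p B}).symm
  have h2 : ∑ B : {B // p B}, c B = Nat.card (Σ B : {B // p B}, Fin (c B)) := by
    rw [Nat.card_sigma]
    simp
  rw [h1, h2, ← Nat.card_coe_set_eq]
  refine (Nat.card_congr (Equiv.ofBijective
    (fun x : Σ B : {B // p B}, Fin (c B) => ⟨.copy x.1.1 ⟨x.2, x.2.2.trans_le (hc _)⟩,
      ⟨_, _, rfl, x.2.2⟩, ⟨_, _, rfl, x.1.2⟩⟩) ⟨?_, ?_⟩)).symm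
  · rintro ⟨⟨B, hB⟩, m⟩ ⟨⟨B', hB'⟩, n⟩ h
    have h := congrArg Subtype.val h
    simp only [Vert.copy.injEq] at h
    obtain ⟨rfl, h⟩ := h
    simp only [heq_eq_eq, Fin.mk.injEq] at h
    rw [Fin.ext h]
  · rintro ⟨v, ⟨B, n, rfl, hn⟩, ⟨B', n', h, hB⟩⟩
    cases h
    exact ⟨⟨⟨B, hB⟩, ⟨n, hn⟩⟩, rfl⟩

/-- The formula `μ_{τB}(M) = μ_B(τ⁻¹M)` turns `F_i(M, V)` into a count of vertices. -/
theorem F_eq_excess (hq : EulerPosDef I) (hM : M.FinDim) (V : Set (P i)) :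
    F i M V = excess (fullDown M V) := by
  have := P.finite hq i
  have h1 := ncard_copies (i := i) (M := M) (fun B => B.leS V) (fun B => B.rep.mult M)
    fun B => le_max_of_le_right (le_max_left _ _)
  have h2 := ncard_copies (i := i) (M := M) (fun B => B.leS V) (fun B => B.rep.mult M.tauInv)
    fun B => le_max_of_le_right (le_max_right _ _)
  have h3 : ∀ (p : P i → Prop) (c : P i → ℕ), ((∑ᶠ (B : P i) (_ : p B), c B : ℕ) : ℤ) =
      ∑ᶠ (B : P i) (_ : p B), (c B : ℤ) := fun p c => by
    classical
    have := Fintype.ofFinite (P i)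
    simp only [finsum_eq_sum_of_fintype, finsum_eq_if]
    push_cast
    rfl
  rw [excess, white, red, fullDown, h1, h2, h3, h3, F]
  have h4 : ∀ B : P i, (B.rep.tau.mult M : ℤ) = B.rep.mult M.tauInv := fun B => by
    rw [QRep.mult_tau hq B.indecomposable B.finDim hM]
  simp only [h4]
  exact finsum_mem_sub_distrib (s := {B : P i | B.leS V}) _ _ (Set.toFinite _)

/-- The least lower set of maximal excess is a union of full chains: if it contained only part of
a chain, then removing or completing this part would increase the excess. -/
theorem hull_full [Finite (P i)] (hP : IsPartialOrder (P i) P.le) {f : Vert i M → Vert i M}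
    (hf : IsMor (red i M) (white i M) f) (h : Vert.infty ∉ hull f) {B : P i}
    {n : Fin (chainLength i M B)} (hn : Vert.copy B n ∈ hull f) (n' : Fin (chainLength i M B)) :
    Vert.copy B n' ∈ hull f := by
  have : Finite (Vert i M) := Vert.finite
  by_contra hn'
  have hlow := fun {v w} => (hull_closed f).lower (v := v) (w := w)
  let chain : Set (Vert i M) := {v | ∃ m, v = .copy B m}
  -- `B` is maximal among the chains that meet the hull
  have hmax : ∀ (B' : P i) (m : Fin (chainLength i M B')), B.lt B' →
      Vert.copy B' m ∉ hull f := fun B' m hB hm =>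
    hn' (hlow (Vert.copy_le_of_lt hP hB n' m) hm)
  have hA : IsFiniteLower (hull f \ chain) :=
    { lower := by
        rintro v w hvw ⟨hw, hwc⟩
        refine ⟨hlow hvw hw, ?_⟩
        rintro ⟨m, rfl⟩
        cases w with
        | infty => exact h hw
        | copy B' k =>
          rcases Vert.of_copy_le hP hvw with h1 | ⟨rfl, -⟩
          · exact hmax B' k h1 hw
          · exact hwc ⟨k, rfl⟩
      infty_notMem := fun h' => h h'.1 }
  have hC : IsFiniteLower (hull f ∪ chain \ hull f) :=
    { lower := by
        rintro v w hvw (hw | ⟨⟨m, rfl⟩, hw⟩)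
        · exact .inl (hlow hvw hw)
        · by_cases hv : v ∈ hull f
          · exact .inl hv
          · refine .inr ⟨?_, hv⟩
            cases v with
            | infty => cases Vert.infty_le hvw
            | copy B' k =>
              rcases Vert.of_copy_le hP hvw with h1 | ⟨rfl, -⟩
              · exact absurd (hlow (Vert.copy_le_of_lt hP h1 k n) hn) hv
              · exact ⟨k, rfl⟩
      infty_notMem := by
        rintro (h' | ⟨⟨m, h'⟩, -⟩)
        · exact h h'
        · cases h' }
  have hU := excess_hull hf h
  have h1 : excess (hull f \ chain) < (white i M \ f '' red i M).ncard := by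
    by_contra! h1
    exact (hull_subset_of_excess hf hA h1 hn).2 ⟨n, rfl⟩
  have h2 : excess (hull f) = excess (hull f \ chain) + excess (hull f ∩ chain) := by
    rw [← excess_union (Set.disjoint_sdiff_inter), Set.sdiff_union_inter]
  have h3 : excess (hull f ∪ chain \ hull f) = excess (hull f) + excess (chain \ hull f) :=
    excess_union Set.disjoint_sdiff_right
  have h4 := excess_le hf hC
  -- some vertex of the chain in the hull is white but not red
  obtain ⟨m, hmU, hmw, hmr⟩ : ∃ m : Fin (chainLength i M B), Vert.copy B m ∈ hull f ∧
      (m : ℕ) < B.rep.mult M ∧ B.rep.mult M.tauInv ≤ m := by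
    by_contra! h5
    have h6 : (white i M ∩ (hull f ∩ chain)).ncard ≤ (red i M ∩ (hull f ∩ chain)).ncard := by
      refine Set.ncard_le_ncard ?_ (Set.toFinite _)
      rintro v ⟨⟨B', m, rfl, hm⟩, hv, m', hm'⟩
      cases hm'
      exact ⟨⟨B, m', rfl, h5 m' hv hm⟩, hv, m', rfl⟩
    have h7 : excess (hull f ∩ chain) ≤ 0 := by
      rw [excess]
      omega
    omega
  have hgt : ∀ k : Fin (chainLength i M B), Vert.copy B k ∉ hull f → (m : ℕ) < k := fun k hk => by
    by_contra! hk'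
    exact hk (hlow (Vert.copy_le_copy hk') hmU)
  -- hence no vertex of the chain outside of the hull is red, and so none is white
  have h5 : red i M ∩ (chain \ hull f) = ∅ := by
    refine Set.eq_empty_of_forall_notMem ?_
    rintro v ⟨⟨B', k, rfl, hk⟩, ⟨k', hk'⟩, hv⟩
    cases hk'
    have := hgt k' hv
    omega
  have h6 : white i M ∩ (chain \ hull f) = ∅ := by
    rw [← Set.ncard_eq_zero (Set.toFinite _)]
    have h7 : excess (chain \ hull f) ≤ 0 := by omega
    rw [excess, h5, Set.ncard_empty] at h7
    omega
  have h7 : B.rep.mult M ≤ n' := by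
    by_contra! h7
    have h8 : Vert.copy B n' ∈ white i M ∩ (chain \ hull f) := ⟨⟨B, n', rfl, h7⟩, ⟨n', rfl⟩, hn'⟩
    rw [h6] at h8
    exact h8
  have h8 := hgt n' hn'
  have h9 := n'.2
  have h10 : chainLength i M B = max 1 (max (B.rep.mult M) (B.rep.mult M.tauInv)) := rfl
  omega

theorem exists_maximal_copy [Finite (P i)] (hP : IsPartialOrder (P i) P.le)
    {f : Vert i M → Vert i M} (h : Vert.infty ∉ hull f) {B : P i} {n : Fin (chainLength i M B)}
    (hn : Vert.copy B n ∈ hull f) (hfull : ∀ {B : P i} {n : Fin (chainLength i M B)},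
      Vert.copy B n ∈ hull f → ∀ n', Vert.copy B n' ∈ hull f) :
    B.leS (hullAntichain f) := by
  have : IsTrans (P i) fun C B : P i => B.lt C :=
    ⟨fun A B C h h' => P.lt_of_lt_of_le hP h' h.1⟩
  have : Std.Irrefl fun C B : P i => B.lt C := ⟨fun B h => h.2 rfl⟩
  have hwf : WellFounded fun C B : P i => B.lt C := Finite.wellFounded_of_trans_of_irrefl _
  obtain ⟨C, ⟨hBC, k, hk⟩, hmax⟩ := hwf.has_min {C | B.le C ∧ ∃ k, Vert.copy C k ∈ hull f}
    ⟨B, hP.refl B, n, hn⟩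
  have hl := chainLength_pos (M := M) C
  let last : Fin (chainLength i M C) := ⟨chainLength i M C - 1, by omega⟩
  refine ⟨C, ⟨last, hfull hk last, fun w hw hle => ?_⟩, hBC⟩
  cases w with
  | infty => exact absurd hw h
  | copy E m =>
    rcases Vert.of_copy_le hP hle with h1 | ⟨rfl, h1⟩
    · exact absurd h1 (hmax E ⟨hP.trans _ _ _ hBC h1.1, m, hw⟩)
    · have := m.2
      have : m = last := Fin.ext (le_antisymm (Nat.le_sub_one_of_lt m.2) h1)
      rw [this]

theorem fullDown_hullAntichain [Finite (P i)] (hP : IsPartialOrder (P i) P.le)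
    {f : Vert i M → Vert i M} (hf : IsMor (red i M) (white i M) f) (h : Vert.infty ∉ hull f) :
    fullDown M (hullAntichain f) = hull f := by
  ext v
  constructor
  · rintro ⟨B, n, rfl, B', ⟨n', hn', -⟩, hB⟩
    by_cases hBB : B = B'
    · subst hBB
      exact hull_full hP hf h hn' n
    · exact (hull_closed f).lower (Vert.copy_le_of_lt hP ⟨hB, hBB⟩ n n') hn'
  · intro hv
    cases v with
    | infty => exact absurd hv h
    | copy B n => exact ⟨B, n, rfl, exists_maximal_copy hP h hv fun hn => hull_full hP hf h hn⟩

theorem leS_antisymm (hP : IsPartialOrder (P i) P.le) {V V' : Set (P i)} (hV : V ∈ S i)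
    (hV' : V' ∈ S i) (h : leS V V') (h' : leS V' V) : V = V' := by
  have key : ∀ {V V' : Set (P i)}, V ∈ S i → leS V V' → leS V' V → V ⊆ V' :=
    fun {V V'} hV h h' B hB => by
      obtain ⟨B', hB', hBB'⟩ := h B hB
      obtain ⟨B'', hB'', hB'B''⟩ := h' B' hB'
      have h1 := hV.2.2 B hB B'' hB'' (hP.trans _ _ _ hBB' hB'B'')
      subst h1
      rwa [hP.antisymm _ _ hBB' hB'B'']
  exact (key hV h h').antisymm (key hV' h' h)

theorem exists_F_pos (h : 0 < aQ i M) : ∃ V ∈ S i, 0 < F i M V := by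
  by_contra! h'
  refine h.not_ge ?_
  rcases (F i M '' S i).eq_empty_or_nonempty with h0 | h0
  · rw [aQ, h0, Int.csSup_empty]
  · refine csSup_le h0 ?_
    rintro _ ⟨V, hV, rfl⟩
    exact h' V hV

theorem hullAntichain_spec (hq : EulerPosDef I) (hs : IsSpecialQuiver I) (hM : M.FinDim)
    (ha : 0 < aQ i M) {f : Vert i M → Vert i M} (hf : IsPrecMinimal f) :
    IsMaximizer i M (hullAntichain f) ∧
      ∀ V, IsMaximizer i M V → leS (hullAntichain f) V := by
  have := P.finite hq i
  have hP := P.isPartialOrder hq hs i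
  have h := infty_notMem_hull hP hf
  have hfull := fullDown_hullAntichain hP hf.1 h
  have hF : F i M (hullAntichain f) = (white i M \ f '' red i M).ncard := by
    rw [F_eq_excess hq hM, hfull, excess_hull hf.1 h]
  have hle : ∀ V, F i M V ≤ (white i M \ f '' red i M).ncard := fun V => by
    rw [F_eq_excess hq hM]
    exact excess_le hf.1 (fullDown_isFiniteLower hP V)
  have hS : hullAntichain f ∈ S i := by
    refine ⟨Set.toFinite _, ?_, ?_⟩
    · obtain ⟨V, -, hV⟩ := exists_F_pos ha
      have h1 : (white i M \ f '' red i M).ncard ≠ 0 := fun h0 => by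
        have := hle V
        rw [h0] at this
        omega
      obtain ⟨v, hv⟩ := Set.nonempty_of_ncard_ne_zero h1
      obtain ⟨⟨B, n, rfl, -⟩, -⟩ := id hv
      obtain ⟨C, hC, -⟩ := exists_maximal_copy hP h (subset_hull f hv)
        fun hn => hull_full hP hf.1 h hn
      exact ⟨C, hC⟩
    · rintro B ⟨n, hn, hmax⟩ B' ⟨n', hn', -⟩ hBB'
      by_contra hne
      have h1 := hmax _ hn' (Vert.copy_le_of_lt hP ⟨hBB', hne⟩ n n')
      cases h1
      exact hne rfl
  refine ⟨⟨hS, fun V _ => hF ▸ hle V⟩, fun V hV B hB => ?_⟩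
  have h1 : hull f ⊆ fullDown M V := hull_subset_of_excess hf.1 (fullDown_isFiniteLower hP V) (by
    rw [← F_eq_excess hq hM, ← hF]
    exact hV.2 _ hS)
  obtain ⟨n, hn, -⟩ := hB
  obtain ⟨B', n', h2, h3⟩ := h1 hn
  cases h2
  exact h3

theorem isMinimalMaximizer_iff (hq : EulerPosDef I) (hs : IsSpecialQuiver I) (hM : M.FinDim)
    (ha : 0 < aQ i M) {f : Vert i M → Vert i M} (hf : IsPrecMinimal f) (V : Set (P i)) :
    IsMinimalMaximizer i M V ↔ V = hullAntichain f := by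
  obtain ⟨h1, h2⟩ := hullAntichain_spec hq hs hM ha hf
  have hP := P.isPartialOrder hq hs i
  constructor
  · exact fun hV => (hV.2 _ h1 (h2 V hV.1)).symm
  · rintro rfl
    exact ⟨h1, fun V' hV' hle => leS_antisymm hP hV'.1 h1.1 hle (h2 V' hV')⟩

end excess

namespace QRep

section dynkin

/-! ### Positive definiteness of the Euler form of a Dynkin quiver -/

/-- The integral quadratic form `y ↦ yᵀ B y`. -/
def quadForm {n : ℕ} (B : Matrix (Fin n) (Fin n) ℤ) (y : Fin n → ℤ) : ℤ :=
  ∑ a, ∑ b, y a * B a b * y b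

/-- The form of `B` is positive definite and bounded below by the square of the coordinate `0`. This
condition is inherited when a new vertex is attached to vertex `0` by a simple edge. -/
def DominatesHead {n : ℕ} (B : Matrix (Fin (n + 1)) (Fin (n + 1)) ℤ) : Prop :=
  ∀ y, y 0 ^ 2 ≤ quadForm B y ∧ (quadForm B y = 0 → y = 0)

theorem DominatesHead.extend {n : ℕ} {B : Matrix (Fin (n + 1)) (Fin (n + 1)) ℤ}
    (hB : DominatesHead B) {C : Matrix (Fin (n + 2)) (Fin (n + 2)) ℤ} (h00 : C 0 0 = 2)
    (h0 : ∀ b : Fin (n + 1), C 0 b.succ = if (b : ℕ) = 0 then -1 else 0)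
    (h1 : ∀ a : Fin (n + 1), C a.succ 0 = if (a : ℕ) = 0 then -1 else 0)
    (h2 : ∀ a b : Fin (n + 1), C a.succ b.succ = B a b) : DominatesHead C := by
  intro y
  have key : quadForm C y = y 0 ^ 2 + (y 0 - y (Fin.succ 0)) ^ 2 +
      (quadForm B (fun a => y a.succ) - y (Fin.succ 0) ^ 2) := by
    have e1 : ∑ b : Fin (n + 1), y 0 * C 0 b.succ * y b.succ = -(y 0 * y (Fin.succ 0)) := by
      simp only [h0, Fin.val_eq_zero_iff]
      simp
    have e2 : ∑ a : Fin (n + 1), y a.succ * C a.succ 0 * y 0 = -(y (Fin.succ 0) * y 0) := by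
      simp only [h1, Fin.val_eq_zero_iff]
      simp
    simp only [quadForm]
    rw [Fin.sum_univ_succ, Fin.sum_univ_succ]
    simp only [Fin.sum_univ_succ (fun b => y (Fin.succ _) * C (Fin.succ _) b * y b)]
    rw [Finset.sum_add_distrib, e1, e2]
    simp only [h00, h2]
    ring
  obtain ⟨h3, h4⟩ := hB fun a => y a.succ
  refine ⟨by rw [key]; nlinarith [sq_nonneg (y 0 - y (Fin.succ 0))], fun hz => ?_⟩
  rw [key] at hz
  have hy0 : y 0 = 0 := pow_eq_zero_iff two_ne_zero |>.1
    (by nlinarith [sq_nonneg (y 0 - y (Fin.succ 0)), sq_nonneg (y 0)])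
  have hy1 : y (Fin.succ 0) = 0 := by
    have : (y 0 - y (Fin.succ 0)) ^ 2 = 0 := by
      nlinarith [sq_nonneg (y 0 - y (Fin.succ 0)), sq_nonneg (y 0)]
    have := pow_eq_zero_iff two_ne_zero |>.1 this
    omega
  rw [hy0, hy1] at hz
  have hy := h4 (by simpa using hz)
  funext a
  refine Fin.cases hy0 (fun b => congrFun hy b) a

theorem dominatesHead_A : ∀ n, DominatesHead (CartanMatrix.A (n + 1))
  | 0 => fun y => by
    have : quadForm (CartanMatrix.A (0 + 1)) y = y 0 ^ 2 + y 0 ^ 2 := by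
      simp [quadForm, CartanMatrix.A]; ring
    rw [this]
    refine ⟨by nlinarith [sq_nonneg (y 0)], fun h => ?_⟩
    have h0 : y 0 = 0 := pow_eq_zero_iff two_ne_zero |>.1 (by nlinarith [sq_nonneg (y 0)])
    funext a
    exact (congrArg y (Fin.fin_one_eq_zero a)).trans h0
  | n + 1 => by
    refine (dominatesHead_A n).extend ?_ ?_ ?_ ?_ <;>
      simp only [CartanMatrix.A, Matrix.of_apply, Fin.ext_iff, Fin.val_succ, Fin.coe_ofNat_eq_mod,
        Nat.zero_mod]
    · simp
    · intro b; grind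
    · intro b; grind
    · intro a b; grind

theorem dominatesHead_D : ∀ n, DominatesHead (CartanMatrix.D (n + 3))
  | 0 => fun y => by
    have : quadForm (CartanMatrix.D (0 + 3)) y =
        y 0 ^ 2 + (y 0 - y 1 - y 2) ^ 2 + (y 1 - y 2) ^ 2 := by
      simp [quadForm, CartanMatrix.D, Fin.sum_univ_three]; ring
    rw [this]
    refine ⟨by nlinarith [sq_nonneg (y 0 - y 1 - y 2), sq_nonneg (y 1 - y 2)], fun h => ?_⟩
    have s0 := sq_nonneg (y 0)
    have s1 := sq_nonneg (y 0 - y 1 - y 2)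
    have s2 := sq_nonneg (y 1 - y 2)
    have t0 := pow_eq_zero_iff two_ne_zero |>.1 (show y 0 ^ 2 = 0 by linarith)
    have t1 := pow_eq_zero_iff two_ne_zero |>.1 (show (y 0 - y 1 - y 2) ^ 2 = 0 by linarith)
    have t2 := pow_eq_zero_iff two_ne_zero |>.1 (show (y 1 - y 2) ^ 2 = 0 by linarith)
    funext a
    fin_cases a <;> simp <;> omega
  | n + 1 => by
    refine (dominatesHead_D n).extend ?_ ?_ ?_ ?_ <;>
      simp only [CartanMatrix.D, Matrix.of_apply, Fin.ext_iff, Fin.val_succ, Fin.coe_ofNat_eq_mod,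
        Nat.zero_mod]
    · simp
    · intro b; grind
    · intro b; grind
    · intro a b; grind

/-- The sum of squares comes from completing the square along the three arms of the diagram, from the
ends towards the branch vertex `3`. -/
theorem eq_zero_of_quadForm_E₈ (y : Fin 8 → ℤ) (h : quadForm CartanMatrix.E₈ y ≤ 0) : y = 0 := by
  have key : 60 * quadForm CartanMatrix.E₈ y =
      30 * (2 * y 0 - y 2) ^ 2 + 30 * (2 * y 1 - y 3) ^ 2 + 10 * (3 * y 2 - 2 * y 3) ^ 2 +
      30 * (2 * y 7 - y 6) ^ 2 + 10 * (3 * y 6 - 2 * y 5) ^ 2 + 5 * (4 * y 5 - 3 * y 4) ^ 2 +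
      3 * (5 * y 4 - 4 * y 3) ^ 2 + 2 * y 3 ^ 2 := by
    simp [quadForm, CartanMatrix.E₈, Fin.sum_univ_eight]; ring
  have s1 := sq_nonneg (2 * y 0 - y 2)
  have s2 := sq_nonneg (2 * y 1 - y 3)
  have s3 := sq_nonneg (3 * y 2 - 2 * y 3)
  have s4 := sq_nonneg (2 * y 7 - y 6)
  have s5 := sq_nonneg (3 * y 6 - 2 * y 5)
  have s6 := sq_nonneg (4 * y 5 - 3 * y 4)
  have s7 := sq_nonneg (5 * y 4 - 4 * y 3)
  have s8 := sq_nonneg (y 3)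
  have t1 := pow_eq_zero_iff two_ne_zero |>.1 (show (2 * y 0 - y 2) ^ 2 = 0 by linarith)
  have t2 := pow_eq_zero_iff two_ne_zero |>.1 (show (2 * y 1 - y 3) ^ 2 = 0 by linarith)
  have t3 := pow_eq_zero_iff two_ne_zero |>.1 (show (3 * y 2 - 2 * y 3) ^ 2 = 0 by linarith)
  have t4 := pow_eq_zero_iff two_ne_zero |>.1 (show (2 * y 7 - y 6) ^ 2 = 0 by linarith)
  have t5 := pow_eq_zero_iff two_ne_zero |>.1 (show (3 * y 6 - 2 * y 5) ^ 2 = 0 by linarith)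
  have t6 := pow_eq_zero_iff two_ne_zero |>.1 (show (4 * y 5 - 3 * y 4) ^ 2 = 0 by linarith)
  have t7 := pow_eq_zero_iff two_ne_zero |>.1 (show (5 * y 4 - 4 * y 3) ^ 2 = 0 by linarith)
  have t8 := pow_eq_zero_iff two_ne_zero |>.1 (show y 3 ^ 2 = 0 by linarith)
  funext a
  fin_cases a <;> simp <;> omega

theorem eq_zero_of_quadForm_E₇ (y : Fin 7 → ℤ) (h : quadForm CartanMatrix.E₇ y ≤ 0) : y = 0 := by
  have key : quadForm CartanMatrix.E₈ (Fin.snoc y 0 : Fin 8 → ℤ) = quadForm CartanMatrix.E₇ y := by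
    rw [show (Fin.snoc y 0 : Fin 8 → ℤ) = ![y 0, y 1, y 2, y 3, y 4, y 5, y 6, 0] by
      funext a; fin_cases a <;> rfl]
    simp [quadForm, CartanMatrix.E₈, CartanMatrix.E₇, Fin.sum_univ_eight, Fin.sum_univ_seven]
  have := eq_zero_of_quadForm_E₈ _ (key.trans_le h)
  funext a
  simpa using congrFun this a.castSucc

theorem eq_zero_of_quadForm_E₆ (y : Fin 6 → ℤ) (h : quadForm CartanMatrix.E₆ y ≤ 0) : y = 0 := by
  have key : quadForm CartanMatrix.E₇ (Fin.snoc y 0 : Fin 7 → ℤ) = quadForm CartanMatrix.E₆ y := by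
    rw [show (Fin.snoc y 0 : Fin 7 → ℤ) = ![y 0, y 1, y 2, y 3, y 4, y 5, 0] by
      funext a; fin_cases a <;> rfl]
    simp [quadForm, CartanMatrix.E₇, CartanMatrix.E₆, Fin.sum_univ_seven, Fin.sum_univ_six]
  have := eq_zero_of_quadForm_E₇ _ (key.trans_le h)
  funext a
  simpa using congrFun this a.castSucc

variable {I : Type} [Fintype I] [Quiver.{0} I] [∀ s t : I, Fintype (s ⟶ t)]

theorem two_mul_euler_self (x : I → ℤ) :
    2 * euler x x = ∑ v, ∑ w, x v * quiverCartan I v w * x w := by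
  classical
  have h1 : ∀ v w, x v * quiverCartan I v w * x w = (if v = w then 2 * (x v * x w) else 0) -
      arrowCount v w * (x v * x w) - arrowCount w v * (x w * x v) := fun v w => by
    unfold quiverCartan arrowCount
    split_ifs <;> ring
  simp only [h1, Finset.sum_sub_distrib, Finset.sum_ite_eq, Finset.mem_univ, if_true]
  rw [euler_apply, sum_arr (f := fun s t => x s * x t),
    Finset.sum_comm (f := fun v w => arrowCount w v * (x w * x v)), ← Finset.mul_sum]
  ring

theorem eulerPosDef_of_reindex {n : ℕ} {B : Matrix (Fin n) (Fin n) ℤ} (e : I ≃ Fin n)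
    (he : (quiverCartan I).reindex e e = B) (hB : ∀ y, quadForm B y ≤ 0 → y = 0) :
    EulerPosDef I := by
  intro x hx
  by_contra! hneg
  have h1 : quadForm B (x ∘ e.symm) = 2 * euler x x := by
    rw [two_mul_euler_self, quadForm, ← he, ← e.symm.sum_comp]
    refine Finset.sum_congr rfl fun a _ => ?_
    rw [← e.symm.sum_comp]
    rfl
  have h2 := hB _ (h1.trans_le (by linarith))
  refine hx (funext fun v => ?_)
  simpa using congrFun h2 (e v)

/-- The Euler form of a Dynkin quiver is positive definite. -/
theorem eulerPosDef_of_isDynkinQuiver (h : IsDynkinQuiver I) : EulerPosDef I := by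
  have head : ∀ {n : ℕ} {B : Matrix (Fin (n + 1)) (Fin (n + 1)) ℤ}, DominatesHead B →
      ∀ y, quadForm B y ≤ 0 → y = 0 := fun hB y hy =>
    (hB y).2 (le_antisymm hy ((sq_nonneg _).trans (hB y).1))
  rcases h with ⟨n, hn, e, he⟩ | ⟨n, hn, e, he⟩ | ⟨e, he⟩ | ⟨e, he⟩ | ⟨e, he⟩
  · obtain ⟨k, rfl⟩ := Nat.exists_eq_add_of_le' hn
    exact eulerPosDef_of_reindex e he (head (dominatesHead_A k))
  · obtain ⟨k, rfl⟩ := Nat.exists_eq_add_of_le' (Nat.le_of_succ_le hn : 3 ≤ n)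
    exact eulerPosDef_of_reindex e he (head (dominatesHead_D k))
  · exact eulerPosDef_of_reindex e he eq_zero_of_quadForm_E₆
  · exact eulerPosDef_of_reindex e he eq_zero_of_quadForm_E₇
  · exact eulerPosDef_of_reindex e he eq_zero_of_quadForm_E₈

end dynkin

end QRep

end QuiverCrystal

end

theorem lemma3 {I : Type} [Fintype I] [Quiver.{0} I] [∀ s t : I, Fintype (s ⟶ t)]
    (hDynkin : IsDynkinQuiver I) (hSpecial : IsSpecialQuiver I) (i : I)
    (M : QRep I) (hM : M.FinDim) (ha : 0 < aQ i M) :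
    (∀ φ : MinimalHom i M,
      Vert.infty ∉ hull φ.f ∧
      ∀ V : Set (P i), IsMinimalMaximizer i M V ↔ V = hullAntichain φ.f) ∧
    ∀ φ φ' : MinimalHom i M, hullAntichain φ.f = hullAntichain φ'.f := by
  have hq := QRep.eulerPosDef_of_isDynkinQuiver hDynkin
  have := P.finite hq i
  have key : ∀ (φ : MinimalHom i M) (V : Set (P i)),
      IsMinimalMaximizer i M V ↔ V = hullAntichain φ.f := fun φ =>
    isMinimalMaximizer_iff hq hSpecial hM ha φ.minimal
  exact ⟨fun φ => ⟨infty_notMem_hull (P.isPartialOrder hq hSpecial i) φ.minimal, key φ⟩,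
    fun φ φ' => (key φ' _).1 ((key φ _).2 rfl)⟩
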